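/- Let $V$ be a finite set and let $\mathcal M$ be an asynchronous distributed system of two deterministic processes $p_1,p_2$ (arbitrary state machines, each with a nonempty finite set of possible initial states) and one 2-consensus object $O$ with value set $V$. The processes send no messages to each other, and in every execution each of them invokes $O$ at most once. A process that invokes $O$ with a proposal $v\in V$ waits for the answer; $O$ never fails, answers pending invocations in any order, and gives the same value to all, namely the proposal of the process that it answers first. At most one process may crash, at any time. A configuration is a triple $\langle q_1,q_2,o\rangle$ that occurs in some execution of $\mathcal M$; the local states $q_i$ and the state $o$ of $O$ include their histories (the states $p_i$ went through; the answers sent so far, in order). Events are computation steps of a process (local, invocation, receipt of an answer), answers of $O$, and crashes. Then there is a two-dimensional tile assembly system $\mathcal T$ at temperature 2 (a finite set of tile types with glue names and strengths $0,1,2$ on their sides, a symmetric relation telling which glues bind, and a finite nonempty stable seed assembly) that simulates $\mathcal M$. In assembly sequences of $\mathcal T$ a tile is added either correctly (binding strength at least $2$, at a site not adjacent to a blockage) or as a blockage: a tile that sticks with strength less than $2$ to a free site, abutting on a nonzero glue with which it does not bind. A tile configuration is stable if every cut of its correctly bound tiles has strength at least $2$. Simulation means that there is a map $h$ from the configurations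 of $\mathcal M$ to tile configurations of $\mathcal T$ such that: 1. $h$ is injective, all $h(C)$ are stable, and $h(C)$ is produced from the seed without blockages if $C$ is initial. 2. If an event $\phi$ leads from $C$ to $C'$, then $h(C)\longrightarrow h(C')$ by a legal assembly sequence, which can be chosen without blockages unless $\phi$ is a crash. 3. If there is no legal execution segment from $C$ to $C'$, then there is no assembly sequence $h(C)\longrightarrow h(C')$, not even one with blockages. 4. Let $\mathcal C$ be a set of configurations. If every fair crash-free execution from $C$ meets $\mathcal C$, then every fair blockage-free assembly sequence from $h(C)$ achieves $h(C')$ for some $C'\in\mathcal C$ that is reachable from $C$: some stage of the sequence arises from $h(C')$ by (zero or more) legal tile additions. (Fair: no computation step or answer stays possible forever without being taken; no site stays open to binding forever.) 5. If a crash leads from $C$ to $C'$, then $h(C')$ contains exactly one more blockage than $h(C)$. 6. If in $C$ every process has halted (or, more generally, has halted or crashed, and $O$ has no pending invocation), then $h(C)$ is terminal. Moreover $O$ is realized around a single decision site $l$, with distinct glue names $v$ for the values, and distinct glue names $\mathrm{Ack}\,v$: in $h(C)$ the site $l$ is empty as long as $O$ has not answered; if the first answer was the value $v$ to $p_1$ (to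 $p_2$), then the tile at $l$ is not a blockage, has nonzero strength on its north, south and west (east) sides and strength zero on the remaining side, glue name $v$ in the west (east) and $\mathrm{Ack}\,v$ in the north; and a ray of bonds named $\mathrm{Ack}\,w$ leads in $h(C)$ from $l$ to the west (east) of $l$ if and only if $O$ has answered $w$ to $p_1$ (to $p_2$). -/

import Mathlib

open Relation

universe u v

/-! ### Two asynchronous processes sharing one consensus object -/

/-- What a process does in a given state: it has halted, it makes a local computation step, or it
invokes the consensus object with the value `v`, waits for the returned value `w`, and then goes
on from the state `k w`. -/
inductive ProcAction (V : Type u) (S : Type v) where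
  | halt : ProcAction V S
  | step (s : S) : ProcAction V S
  | invoke (v : V) (k : V → S) : ProcAction V S

/-- A deterministic process over an arbitrary state set (finite automata and Turing machines are
instances) with finitely many possible initial states, one for each possible input. -/
structure DetProc (V : Type u) where
  State : Type v
  init : Set State
  init_finite : init.Finite
  init_nonempty : init.Nonempty
  next : State → ProcAction V State

/-- Two processes, which exchange no messages, and one consensus object with set of values `V`. -/
structure DistSystem (V : Type u) where
  proc : Fin 2 → DetProc.{u, v} V

/-- The interface of the consensus object to one process: no open invocation; invoked with `v`
and not answered yet; answered with `w`, where the process has not taken up the answer yet. -/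
inductive Port (V : Type u) where
  | idle : Port V
  | pending (v : V) : Port V
  | acked (w : V) : Port V

/-- The local state of a process, with the states it went through before (latest first), and
whether it has crashed. -/
structure ProcState (S : Type v) where
  cur : S
  past : List S
  crashed : Bool

/-- The state of the consensus object: its interfaces, and the answers it has sent so far,
oldest first. -/
structure ObjState (V : Type u) where
  port : Fin 2 → Port V
  log : List (Fin 2 × V)

/-- The value that the object sends in answer to the proposal `v`: the value decided before, if
there is one, and otherwise `v`, which thereby becomes the decision. -/
def ObjState.answer {V : Type u} (o : ObjState V) (v : V) : V :=
  match o.log.head? with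
  | none => v
  | some e => e.2

/-- Events: a computation step of a process (local, or an invocation, or the receipt of an
answer); the transmission of the decision value by the object to a process; a crash. -/
inductive Event where
  | comp (i : Fin 2) : Event
  | respond (i : Fin 2) : Event
  | crash (i : Fin 2) : Event

def Event.IsCrash : Event → Prop
  | .crash _ => True
  | _ => False

namespace DistSystem

variable {V : Type u} (M : DistSystem.{u, v} V)

/-- A configuration `⟨q₁, q₂, o⟩`. -/
structure Config where
  proc : (i : Fin 2) → ProcState (M.proc i).State
  obj : ObjState V

variable {M}

/-- The action that process `i` is at. -/
def Config.action (C : M.Config) (i : Fin 2) : ProcAction V (M.proc i).State :=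
  (M.proc i).next (C.proc i).cur

/-- DetProc `i` moves to the local state `s`. -/
def Config.advance (C : M.Config) (i : Fin 2) (s : (M.proc i).State) : M.Config :=
  ⟨Function.update C.proc i ⟨s, (C.proc i).cur :: (C.proc i).past, (C.proc i).crashed⟩, C.obj⟩

def Config.setPort (C : M.Config) (i : Fin 2) (x : Port V) : M.Config :=
  ⟨C.proc, ⟨Function.update C.obj.port i x, C.obj.log⟩⟩

def Config.addLog (C : M.Config) (i : Fin 2) (w : V) : M.Config :=
  ⟨C.proc, ⟨C.obj.port, C.obj.log ++ [(i, w)]⟩⟩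

def Config.setCrashed (C : M.Config) (i : Fin 2) : M.Config :=
  ⟨Function.update C.proc i ⟨(C.proc i).cur, (C.proc i).past, true⟩, C.obj⟩

/-- `Step C e C'`: the event `e` is possible in `C` and results in `C'`. At most one of the two
processes may crash; the object never fails. -/
inductive Step : M.Config → Event → M.Config → Prop
  | internal {C : M.Config} {i : Fin 2} {s : (M.proc i).State}
      (alive : (C.proc i).crashed = false) (port : C.obj.port i = .idle)
      (act : C.action i = .step s) :
      Step C (.comp i) (C.advance i s)
  | invoke {C : M.Config} {i : Fin 2} {v : V} {k : V → (M.proc i).State}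
      (alive : (C.proc i).crashed = false) (port : C.obj.port i = .idle)
      (act : C.action i = .invoke v k) :
      Step C (.comp i) (C.setPort i (.pending v))
  | receive {C : M.Config} {i : Fin 2} {v w : V} {k : V → (M.proc i).State}
      (alive : (C.proc i).crashed = false) (port : C.obj.port i = .acked w)
      (act : C.action i = .invoke v k) :
      Step C (.comp i) ((C.advance i (k w)).setPort i .idle)
  | respond {C : M.Config} {i : Fin 2} {v : V} (port : C.obj.port i = .pending v) :
      Step C (.respond i)
        ((C.addLog i (C.obj.answer v)).setPort i (.acked (C.obj.answer v)))
  | crash {C : M.Config} {i : Fin 2} (alive : ∀ j, (C.proc j).crashed = false) :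
      Step C (.crash i) (C.setCrashed i)

variable (M)

structure IsInitial (C : M.Config) : Prop where
  cur : ∀ i, (C.proc i).cur ∈ (M.proc i).init
  past : ∀ i, (C.proc i).past = []
  alive : ∀ i, (C.proc i).crashed = false
  port : ∀ i, C.obj.port i = .idle
  log : C.obj.log = []

/-- There is a legal execution segment from `C` to `C'`. -/
def Reaches (C C' : M.Config) : Prop := ReflTransGen (fun A B => ∃ e, Step A e B) C C'

def Reachable (C : M.Config) : Prop := ∃ C₀, M.IsInitial C₀ ∧ M.Reaches C₀ C

/-- In `C` the next computation step of process `i` is an invocation of the object. -/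
def AboutToInvoke (C : M.Config) (i : Fin 2) : Prop :=
  (C.proc i).crashed = false ∧ C.obj.port i = .idle ∧ ∃ v k, C.action i = .invoke v k

/-- In every execution each process invokes the object at most once. -/
def InvokesAtMostOnce : Prop :=
  ∀ (i : Fin 2) (C C' C'' : M.Config), M.Reachable C → M.AboutToInvoke C i →
    Step C (.comp i) C' → M.Reaches C' C'' → ¬ M.AboutToInvoke C'' i

/-- Nothing but a crash can happen any more: every process has halted or crashed, and the object
has no invocation left to answer. In particular this is so if all processes have halted. -/
def AllStopped (C : M.Config) : Prop :=
  ∀ i, (C.action i = .halt ∨ (C.proc i).crashed = true) ∧ ∀ v, C.obj.port i ≠ .pending v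

/-- A fair execution from `C` without crashes (`none` is an idle moment, so that finite
executions are included): no computation step and no answer of the object stays possible forever
without being taken. -/
structure FairRun (C : M.Config) (run : ℕ → M.Config) (ev : ℕ → Option Event) : Prop where
  start : run 0 = C
  idle : ∀ n, ev n = none → run (n + 1) = run n
  step : ∀ n e, ev n = some e → Step (run n) e (run (n + 1))
  no_crash : ∀ n e, ev n = some e → ¬ e.IsCrash
  fair : ∀ e : Event, ¬ e.IsCrash → ∀ n, ∃ m, n ≤ m ∧
    (ev m = some e ∨ ¬ ∃ C', Step (run m) e C')

/-- From `C` on, the system must eventually achieve a configuration in `S` unless a process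
crashes. -/
def MustAchieve (C : M.Config) (S : Set M.Config) : Prop :=
  ∀ run ev, M.FairRun C run ev → ∃ n, run n ∈ S

end DistSystem

/-! ### Two-dimensional tile assembly at temperature 2, with blockages -/

inductive Dir where
  | N | S | E | W
  deriving DecidableEq

instance : Fintype Dir where
  elems := {.N, .S, .E, .W}
  complete := by intro d; cases d <;> decide

def Dir.opp : Dir → Dir
  | .N => .S
  | .S => .N
  | .E => .W
  | .W => .E

def Dir.vec : Dir → ℤ × ℤ
  | .N => (0, 1)
  | .S => (0, -1)
  | .E => (1, 0)
  | .W => (-1, 0)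

/-- A finite set of tile types, with a glue name and a strength 0, 1 or 2 on each side, and a
symmetric relation that tells which glues can bind. -/
structure TileSet where
  Tile : Type
  finite : Finite Tile
  Glue : Type
  glue : Tile → Dir → Glue × Fin 3
  binds : Glue → Glue → Prop
  binds_symm : ∀ a b, binds a b → binds b a

namespace TileSet

variable (T : TileSet)

open Classical in
/-- The strength of the bond between `t` and a tile `t'` that lies next to it in direction `d`. -/
noncomputable def bond (t : T.Tile) (d : Dir) (t' : T.Tile) : ℕ :=
  if T.binds (T.glue t d).1 (T.glue t' d.opp).1 ∧ (T.glue t d).2 = (T.glue t' d.opp).2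
  then ((T.glue t d).2 : ℕ) else 0

/-- A placement of tiles in the plane. -/
abbrev Placement := ℤ × ℤ → Option T.Tile

/-- The strength with which `t`, placed at `p`, binds to the tile next to it in direction `d`. -/
noncomputable def bondAt (a : T.Placement) (t : T.Tile) (p : ℤ × ℤ) (d : Dir) : ℕ :=
  match a (p + d.vec) with
  | none => 0
  | some t' => T.bond t d t'

/-- The strength with which `t`, placed at `p`, binds to its neighbours. -/
noncomputable def strengthAt (a : T.Placement) (t : T.Tile) (p : ℤ × ℤ) : ℕ :=
  ∑ d : Dir, T.bondAt a t p d

/-- The strength of the bond from the site `p` to its neighbour in direction `d`. -/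
noncomputable def edgeStrength (a : T.Placement) (p : ℤ × ℤ) (d : Dir) : ℕ :=
  match a p with
  | none => 0
  | some t => T.bondAt a t p d

/-- Every cut into two nonempty parts (the tiles in `A` and the others) has total bond strength
at least 2. -/
def Placement.Stable {T : TileSet} (a : T.Placement) : Prop :=
  ∀ A : Set (ℤ × ℤ), (∃ p ∈ A, a p ≠ none) → (∃ p, p ∉ A ∧ a p ≠ none) →
    ∃ F : Finset ((ℤ × ℤ) × Dir), (∀ e ∈ F, e.1 ∈ A ∧ e.1 + e.2.vec ∉ A) ∧
      2 ≤ ∑ e ∈ F, T.edgeStrength a e.1 e.2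

/-- A tile configuration: the tiles in place, and the sites of those among them that are
blockages, that is, were bound erroneously. -/
structure Assembly where
  tile : T.Placement
  err : Finset (ℤ × ℤ)

variable {T}

namespace Assembly

/-- The tiles that were bound correctly. -/
def correct (α : T.Assembly) : T.Placement :=
  fun p => if p ∈ α.err then none else α.tile p

/-- A configuration is stable if its correctly bound tiles form a stable placement; its blockages
are by definition bound with too little strength. -/
def Stable (α : T.Assembly) : Prop := α.correct.Stable

/-- The tile `t` can bind at `p`: the site is free, the binding strength is at least 2, and the
site is not next to a blockage, which stops all binding around it. -/
def CanAttach (α : T.Assembly) (p : ℤ × ℤ) (t : T.Tile) : Prop :=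
  α.tile p = none ∧ (∀ d : Dir, p + d.vec ∉ α.err) ∧ 2 ≤ T.strengthAt α.tile t p

/-- Legal addition of one tile. -/
def Attach (α β : T.Assembly) : Prop :=
  ∃ p t, α.CanAttach p t ∧ β.tile = Function.update α.tile p (some t) ∧ β.err = α.err

/-- A blockage: a tile sticks to a free site with strength less than 2, and on one of its sides
it abuts on a nonzero glue of the configuration with which it does not bind. -/
def Block (α β : T.Assembly) : Prop :=
  ∃ p t, α.tile p = none ∧ T.strengthAt α.tile t p < 2 ∧
    (∃ d t', α.tile (p + d.vec) = some t' ∧ (T.glue t' d.opp).2 ≠ 0 ∧ T.bond t d t' = 0) ∧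
    β.tile = Function.update α.tile p (some t) ∧ β.err = insert p α.err

/-- `α ⟶ β` through an assembly sequence in which blockages may occur. -/
def Produces (α β : T.Assembly) : Prop := ReflTransGen (fun a b => Attach a b ∨ Block a b) α β

/-- `α ⟶ β` through an assembly sequence without blockages. -/
def ProducesCleanly (α β : T.Assembly) : Prop := ReflTransGen Attach α β

/-- No tile can be stably added. -/
def Terminal (α : T.Assembly) : Prop := ¬ ∃ p t, α.CanAttach p t

/-- A fair assembly sequence from `α` without blockages (idle moments are allowed, so that
finite sequences are included): no site stays open to binding forever. -/
structure FairSeq (α : T.Assembly) (seq : ℕ → T.Assembly) : Prop where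
  start : seq 0 = α
  step : ∀ n, seq (n + 1) = seq n ∨ Attach (seq n) (seq (n + 1))
  fair : ∀ p n, ∃ m, n ≤ m ∧ ¬ ∃ t, (seq m).CanAttach p t

/-- The tiles at `p` and `q` are neighbours and bound to each other by glues named `g`. -/
def Linked (α : T.Assembly) (g : T.Glue) (p q : ℤ × ℤ) : Prop :=
  ∃ d t t', q = p + d.vec ∧ α.tile p = some t ∧ α.tile q = some t' ∧
    (T.glue t d).1 = g ∧ (T.glue t' d.opp).1 = g ∧ 0 < T.bond t d t'

end Assembly

end TileSet

/-- A tile assembly system: a tile set with a finite, nonempty, stable seed assembly. -/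
structure TileSystem extends TileSet where
  seed : toTileSet.Placement
  seed_finite : {p | seed p ≠ none}.Finite
  seed_nonempty : {p | seed p ≠ none}.Nonempty
  seed_stable : seed.Stable

def TileSystem.seedAssembly (T : TileSystem) : T.Assembly := ⟨T.seed, ∅⟩

/-! ### Simulation -/

/-- The tile assembly system `T` simulates `M` by means of the map `h`. The configurations of `M`
are those that occur in its executions. -/
structure TileSystem.SimulatesVia {V : Type u} (T : TileSystem) (M : DistSystem.{u, v} V)
    (h : M.Config → T.Assembly) : Prop where
  injective : Set.InjOn h {C | M.Reachable C}
  stable : ∀ C, M.Reachable C → (h C).Stable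
  /-- The initial configurations are built from the seed. -/
  initial : ∀ C, M.IsInitial C → T.seedAssembly.ProducesCleanly (h C)
  /-- An event of `M` is simulated by an assembly sequence, which is free of blockages unless
  the event is a crash. -/
  sound : ∀ C e C', M.Reachable C → DistSystem.Step C e C' →
    (h C).Produces (h C') ∧ (¬ e.IsCrash → (h C).ProducesCleanly (h C'))
  /-- What is impossible in `M` is impossible in `T`. -/
  complete : ∀ C C', M.Reachable C → M.Reachable C' → ¬ M.Reaches C C' →
    ¬ (h C).Produces (h C')
  /-- If `M` must get from `C` to a configuration in `S` unless there is a crash, then `T` must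
  get from `h C` to some `h C'` with `C'` in `S` unless there is a blockage. The sections of an
  assembly grow asynchronously; so `T` has achieved `h C'` as soon as the assembly arises from
  `h C'` by legal additions, that is, up to the order in which independent tiles are added. -/
  progress : ∀ C S, M.Reachable C → M.MustAchieve C S →
    ∀ seq, (h C).FairSeq seq →
      ∃ C' ∈ S, M.Reaches C C' ∧ ∃ n, (h C').ProducesCleanly (seq n)
  /-- A crash is one more blockage. -/
  crash : ∀ C i C', M.Reachable C → DistSystem.Step C (.crash i) C' →
    (h C').err.card = (h C).err.card + 1
  terminal : ∀ C, M.Reachable C → M.AllStopped C → (h C).Terminal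

/-- The side on which process `i` lies: process 0 in the west, process 1 in the east. -/
def sideOf (i : Fin 2) : Dir := if i = 0 then .W else .E

/-- The site `p` lies strictly on the side of process `i` as seen from `l`. -/
def OnSide (i : Fin 2) (l p : ℤ × ℤ) : Prop := if i = 0 then p.1 < l.1 else l.1 < p.1

/-- The object is realized around a single decision site `l`. The site is empty until the object
first answers. If that is an answer to process `i` with value `v`, the tile at `l` has nonzero
strength on its north and south sides and on that of `i` but not on the opposite one, with glue
name `v` on the side of `i` and `Ack v` in the north. A ray of bonds named `Ack w` leads from `l`
to the side of process `j` exactly if the object has answered `w` to `j`. -/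
def TileSystem.DecidesAt {V : Type u} (T : TileSystem) (M : DistSystem.{u, v} V)
    (h : M.Config → T.Assembly) (l : ℤ × ℤ) (val ack : V → T.Glue) : Prop :=
  ∀ C, M.Reachable C →
    l ∉ (h C).err ∧
    ((h C).tile l = none ↔ C.obj.log = []) ∧
    (∀ i v, C.obj.log.head? = some (i, v) → ∃ t, (h C).tile l = some t ∧
      (T.glue t .N).2 ≠ 0 ∧ (T.glue t .S).2 ≠ 0 ∧ (T.glue t (sideOf i)).2 ≠ 0 ∧
      (T.glue t (sideOf i).opp).2 = 0 ∧
      (T.glue t (sideOf i)).1 = val v ∧ (T.glue t .N).1 = ack v) ∧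
    (∀ j w, (j, w) ∈ C.obj.log ↔
      ∃ p, OnSide j l p ∧ ReflTransGen ((h C).Linked (ack w)) l p)

/-! ### Tile assembly: monotonicity, stability and confluence -/

/-! A process is deterministic and is answered at most once. Its local history is therefore
determined by its initial state, the answer of the object, and the number of events (apart from
crashes) that have concerned it. There are finitely many initial states and answers, so there are
finitely many complete histories, however large the state machine is. Each history can be written in
unary: a track of tiles, one tile per event, every tile carrying the initial state, the answer where
it is known, and an index. Infinite histories need only finitely many tile types, because a process
that has not halted by a common `horizon` never halts; from the index `K` on, one tile type repeats
itself.

Let `m` bound the times of invocation. The track of a process starts next to the seed in column ±2,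
rises to height `m`, turns inward to column ±1, rises to height `m + 2`, and then runs outward
forever. Padding of length `off` makes every invocation appear as the tile with index `m + 2`, which
lies beside the decision site `mid`; a process that never invokes begins its events beyond this
region. The pending tile offers its proposal to `mid` with strength 2, and the proposal that is
bound first decides. The tile above, at `top`, offers the acknowledgement to both sides with
strength 1. The answer tile, with index `m + 3`, gets strength 1 from the pending tile and 1 from
`top`: at temperature 2 it must wait for both.

A crash puts an inert wall on the next site of the track. The object must survive the crash, so at
the lengths from `m + 2` to `m + 4` the wall is put on `trap` instead. This site is adjacent to
those of the invocation tile and of the receipt tile, but not to that of the answer tile, nor to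
`mid` or `top`. Thus a pending invocation can still be answered, while the crashed process cannot
invoke or receive.

The invariant `Inv` translates between configurations and tracks (`Inv.answered_iff`,
`Inv.pending_iff`, `Inv.cont_iff`), and `Valid.attach_cases` shows that only the intended tiles can
be added. For completeness, an assembly sequence between two represented configurations yields the
relation `Precedes`. From it an execution is built event by event: the process that decides takes
precedence, and a new crash comes last. For progress, a fair assembly sequence overtakes the events
of an execution (`Inv.overtake_comp`, `Inv.overtake_respond`), provided that the first answer goes
to the same process. `exists_between_dec` arranges this by first running only the process that the
sequence chooses. Confluence (`ProducesCleanly.of_sub`) then turns inclusion of placements into an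
assembly sequence. -/

theorem Dir.opp_opp (d : Dir) : d.opp.opp = d := by cases d <;> rfl

theorem Dir.add_vec_opp (p : ℤ × ℤ) (d : Dir) : p + d.vec + d.opp.vec = p := by
  cases d <;> simp [Dir.vec, Dir.opp, add_assoc]

theorem Dir.opp_ne (d : Dir) : d.opp ≠ d := by cases d <;> decide

theorem Dir.vec_injective : Function.Injective Dir.vec := by
  intro d d' h
  cases d <;> cases d' <;> simp_all [Dir.vec]

namespace TileSet

variable {T : TileSet}

theorem bond_symm (t : T.Tile) (d : Dir) (t' : T.Tile) : T.bond t d t' = T.bond t' d.opp t := by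
  unfold bond
  rw [Dir.opp_opp]
  by_cases h : T.binds (T.glue t d).1 (T.glue t' d.opp).1 ∧ (T.glue t d).2 = (T.glue t' d.opp).2
  · rw [if_pos h, if_pos ⟨T.binds_symm _ _ h.1, h.2.symm⟩, h.2]
  · rw [if_neg h, if_neg fun h' => h ⟨T.binds_symm _ _ h'.1, h'.2.symm⟩]

/-- The placement `a'` extends `a`. -/
def Placement.Sub (a a' : T.Placement) : Prop := ∀ p t, a p = some t → a' p = some t

theorem bondAt_mono {a a' : T.Placement} (h : a.Sub a') (t : T.Tile) (p : ℤ × ℤ) (d : Dir) :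
    T.bondAt a t p d ≤ T.bondAt a' t p d := by
  unfold bondAt
  cases ha : a (p + d.vec) with
  | none => simp
  | some t' => simp [h _ _ ha]

theorem strengthAt_mono {a a' : T.Placement} (h : a.Sub a') (t : T.Tile) (p : ℤ × ℤ) :
    T.strengthAt a t p ≤ T.strengthAt a' t p :=
  Finset.sum_le_sum fun d _ => bondAt_mono h t p d

theorem edgeStrength_mono {a a' : T.Placement} (h : a.Sub a') (p : ℤ × ℤ) (d : Dir) :
    T.edgeStrength a p d ≤ T.edgeStrength a' p d := by
  unfold edgeStrength
  cases ha : a p with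
  | none => simp
  | some t => simpa [h _ _ ha] using bondAt_mono h t p d

theorem Placement.sub_update {a : T.Placement} {p : ℤ × ℤ} (hp : a p = none) (t : T.Tile) :
    a.Sub (Function.update a p (some t)) := by
  intro q s hq
  have : q ≠ p := by rintro rfl; simp [hp] at hq
  simpa [this] using hq

/-- A cut either separates two old tiles, and then the old bonds suffice, or it isolates the new
tile, and then it crosses all bonds of the new tile. In the second case the new tile may lie on
either side of the cut, and the edges are oriented accordingly. -/
theorem Placement.Stable.update {a : T.Placement} (ha : a.Stable) {p : ℤ × ℤ} {t : T.Tile}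
    (hp : a p = none) (ht : 2 ≤ T.strengthAt a t p) :
    Placement.Stable (Function.update a p (some t)) := by
  classical
  have hsub := Placement.sub_update hp t
  have hocc : ∀ q, Function.update a p (some t) q ≠ none → q ≠ p → a q ≠ none := by
    intro q hq hqp
    simpa [hqp] using hq
  have hedge : ∀ d, T.edgeStrength (Function.update a p (some t)) p d = T.bondAt a t p d := by
    intro d
    have : p + d.vec ≠ p := by
      intro h
      have : d.vec = 0 := by simpa using h
      cases d <;> simp [Dir.vec] at this
    simp [edgeStrength, bondAt, this]
  rintro A ⟨q, hqA, hq⟩ ⟨r, hrA, hr⟩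
  by_cases h1 : ∃ q ∈ A, a q ≠ none
  · by_cases h2 : ∃ q, q ∉ A ∧ a q ≠ none
    · obtain ⟨F, hF, hs⟩ := ha A h1 h2
      exact ⟨F, hF, hs.trans (Finset.sum_le_sum fun e _ => edgeStrength_mono hsub _ _)⟩
    · push Not at h2
      have hrp : r = p := by
        by_contra hne
        exact hocc r hr hne (h2 r hrA)
      subst hrp
      refine ⟨(Finset.univ.filter fun d : Dir => r + d.vec ∈ A).image
        fun d => (r + d.vec, d.opp), ?_, ?_⟩
      · intro e he
        simp only [Finset.mem_image, Finset.mem_filter, Finset.mem_univ, true_and] at he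
        obtain ⟨d, hd, rfl⟩ := he
        exact ⟨hd, by simpa [Dir.add_vec_opp] using hrA⟩
      · rw [Finset.sum_image]
        · refine ht.trans ?_
          unfold strengthAt
          rw [← Finset.sum_filter_add_sum_filter_not _ (fun d : Dir => r + d.vec ∈ A)]
          have hz : ∑ d with ¬ r + Dir.vec d ∈ A, T.bondAt a t r d = 0 := by
            refine Finset.sum_eq_zero fun d hd => ?_
            have := h2 (r + d.vec) (by simpa using hd)
            simp [bondAt, this]
          rw [hz, add_zero]
          refine Finset.sum_le_sum fun d _ => ?_
          unfold bondAt
          cases hd : a (r + d.vec) with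
          | none => simp
          | some t' =>
            have hu : Function.update a r (some t) (r + d.vec) = some t' := hsub _ _ hd
            simp only [edgeStrength, hu, bondAt, Dir.add_vec_opp, Function.update_self]
            rw [bond_symm]
        · intro d _ d' _ hdd
          simp only [Prod.mk.injEq] at hdd
          have := congrArg Dir.opp hdd.2
          simpa [Dir.opp_opp] using this
  · push Not at h1
    have hqp : q = p := by
      by_contra hne
      exact hocc q hq hne (h1 q hqA)
    subst hqp
    refine ⟨(Finset.univ.filter fun d : Dir => q + d.vec ∉ A).image fun d => (q, d), ?_, ?_⟩
    · intro e he
      simp only [Finset.mem_image, Finset.mem_filter, Finset.mem_univ, true_and] at he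
      obtain ⟨d, hd, rfl⟩ := he
      exact ⟨hqA, hd⟩
    · rw [Finset.sum_image]
      · refine ht.trans ?_
        unfold strengthAt
        rw [← Finset.sum_filter_add_sum_filter_not _ (fun d : Dir => q + d.vec ∉ A)]
        have hz : ∑ d with ¬ q + Dir.vec d ∉ A, T.bondAt a t q d = 0 := by
          refine Finset.sum_eq_zero fun d hd => ?_
          have := h1 (q + d.vec) (by simpa using hd)
          simp [bondAt, this]
        rw [hz, add_zero]
        exact Finset.sum_le_sum fun d _ => (hedge d).ge
      · intro d _ d' _ hdd
        simpa using hdd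

/-! ### Assembly sequences: invariants and confluence -/

namespace Assembly

theorem ext' {α β : T.Assembly} (h : α.tile = β.tile) (h' : α.err = β.err) : α = β := by
  cases α; cases β; simp_all

/-- A stable assembly whose blockages are occupied sites. -/
structure Sound (α : T.Assembly) : Prop where
  stable : α.Stable
  occupied : ∀ p ∈ α.err, α.tile p ≠ none

/-- No neighbour of the new tile is a blockage, so its whole binding strength comes from correctly
bound tiles. -/
theorem Sound.attach {α β : T.Assembly} (hα : α.Sound) (h : Attach α β) : β.Sound := by
  obtain ⟨p, t, ⟨hp, hn, hs⟩, ht, he⟩ := h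
  have hpe : p ∉ α.err := fun hpe => hα.occupied p hpe hp
  constructor
  · have hc : β.correct = Function.update α.correct p (some t) := by
      funext q
      by_cases hq : q = p
      · subst hq; simp [correct, he, ht, hpe]
      · simp [correct, he, ht, hq]
    unfold Stable
    rw [hc]
    refine Placement.Stable.update hα.stable (by simp [correct, hp]) ?_
    have : T.strengthAt α.correct t p = T.strengthAt α.tile t p := by
      refine Finset.sum_congr rfl fun d _ => ?_
      simp [bondAt, correct, hn d]
    rwa [this]
  · intro q hq
    rw [he] at hq
    have : q ≠ p := by rintro rfl; exact hpe hq
    simpa [ht, this] using hα.occupied q hq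

theorem Sound.block {α β : T.Assembly} (hα : α.Sound) (h : Block α β) : β.Sound := by
  obtain ⟨p, t, hp, -, -, ht, he⟩ := h
  constructor
  · have hc : β.correct = α.correct := by
      funext q
      by_cases hq : q = p
      · subst hq; simp [correct, he, hp]
      · simp [correct, he, ht, hq]
    unfold Stable
    rw [hc]
    exact hα.stable
  · intro q hq
    rw [he, Finset.mem_insert] at hq
    by_cases hqp : q = p
    · simp [ht, hqp]
    · simpa [ht, hqp] using hα.occupied q (by tauto)

theorem Sound.produces {α β : T.Assembly} (hα : α.Sound) (h : Produces α β) : β.Sound := by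
  induction h with
  | refl => exact hα
  | tail _ hs ih => exact hs.elim ih.attach ih.block

theorem ProducesCleanly.produces {α β : T.Assembly} (h : ProducesCleanly α β) : Produces α β :=
  ReflTransGen.mono (fun _ _ => Or.inl) _ _ h

theorem Attach.sub {α β : T.Assembly} (h : Attach α β) : α.tile.Sub β.tile := by
  obtain ⟨p, t, hc, ht, -⟩ := h
  rw [ht]
  exact Placement.sub_update hc.1 t

theorem Produces.sub {α β : T.Assembly} (h : Produces α β) :
    α.tile.Sub β.tile ∧ α.err ⊆ β.err := by
  induction h with
  | refl => exact ⟨fun _ _ => id, fun _ => id⟩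
  | tail _ hs ih =>
    rcases hs with hs | hs
    · refine ⟨fun p t hp => hs.sub p t (ih.1 p t hp), ?_⟩
      obtain ⟨p, t, -, -, he⟩ := hs
      exact he ▸ ih.2
    · obtain ⟨p, t, hp, -, -, ht, he⟩ := hs
      refine ⟨fun q s hq => ?_, ?_⟩
      · rw [ht]
        exact Placement.sub_update hp t q s (ih.1 q s hq)
      · rw [he]
        exact ih.2.trans (Finset.subset_insert _ _)

theorem ProducesCleanly.sub {α β : T.Assembly} (h : ProducesCleanly α β) : α.tile.Sub β.tile :=
  h.produces.sub.1

/-- Nothing is bound correctly next to a blockage. -/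
theorem Produces.eq_none_of_adj {α β : T.Assembly} (h : Produces α β) {p : ℤ × ℤ} {d : Dir}
    (hp : α.tile p = none) (hd : p + d.vec ∈ α.err) (hβ : p ∉ β.err) : β.tile p = none := by
  induction h with
  | refl => exact hp
  | @tail γ β hγ hs ih =>
    rcases hs with ⟨q, t, hc, ht, he⟩ | ⟨q, t, hq, -, -, ht, he⟩
    · have hpq : p ≠ q := by
        rintro rfl
        exact hc.2.1 d ((Produces.sub hγ).2 hd)
      simpa [ht, hpq] using ih (he ▸ hβ)
    · rw [he, Finset.mem_insert] at hβ
      push Not at hβ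
      simpa [ht, hβ.1] using ih hβ.2

/-- Confluence: what an assembly sequence adds can be added in any order. -/
theorem ProducesCleanly.of_sub {α β : T.Assembly} (h : ProducesCleanly α β) :
    ∀ γ : T.Assembly, γ.err = α.err → α.tile.Sub γ.tile → γ.tile.Sub β.tile →
      ProducesCleanly γ β := by
  induction h using ReflTransGen.head_induction_on with
  | refl =>
    intro γ he h1 h2
    have : γ = β := by
      refine ext' (funext fun p => ?_) he
      cases hp : γ.tile p with
      | some t => exact (h2 _ _ hp).symm
      | none =>
        cases hq : β.tile p with
        | none => rfl
        | some t => rw [h1 _ _ hq] at hp; cases hp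
    rw [this]
    exact ReflTransGen.refl
  | @head α α₁ ha hr ih =>
    intro γ he h1 h2
    have hβ := ProducesCleanly.sub hr
    obtain ⟨p, t, ⟨hp, hn, hs⟩, ht, he1⟩ := ha
    have hβp : β.tile p = some t := hβ p t (by simp [ht])
    cases hγ : γ.tile p with
    | some t' =>
      refine ih γ (he.trans he1.symm) ?_ h2
      intro q s hq
      by_cases hqp : q = p
      · subst hqp
        have : s = t := by simpa [ht] using hq.symm
        rw [hγ, this, ← h2 _ _ hγ, hβp]
      · exact h1 q s (by simpa [ht, hqp] using hq)
    | none =>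
      -- A larger placement with the same blockages binds `t` at least as strongly and impedes it no
      -- more.
      have hcan : γ.CanAttach p t := ⟨hγ, he ▸ hn, hs.trans (strengthAt_mono h1 t p)⟩
      refine ReflTransGen.head (b := ⟨Function.update γ.tile p (some t), γ.err⟩)
        ⟨p, t, hcan, rfl, rfl⟩ (ih _ (he.trans he1.symm) ?_ ?_)
      · intro q s hq
        by_cases hqp : q = p
        · subst hqp; simpa [ht] using hq
        · simpa [hqp] using h1 q s (by simpa [ht, hqp] using hq)
      · intro q s hq
        by_cases hqp : q = p
        · subst hqp
          have : t = s := by simpa using hq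
          rw [← this, hβp]
        · exact h2 q s (by simpa [hqp] using hq)

theorem FairSeq.producesCleanly {α : T.Assembly} {seq : ℕ → T.Assembly} (h : α.FairSeq seq)
    (n : ℕ) : ProducesCleanly α (seq n) := by
  induction n with
  | zero => rw [h.start]; exact ReflTransGen.refl
  | succ n ih =>
    rcases h.step n with hs | hs
    · rwa [hs]
    · exact ReflTransGen.tail ih hs

end Assembly

end TileSet

/-! ### Tile sets made of two tracks that meet at a decision site -/

/-- The data of a tile set with two tracks. Process `i` in its initial state `s` invokes the object
with `prop i s`, if it does so at all; `cont i s w c` tells whether the track of process `i` goes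
on behind the tile with index `c` if the answer of the object is `w`. Indices from `K` on are
identified. -/
structure Blueprint where
  V : Type
  S : Fin 2 → Type
  finite_V : Finite V
  finite_S : ∀ i, Finite (S i)
  m : ℕ
  K : ℕ
  one_le_m : 1 ≤ m
  le_K : m + 5 ≤ K
  prop : ∀ i, S i → Option V
  cont : ∀ i, S i → Option V → ℕ → Prop

namespace Blueprint

variable (b : Blueprint)

/-! ### The tile types and their glues -/

inductive Tile
  | seed : Tile
  | wall : Tile
  | dec (i : Fin 2) (v : b.V) : Tile
  | north (v : b.V) : Tile
  | track (i : Fin 2) (s : b.S i) (w : Option b.V) (c : Fin (b.K + 1)) : Tile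

inductive Glue
  | blank : Glue
  | root : Glue
  | val (v : b.V) : Glue
  | prp (v : b.V) : Glue
  | ack (v : b.V) : Glue
  | link (i : Fin 2) (s : b.S i) (w : Option b.V) (c : ℕ) : Glue

/-- The glue `blank` binds to nothing. Values and proposals have different names, so that a decision
tile binds to a pending tile but never to another decision tile. -/
inductive Binds : b.Glue → b.Glue → Prop
  | root : Binds .root .root
  | valPrp (v : b.V) : Binds (.val v) (.prp v)
  | prpVal (v : b.V) : Binds (.prp v) (.val v)
  | ack (v : b.V) : Binds (.ack v) (.ack v)
  | link (i : Fin 2) (s : b.S i) (w : Option b.V) (c : ℕ) : Binds (.link i s w c) (.link i s w c)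

/-- The direction from the side of process `i` to the middle. -/
def inward (i : Fin 2) : Dir := (sideOf i).opp

/-- The side on which the track tile with index `c` is bound to its predecessor. -/
def innDir (i : Fin 2) (c : ℕ) : Dir :=
  if c = 0 then inward i else if c ≤ b.m then .S else if c = b.m + 1 then sideOf i
  else if c ≤ b.m + 3 then .S else inward i

/-- The side on which the track tile with index `c` is bound to its successor. -/
def outDir (i : Fin 2) (c : ℕ) : Dir :=
  if c < b.m then .N else if c = b.m then inward i else if c ≤ b.m + 2 then .N else sideOf i

-- The incoming and outgoing sides have strength 2, except between the pending tile and the answer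
-- tile of an invoking process, where 1 leaves the other unit to the acknowledgement. The incoming
-- glue of the answer tile carries no answer, since its predecessor knows none; the acknowledgement
-- alone selects the answer. Where a track ends, the outgoing glue is `blank` but keeps its nonzero
-- strength, so that a blockage there has something to abut on. The `blank` glue of strength 1 in
-- the north of tile `m` does the same for the site `trap`.
open Classical in
noncomputable def trackGlue (i : Fin 2) (s : b.S i) (w : Option b.V) (c : ℕ) (d : Dir) :
    b.Glue × Fin 3 :=
  if d = b.innDir i c then
    (if c = 0 then .root else .link i s (if c = b.m + 3 then none else w) c,
      if c = b.m + 3 ∧ (b.prop i s).isSome then 1 else 2)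
  else if d = b.outDir i c then
    (if b.cont i s w c then .link i s w (min (c + 1) b.K) else .blank,
      if c = b.m + 2 ∧ (b.prop i s).isSome then 1 else 2)
  else if c = b.m ∧ d = .N then (.blank, 1)
  else if c = b.m + 2 ∧ d = inward i then
    match b.prop i s with
    | none => (.blank, 0)
    | some v => (.prp v, 2)
  else if c = b.m + 3 ∧ d = inward i then
    match w with
    | none => (.blank, 0)
    | some v => (.ack v, 1)
  else (.blank, 0)

/-- A wall has strength 0 on all sides and is used only for blockages. The southern glue of a
decision tile has nonzero strength but binds to nothing. -/
noncomputable def glue : b.Tile → Dir → b.Glue × Fin 3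
  | .seed, d => if d = .E ∨ d = .W then (.root, 2) else (.blank, 0)
  | .wall, _ => (.blank, 0)
  | .dec i v, d =>
    if d = .N then (.ack v, 2) else if d = .S then (.blank, 1)
    else if d = sideOf i then (.val v, 2) else (.blank, 0)
  | .north v, d => if d = .N then (.blank, 0) else if d = .S then (.ack v, 2) else (.ack v, 1)
  | .track i s w c, d => b.trackGlue i s w c d

theorem finite_tile : Finite b.Tile := by
  have := b.finite_V
  have := b.finite_S
  let f : (Unit ⊕ Unit ⊕ (Fin 2 × b.V) ⊕ b.V ⊕ (Σ i : Fin 2, b.S i × Option b.V × Fin (b.K + 1))) →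
      b.Tile
    | .inl _ => .seed
    | .inr (.inl _) => .wall
    | .inr (.inr (.inl (i, v))) => .dec i v
    | .inr (.inr (.inr (.inl v))) => .north v
    | .inr (.inr (.inr (.inr ⟨i, s, w, c⟩))) => .track i s w c
  refine Finite.of_surjective f ?_
  rintro (_ | _ | ⟨i, v⟩ | v | ⟨i, s, w, c⟩)
  · exact ⟨.inl (), rfl⟩
  · exact ⟨.inr (.inl ()), rfl⟩
  · exact ⟨.inr (.inr (.inl (i, v))), rfl⟩
  · exact ⟨.inr (.inr (.inr (.inl v))), rfl⟩
  · exact ⟨.inr (.inr (.inr (.inr ⟨i, s, w, c⟩))), rfl⟩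

noncomputable abbrev tileSet : TileSet where
  Tile := b.Tile
  finite := b.finite_tile
  Glue := b.Glue
  glue := b.glue
  binds := b.Binds
  binds_symm := by rintro _ _ (_ | _ | _ | _ | _) <;> constructor

/-! ### Glues by name -/

variable {b}

theorem glue_root {t : b.Tile} {d : Dir} (h : (b.glue t d).1 = .root) :
    (t = .seed ∧ (d = .E ∨ d = .W)) ∨
      ∃ i s w c, t = .track i s w c ∧ c.val = 0 ∧ d = b.innDir i 0 := by
  rcases t with _ | _ | ⟨i, v⟩ | v | ⟨i, s, w, c⟩ <;> simp only [glue] at h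
  · split_ifs at h with h1
    exact .inl ⟨rfl, h1⟩
  · cases h
  · split_ifs at h
  · split_ifs at h
  · right
    refine ⟨i, s, w, c, rfl, ?_⟩
    unfold trackGlue at h
    split at h
    · dsimp only at h
      split at h
      · rename_i h1 h2; exact ⟨h2, h2 ▸ h1⟩
      · cases h
    · split_ifs at h
      · split at h <;> cases h
      · split at h <;> cases h

/-- A link glue occurs only as the incoming glue of a track tile or as the outgoing glue of a track
tile that has a successor; the index tells which places in the track it can join. -/
theorem glue_link {t : b.Tile} {d : Dir} {i : Fin 2} {s : b.S i} {w : Option b.V} {n : ℕ}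
    (h : (b.glue t d).1 = .link i s w n) :
    ∃ w' c, t = .track i s w' c ∧
      ((d = b.innDir i c ∧ c.val ≠ 0 ∧ n = c ∧ w = (if c.val = b.m + 3 then none else w')) ∨
        (d = b.outDir i c ∧ b.cont i s w' c ∧ n = min (c.val + 1) b.K ∧ w = w' ∧
          (b.glue t d).2 = if c.val = b.m + 2 ∧ (b.prop i s).isSome then 1 else 2)) := by
  rcases t with _ | _ | ⟨i', v⟩ | v | ⟨i', s', w', c⟩ <;> simp only [glue] at h
  · split_ifs at h
  · cases h
  · split_ifs at h
  · split_ifs at h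
  · unfold trackGlue at h
    split at h
    · dsimp only at h
      split at h
      · cases h
      · injection h with h1 h2 h3 h4
        subst h1
        have h2 := eq_of_heq h2
        subst h2
        refine ⟨w', c, rfl, .inl ⟨by assumption, by assumption, h4.symm, h3.symm⟩⟩
    · rename_i h0
      split at h
      · rename_i h5
        dsimp only at h
        split at h
        · rename_i h6
          injection h with h1 h2 h3 h4
          subst h1
          have h2 := eq_of_heq h2
          subst h2
          refine ⟨w', c, rfl, .inr ⟨h5, h6, h4.symm, h3.symm, ?_⟩⟩
          simp only [glue, trackGlue, if_neg h0, if_pos h5]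
        · cases h
      · split_ifs at h
        · split at h <;> cases h
        · split at h <;> cases h

theorem glue_val {t : b.Tile} {d : Dir} {v : b.V} (h : (b.glue t d).1 = .val v) :
    ∃ i, t = .dec i v ∧ d = sideOf i := by
  rcases t with _ | _ | ⟨i, v'⟩ | v' | ⟨i, s, w, c⟩ <;> simp only [glue] at h
  · split_ifs at h
  · cases h
  · split_ifs at h with h1 h2 h3
    cases h
    exact ⟨i, rfl, h3⟩
  · split_ifs at h
  · unfold trackGlue at h
    split at h
    · dsimp only at h
      split at h <;> cases h
    · split_ifs at h
      · split at h <;> cases h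
      · split at h <;> cases h

theorem glue_prp {t : b.Tile} {d : Dir} {v : b.V} (h : (b.glue t d).1 = .prp v) :
    ∃ i s w c, t = .track i s w c ∧ c.val = b.m + 2 ∧ d = inward i ∧ b.prop i s = some v := by
  rcases t with _ | _ | ⟨i, v'⟩ | v' | ⟨i, s, w, c⟩ <;> simp only [glue] at h
  · split_ifs at h
  · cases h
  · split_ifs at h
  · split_ifs at h
  · refine ⟨i, s, w, c, rfl, ?_⟩
    unfold trackGlue at h
    split at h
    · dsimp only at h
      split at h <;> cases h
    · split_ifs at h with h1 h2 h3 h4 h5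
      · split at h
        · cases h
        · cases h
          exact ⟨h4.1, h4.2, by assumption⟩
      · split at h <;> cases h

theorem glue_ack {t : b.Tile} {d : Dir} {v : b.V} (h : (b.glue t d).1 = .ack v) :
    (∃ i, t = .dec i v ∧ d = .N ∧ (b.glue t d).2 = 2) ∨
      (t = .north v ∧ d = .S ∧ (b.glue t d).2 = 2) ∨
      (t = .north v ∧ (d = .E ∨ d = .W) ∧ (b.glue t d).2 = 1) ∨
      ∃ i s c, t = .track i s (some v) c ∧ c.val = b.m + 3 ∧ d = inward i ∧
        (b.glue t d).2 = 1 := by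
  rcases t with _ | _ | ⟨i, v'⟩ | v' | ⟨i, s, w, c⟩ <;> simp only [glue] at h
  · split_ifs at h
  · cases h
  · split_ifs at h with h1
    cases h
    exact .inl ⟨i, rfl, h1, by simp [glue, h1]⟩
  · split_ifs at h with h1 h2
    · cases h
      exact .inr (.inl ⟨rfl, h2, by simp [glue, h2]⟩)
    · cases h
      refine .inr (.inr (.inl ⟨rfl, ?_, by simp [glue, h1, h2]⟩))
      cases d <;> simp_all
  · refine .inr (.inr (.inr ?_))
    unfold trackGlue at h
    split at h
    · dsimp only at h
      split at h <;> cases h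
    · rename_i h0
      split at h
      · dsimp only at h
        split at h <;> cases h
      · rename_i h1
        split_ifs at h with h3 h4 h5
        · split at h <;> cases h
        · split at h
          · cases h
          · cases h
            refine ⟨i, s, c, rfl, h5.1, h5.2, ?_⟩
            simp only [glue, trackGlue, if_neg h0, if_neg h1, if_neg h3, if_neg h4, if_pos h5]

theorem bond_pos {t t' : b.Tile} {d : Dir} (h : 0 < b.tileSet.bond t d t') :
    b.Binds (b.glue t d).1 (b.glue t' d.opp).1 ∧ (b.glue t d).2 = (b.glue t' d.opp).2 ∧
      b.tileSet.bond t d t' = ((b.glue t d).2 : ℕ) := by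
  unfold TileSet.bond at h ⊢
  split_ifs at h ⊢ with h1
  · exact ⟨h1.1, h1.2, rfl⟩
  · simp at h

theorem bond_eq {t t' : b.Tile} {d : Dir} (h : b.Binds (b.glue t d).1 (b.glue t' d.opp).1)
    (h' : (b.glue t d).2 = (b.glue t' d.opp).2) :
    b.tileSet.bond t d t' = ((b.glue t d).2 : ℕ) := if_pos ⟨h, h'⟩

theorem bond_wall (t : b.Tile) (d : Dir) : b.tileSet.bond t d Tile.wall = 0 := by
  by_contra h
  have := (bond_pos (Nat.pos_of_ne_zero h)).1
  generalize (b.glue t d).1 = g at this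
  simp only [glue] at this
  cases this

theorem wall_bond (t : b.Tile) (d : Dir) : b.tileSet.bond Tile.wall d t = 0 := by
  rw [TileSet.bond_symm]; exact bond_wall t _

end Blueprint

namespace Blueprint

variable {b : Blueprint}

/-! ### Sites -/

def sgn (i : Fin 2) : ℤ := if i = 0 then -1 else 1

variable (b) in
/-- The site of the tile with index `k` on the track of process `i`. -/
def pos (i : Fin 2) (k : ℕ) : ℤ × ℤ :=
  if k ≤ b.m then (2 * sgn i, k) else if k = b.m + 1 then (sgn i, b.m)
  else if k = b.m + 2 then (sgn i, b.m + 1) else (sgn i * ((k : ℤ) - b.m - 2), b.m + 2)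

variable (b) in
/-- The site of the decision. -/
def mid : ℤ × ℤ := (0, b.m + 1)

variable (b) in
/-- The site from which the decision is spread. -/
def top : ℤ × ℤ := (0, b.m + 2)

theorem sgn_cases (i : Fin 2) :
    (i = 0 ∧ sgn i = -1 ∧ sideOf i = .W ∧ inward i = .E) ∨
      (i = 1 ∧ sgn i = 1 ∧ sideOf i = .E ∧ inward i = .W) := by
  fin_cases i <;> simp [sgn, sideOf, inward, Dir.opp]

theorem pos_injective {i j : Fin 2} {k n : ℕ} (h : b.pos i k = b.pos j n) : i = j ∧ k = n := by
  rcases sgn_cases i with ⟨rfl, h1, -⟩ | ⟨rfl, h1, -⟩ <;>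
  rcases sgn_cases j with ⟨rfl, h2, -⟩ | ⟨rfl, h2, -⟩ <;>
  · simp only [pos, h1, h2] at h
    split_ifs at h <;> simp only [Prod.mk.injEq] at h <;>
      first
      | (refine ⟨rfl, ?_⟩; omega)
      | (exfalso; omega)

theorem one_le_sgn_mul_pos (i : Fin 2) (k : ℕ) : 1 ≤ sgn i * (b.pos i k).1 := by
  rcases sgn_cases i with ⟨rfl, h1, -⟩ | ⟨rfl, h1, -⟩ <;>
  · simp only [pos, h1]
    split_ifs <;> simp only <;> omega

theorem pos_ne_mid (i : Fin 2) (k : ℕ) : b.pos i k ≠ b.mid := by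
  intro h
  have := one_le_sgn_mul_pos (b := b) i k
  rw [h] at this
  simp [mid] at this

theorem pos_ne_top (i : Fin 2) (k : ℕ) : b.pos i k ≠ b.top := by
  intro h
  have := one_le_sgn_mul_pos (b := b) i k
  rw [h] at this
  simp [top] at this

theorem mid_ne_top : b.mid ≠ b.top := by
  simp [mid, top]

/-- The sites of the seed. -/
def IsSeedSite (p : ℤ × ℤ) : Prop := p.2 = 0 ∧ -1 ≤ p.1 ∧ p.1 ≤ 1

theorem pos_not_seed (i : Fin 2) (k : ℕ) : ¬ IsSeedSite (b.pos i k) := by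
  have := b.one_le_m
  rcases sgn_cases i with ⟨rfl, h1, -⟩ | ⟨rfl, h1, -⟩ <;>
  · simp only [IsSeedSite, pos, h1]
    split_ifs <;> simp only <;> omega

theorem mid_not_seed : ¬ IsSeedSite b.mid := by
  simp only [IsSeedSite, mid]; omega

theorem top_not_seed : ¬ IsSeedSite b.top := by
  simp only [IsSeedSite, top]; omega

theorem pos_succ (i : Fin 2) (k : ℕ) : b.pos i (k + 1) = b.pos i k + (b.outDir i k).vec := by
  rcases sgn_cases i with ⟨rfl, h1, h2, h3⟩ | ⟨rfl, h1, h2, h3⟩ <;>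
  · simp only [pos, outDir, h1, h2, h3]
    split_ifs <;> simp only [Dir.vec, Prod.mk_add_mk, Prod.mk.injEq] <;> push_cast <;>
      first
      | omega
      | (constructor <;> first | trivial | omega)

theorem innDir_succ (i : Fin 2) (k : ℕ) : b.innDir i (k + 1) = (b.outDir i k).opp := by
  rcases sgn_cases i with ⟨rfl, h1, h2, h3⟩ | ⟨rfl, h1, h2, h3⟩ <;>
  · simp only [innDir, outDir, h2, h3]
    split_ifs <;> first | rfl | contradiction | omega

theorem innDir_zero (i : Fin 2) : b.innDir i 0 = inward i := by simp [innDir]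

theorem innDir_ne_outDir (i : Fin 2) (k : ℕ) : b.innDir i k ≠ b.outDir i k := by
  have := b.one_le_m
  rcases sgn_cases i with ⟨rfl, h1, h2, h3⟩ | ⟨rfl, h1, h2, h3⟩ <;>
  · simp only [innDir, outDir, h2, h3]
    split_ifs <;> first | omega | simp

theorem pos_add_innDir (i : Fin 2) (k : ℕ) :
    b.pos i (k + 1) + (b.innDir i (k + 1)).vec = b.pos i k := by
  rw [innDir_succ, pos_succ, Dir.add_vec_opp]

theorem isSeedSite_pos_zero_add (i : Fin 2) : IsSeedSite (b.pos i 0 + (inward i).vec) := by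
  rcases sgn_cases i with ⟨rfl, h1, h2, h3⟩ | ⟨rfl, h1, h2, h3⟩ <;>
    simp [pos, h1, h3, IsSeedSite, Dir.vec]

/-- The sites in the row of the seed that are next to it are the first ones of the tracks. -/
theorem IsSeedSite.add {p : ℤ × ℤ} (hp : IsSeedSite p) {d : Dir} (hd : d = .E ∨ d = .W) :
    IsSeedSite (p + d.vec) ∨ ∃ i, p + d.vec = b.pos i 0 := by
  obtain ⟨x, y⟩ := p
  obtain ⟨h1, h2, h3⟩ := hp
  simp only at h1 h2 h3
  subst h1
  rcases hd with rfl | rfl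
  · by_cases h : x = 1
    · right; refine ⟨1, ?_⟩; simp [pos, sgn, Dir.vec, h]
    · left; simp only [IsSeedSite, Dir.vec, Prod.mk_add_mk]; omega
  · by_cases h : x = -1
    · right; refine ⟨0, ?_⟩; simp [pos, sgn, Dir.vec, h]
    · left; simp only [IsSeedSite, Dir.vec, Prod.mk_add_mk]; omega

theorem pos_pending_add (i : Fin 2) : b.pos i (b.m + 2) + (inward i).vec = b.mid := by
  rcases sgn_cases i with ⟨rfl, h1, h2, h3⟩ | ⟨rfl, h1, h2, h3⟩ <;>
    simp [pos, h1, h3, mid, Dir.vec]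

theorem mid_add_sideOf (i : Fin 2) : b.mid + (sideOf i).vec = b.pos i (b.m + 2) := by
  rw [← pos_pending_add i, inward, add_assoc]
  have := Dir.add_vec_opp 0 (sideOf i)
  rw [zero_add] at this
  rw [add_comm (sideOf i).opp.vec, this, add_zero]

theorem pos_answer_add (i : Fin 2) : b.pos i (b.m + 3) + (inward i).vec = b.top := by
  rcases sgn_cases i with ⟨rfl, h1, h2, h3⟩ | ⟨rfl, h1, h2, h3⟩ <;>
    simp [pos, h1, h3, top, Dir.vec]

theorem top_add_sideOf (i : Fin 2) : b.top + (sideOf i).vec = b.pos i (b.m + 3) := by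
  rw [← pos_answer_add i, inward, add_assoc]
  have := Dir.add_vec_opp 0 (sideOf i)
  rw [zero_add] at this
  rw [add_comm (sideOf i).opp.vec, this, add_zero]

theorem mid_add_north : b.mid + Dir.N.vec = b.top := by
  simp [mid, top, Dir.vec, add_assoc]

theorem top_add_south : b.top + Dir.S.vec = b.mid := by
  rw [← mid_add_north]; exact Dir.add_vec_opp _ .N

theorem eq_add_opp {p q : ℤ × ℤ} {d : Dir} (h : p + d.vec = q) : p = q + d.opp.vec := by
  rw [← h, Dir.add_vec_opp]

/-! ### States and the placements that represent them -/

variable (b) in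
/-- How far the tracks have got, and what has been decided. -/
structure St where
  s : ∀ i, b.S i
  len : Fin 2 → ℕ
  dec : Option (Fin 2 × b.V)
  ans : Option b.V

-- Indices from `K` on share one tile type; its outgoing link then fits its own incoming side, and
-- the track repeats it.
variable (b) in
def cap (k : ℕ) : Fin (b.K + 1) := ⟨min k b.K, by omega⟩

theorem cap_val (k : ℕ) : (b.cap k).val = min k b.K := rfl

theorem cap_val_of_lt {k : ℕ} (h : k < b.m + 5) : (b.cap k).val = k := by
  have := b.le_K
  rw [cap_val]; omega

theorem cap_val_eq {k n : ℕ} (hn : n < b.m + 5) : (b.cap k).val = n ↔ k = n := by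
  have := b.le_K
  rw [cap_val]; omega

theorem innDir_cap (i : Fin 2) (k : ℕ) : b.innDir i (b.cap k) = b.innDir i k := by
  have := b.le_K
  rw [cap_val]
  unfold innDir
  split_ifs <;> first | rfl | omega

theorem outDir_cap (i : Fin 2) (k : ℕ) : b.outDir i (b.cap k) = b.outDir i k := by
  have := b.le_K
  rw [cap_val]
  unfold outDir
  split_ifs <;> first | rfl | omega

/-- This excludes a bond between two outgoing sides: if their links have the same name they point in
the same direction, so they cannot face each other. -/
theorem outDir_eq_of_succ {i : Fin 2} {k n : ℕ} (h : min (k + 1) b.K = min (n + 1) b.K) :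
    b.outDir i k = b.outDir i n := by
  have := b.le_K
  unfold outDir
  split_ifs <;> first | rfl | omega

namespace St

/-- The answer that the tile with index `k` on track `i` carries. -/
def label (x : b.St) (i : Fin 2) (k : ℕ) : Option b.V :=
  if b.m + 3 ≤ k ∧ (b.prop i (x.s i)).isSome then x.ans else none

def trackTile (x : b.St) (i : Fin 2) (k : ℕ) : b.Tile := .track i (x.s i) (x.label i k) (b.cap k)

/-- The tile `t` lies at `p`. -/
def Occ (x : b.St) (p : ℤ × ℤ) (t : b.Tile) : Prop :=
  (IsSeedSite p ∧ t = .seed) ∨ (∃ i v, x.dec = some (i, v) ∧ p = b.mid ∧ t = .dec i v) ∨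
    (∃ v, x.ans = some v ∧ p = b.top ∧ t = .north v) ∨
    ∃ i k, k < x.len i ∧ p = b.pos i k ∧ t = x.trackTile i k

theorem Occ.unique {x : b.St} {p : ℤ × ℤ} {t t' : b.Tile} (h : x.Occ p t) (h' : x.Occ p t') :
    t = t' := by
  rcases h with ⟨h1, rfl⟩ | ⟨i, v, h1, rfl, rfl⟩ | ⟨v, h1, rfl, rfl⟩ | ⟨i, k, h1, rfl, rfl⟩ <;>
  rcases h' with ⟨h2, rfl⟩ | ⟨j, w, h2, h3, rfl⟩ | ⟨w, h2, h3, rfl⟩ | ⟨j, n, h2, h3, rfl⟩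
  · rfl
  · exact absurd (h3 ▸ h1) mid_not_seed
  · exact absurd (h3 ▸ h1) top_not_seed
  · exact absurd (h3 ▸ h1) (pos_not_seed _ _)
  · exact absurd h2 mid_not_seed
  · rw [h1] at h2; cases h2; rfl
  · exact absurd h3 mid_ne_top
  · exact absurd h3.symm (pos_ne_mid _ _)
  · exact absurd h2 top_not_seed
  · exact absurd h3.symm mid_ne_top
  · rw [h1] at h2; cases h2; rfl
  · exact absurd h3.symm (pos_ne_top _ _)
  · exact absurd h2 (pos_not_seed _ _)
  · exact absurd h3 (pos_ne_mid _ _)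
  · exact absurd h3 (pos_ne_top _ _)
  · obtain ⟨rfl, rfl⟩ := pos_injective h3; rfl

open Classical in
/-- The placement without the blockages. -/
noncomputable def asm (x : b.St) : b.tileSet.Placement := fun p =>
  if h : ∃ t, x.Occ p t then some h.choose else none

theorem asm_eq_some {x : b.St} {p : ℤ × ℤ} {t : b.Tile} : x.asm p = some t ↔ x.Occ p t := by
  unfold asm
  constructor
  · intro h
    split_ifs at h with h1
    cases h
    exact h1.choose_spec
  · intro h
    rw [dif_pos ⟨t, h⟩]
    exact congrArg some (Occ.unique (Exists.choose_spec (p := fun t => x.Occ p t) ⟨t, h⟩) h)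

theorem asm_eq_none {x : b.St} {p : ℤ × ℤ} : x.asm p = none ↔ ∀ t, ¬ x.Occ p t := by
  constructor
  · intro h t ht
    rw [asm_eq_some.2 ht] at h; cases h
  · intro h
    cases hp : x.asm p with
    | none => rfl
    | some t => exact absurd (asm_eq_some.1 hp) (h t)

theorem occ_pos {x : b.St} {i : Fin 2} {k : ℕ} (h : k < x.len i) :
    x.Occ (b.pos i k) (x.trackTile i k) := .inr (.inr (.inr ⟨i, k, h, rfl, rfl⟩))

theorem asm_pos {x : b.St} {i : Fin 2} {k : ℕ} (h : k < x.len i) :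
    x.asm (b.pos i k) = some (x.trackTile i k) := asm_eq_some.2 (occ_pos h)

theorem asm_pos_none {x : b.St} {i : Fin 2} {k : ℕ} (h : x.len i ≤ k) :
    x.asm (b.pos i k) = none := by
  rw [asm_eq_none]
  rintro t (⟨h2, rfl⟩ | ⟨j, w, h2, h3, rfl⟩ | ⟨w, h2, h3, rfl⟩ | ⟨j, n, h2, h3, rfl⟩)
  · exact pos_not_seed _ _ h2
  · exact pos_ne_mid _ _ h3
  · exact pos_ne_top _ _ h3
  · obtain ⟨rfl, rfl⟩ := pos_injective h3; omega

theorem asm_mid {x : b.St} : x.asm b.mid = x.dec.map fun e => .dec e.1 e.2 := by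
  cases hd : x.dec with
  | some e => exact asm_eq_some.2 (.inr (.inl ⟨e.1, e.2, hd, rfl, rfl⟩))
  | none =>
    refine asm_eq_none.2 ?_
    rintro t (⟨h2, rfl⟩ | ⟨j, w, h2, h3, rfl⟩ | ⟨w, h2, h3, rfl⟩ | ⟨j, n, h2, h3, rfl⟩)
    · exact mid_not_seed h2
    · rw [hd] at h2; cases h2
    · exact mid_ne_top h3
    · exact pos_ne_mid _ _ h3.symm

theorem asm_top {x : b.St} : x.asm b.top = x.ans.map .north := by
  cases hd : x.ans with
  | some v => exact asm_eq_some.2 (.inr (.inr (.inl ⟨v, hd, rfl, rfl⟩)))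
  | none =>
    refine asm_eq_none.2 ?_
    rintro t (⟨h2, rfl⟩ | ⟨j, w, h2, h3, rfl⟩ | ⟨w, h2, h3, rfl⟩ | ⟨j, n, h2, h3, rfl⟩)
    · exact top_not_seed h2
    · exact mid_ne_top h3.symm
    · rw [hd] at h2; cases h2
    · exact pos_ne_top _ _ h3.symm

theorem asm_seed {x : b.St} {p : ℤ × ℤ} (h : IsSeedSite p) : x.asm p = some .seed :=
  asm_eq_some.2 (.inl ⟨h, rfl⟩)

/-- The conditions under which all possible additions are those intended. -/
structure Valid (x : b.St) : Prop where
  one_le_len : ∀ i, 1 ≤ x.len i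
  le_len : ∀ i, b.prop i (x.s i) = none → b.m + 4 ≤ x.len i
  dec_of_ans : ∀ v, x.ans = some v → ∃ i, x.dec = some (i, v)
  prop_of_dec : ∀ i v, x.dec = some (i, v) → b.prop i (x.s i) = some v ∧ b.m + 3 ≤ x.len i
  ans_of_len : ∀ i, b.m + 4 ≤ x.len i → (b.prop i (x.s i)).isSome → x.ans.isSome

/-- What binds to a free site, and how. -/
theorem Valid.bond_cases {x : b.St} (hx : x.Valid) {p : ℤ × ℤ} {t : b.Tile} {d : Dir}
    (hp : x.asm p = none) (h : 0 < b.tileSet.bondAt x.asm t p d) :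
    (∃ i k w' c, k + 1 = x.len i ∧ p = b.pos i (k + 1) ∧ t = .track i (x.s i) w' c ∧
        d = b.innDir i c ∧ c = b.cap (k + 1) ∧ b.cont i (x.s i) (x.label i k) (b.cap k) ∧
        x.label i k = (if c.val = b.m + 3 then none else w') ∧
        (k = b.m + 2 ∧ (b.prop i (x.s i)).isSome → b.tileSet.bondAt x.asm t p d = 1)) ∨
      (∃ i v, t = .dec i v ∧ p = b.mid ∧ b.prop i (x.s i) = some v ∧ b.m + 2 < x.len i) ∨
      (∃ i v, t = .north v ∧ p = b.top ∧ x.dec = some (i, v)) ∨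
      (∃ v, b.tileSet.bondAt x.asm t p d = 1 ∧ (d = .E ∨ d = .W) ∧ p = b.top + d.opp.vec ∧
        x.ans = some v ∧
        (t = .north v ∨ ∃ i s c, t = .track i s (some v) c ∧ d = inward i)) := by
  have hfree := asm_eq_none.1 hp
  unfold TileSet.bondAt at h ⊢
  cases hq : x.asm (p + d.vec) with
  | none => simp [hq] at h
  | some t' =>
    have hocc := asm_eq_some.1 hq
    simp only [hq] at h
    have hpq := eq_add_opp (p := p) (d := d) rfl
    obtain ⟨hb, he, hv⟩ := bond_pos h
    have hpos : (b.glue t d).2 ≠ 0 := by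
      intro h0; rw [hv, h0] at h; simp at h
    generalize hg : (b.glue t d).1 = g at hb
    generalize hg' : (b.glue t' d.opp).1 = g' at hb
    generalize p + d.vec = q at *
    cases hb with
    | root =>
      -- A root glue joins seed sites and first track sites only, and all of these are occupied
      -- already.
      exfalso
      rcases glue_root hg' with ⟨rfl, hd⟩ | ⟨i, s, w, c, rfl, hc, hd⟩
      · rcases hocc with ⟨h2, -⟩ | ⟨j, w, h2, h3, h4⟩ | ⟨w, h2, h3, h4⟩ | ⟨j, n, h2, h3, h4⟩
        · rcases h2.add (b := b) hd with h5 | ⟨i, h5⟩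
          · exact hfree _ (.inl ⟨hpq ▸ h5, rfl⟩)
          · exact hfree _ (hpq.trans h5 ▸ occ_pos (hx.one_le_len i))
        · cases h4
        · cases h4
        · cases h4
      · rcases hocc with ⟨-, h4⟩ | ⟨j, w, h2, h3, h4⟩ | ⟨w, h2, h3, h4⟩ | ⟨j, n, h2, h3, h4⟩
        · cases h4
        · cases h4
        · cases h4
        · unfold trackTile at h4
          injection h4 with h5 h6 h7 h8
          subst h5 h8
          rw [cap_val_eq (by omega)] at hc
          subst hc
          refine hfree _ (.inl ⟨?_, rfl⟩)
          rw [hpq, hd, h3, innDir_zero]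
          exact isSeedSite_pos_zero_add i
    | link i s w n =>
      obtain ⟨w', c, rfl, hA⟩ := glue_link hg'
      obtain ⟨w₁, c₁, rfl, hB⟩ := glue_link hg
      rcases hocc with ⟨-, h4⟩ | ⟨j, w, h2, h3, h4⟩ | ⟨w, h2, h3, h4⟩ | ⟨j, k, h2, h3, h4⟩
      · cases h4
      · cases h4
      · cases h4
      unfold trackTile at h4
      injection h4 with h5 h6 h7 h8
      subst h5 h7 h8
      have h6 := eq_of_heq h6
      subst h6
      rcases hA with ⟨hd, hc, -, -⟩ | ⟨hd, hcont, hn, hw, hstr⟩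
      · exfalso
        have hk : k ≠ 0 := by
          rintro rfl; exact hc ((cap_val_eq (by omega)).2 rfl)
        obtain ⟨k, rfl⟩ := Nat.exists_eq_succ_of_ne_zero hk
        rw [innDir_cap] at hd
        rw [hd, h3, pos_add_innDir] at hpq
        exact hfree _ (hpq ▸ occ_pos (by omega))
      · rw [outDir_cap] at hd
        have hpk : p = b.pos i (k + 1) := by rw [pos_succ, hpq, hd, h3]
        have hlen : k + 1 = x.len i := by
          by_contra hne
          exact hfree _ (hpk ▸ occ_pos (by omega))
        rcases hB with ⟨hd', hc', hn', hw'⟩ | ⟨hd', -, hn', -, -⟩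
        · left
          refine ⟨i, k, w₁, c₁, hlen, hpk, rfl, hd', ?_, hcont, hw ▸ hw', ?_⟩
          · apply Fin.ext
            rw [← hn', hn, cap_val, cap_val]; omega
          · rintro ⟨hk, hpr⟩
            change b.tileSet.bond _ _ _ = 1
            rw [hv, he, hstr, if_pos ⟨(cap_val_eq (by omega)).2 hk, hpr⟩]
            rfl
        · exfalso
          have : d = d.opp := by
            rw [hd, hd', ← outDir_cap i k]
            exact outDir_eq_of_succ (by rw [← hn, ← hn'])
          exact Dir.opp_ne d this.symm
    | valPrp v =>
      right; left
      obtain ⟨i, rfl, hd⟩ := glue_val hg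
      obtain ⟨j, s, w, c, rfl, hc, hd', hv'⟩ := glue_prp hg'
      rcases hocc with ⟨-, h4⟩ | ⟨j, w, h2, h3, h4⟩ | ⟨w, h2, h3, h4⟩ | ⟨j, k, h2, h3, h4⟩
      · cases h4
      · cases h4
      · cases h4
      unfold trackTile at h4
      injection h4 with h5 h6 h7 h8
      subst h5 h7 h8
      have h6 := eq_of_heq h6
      subst h6
      rw [cap_val_eq (by omega)] at hc
      subst hc
      have hij : i = j := by
        subst hd
        revert hd'
        unfold inward
        fin_cases i <;> fin_cases j <;> simp [sideOf, Dir.opp]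
      subst hij
      refine ⟨i, v, rfl, ?_, hv', h2⟩
      rw [hpq, hd', h3, pos_pending_add]
    | prpVal v =>
      -- The side of a decision tile that shows the value faces the pending tile whose proposal was
      -- decided, so that site is not free.
      exfalso
      obtain ⟨i, rfl, hd⟩ := glue_val hg'
      rcases hocc with ⟨-, h4⟩ | ⟨j, w, h2, h3, h4⟩ | ⟨w, h2, h3, h4⟩ | ⟨j, k, h2, h3, h4⟩
      · cases h4
      · cases h4
        have hp' : p = b.pos i (b.m + 2) := by rw [hpq, hd, h3, mid_add_sideOf]
        exact hfree _ (hp' ▸ occ_pos (by have := (hx.prop_of_dec i v h2).2; omega))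
      · cases h4
      · cases h4
    | ack v =>
      rcases hocc with ⟨-, h4⟩ | ⟨j, w, h2, h3, h4⟩ | ⟨w, h2, h3, h4⟩ | ⟨j, k, h2, h3, h4⟩
      · subst h4
        simp only [glue] at hg'
        split_ifs at hg'
      · subst h4
        rcases glue_ack hg' with ⟨i, h5, hd, hs⟩ | ⟨h5, -⟩ | ⟨h5, -⟩ | ⟨i, s, c, h5, -⟩ <;> cases h5
        rcases glue_ack hg with ⟨i', h5, hd', hs'⟩ | ⟨h5, hd', hs'⟩ | ⟨h5, hd', hs'⟩ |
          ⟨i', s', c', h5, hc', hd', hs'⟩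
        · rw [hd'] at hd; cases hd
        · right; right; left
          exact ⟨_, v, h5, by rw [hpq, hd, h3, mid_add_north], h2⟩
        · rw [hs, hs'] at he; cases he
        · rw [hs, hs'] at he; cases he
      · subst h4
        rcases glue_ack hg' with ⟨i, h5, -⟩ | ⟨h5, hd, -⟩ | ⟨h5, hd, hs⟩ | ⟨i, s, c, h5, -⟩ <;> cases h5
        · exfalso
          obtain ⟨i, hi⟩ := hx.dec_of_ans _ h2
          refine hfree (.dec i v) (.inr (.inl ⟨i, v, hi, ?_, rfl⟩))
          rw [hpq, hd, h3, top_add_south]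
        · right; right; right
          refine ⟨v, ?_, ?_, h3 ▸ hpq, h2, ?_⟩
          · change b.tileSet.bond _ _ _ = 1
            rw [hv, he, hs]; rfl
          · cases d <;> simp_all [Dir.opp]
          · rcases glue_ack hg with ⟨i', h5, hd', hs'⟩ | ⟨h5, hd', hs'⟩ | ⟨h5, hd', hs'⟩ |
              ⟨i', s', c', h5, hc', hd', hs'⟩
            · subst hd'; simp [Dir.opp] at hd
            · exact .inl h5
            · exact .inl h5
            · exact .inr ⟨i', s', c', h5, hd'⟩
      · exfalso
        subst h4
        unfold trackTile at hg'
        rcases glue_ack hg' with ⟨i, h5, -⟩ | ⟨h5, hd, -⟩ | ⟨h5, hd, hs⟩ | ⟨i, s, c, h5, hc, hd, -⟩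
        · cases h5
        · cases h5
        · cases h5
        · injection h5 with h5 h6 h7 h8
          subst h5 h8
          rw [cap_val_eq (by omega)] at hc
          subst hc
          have hl : x.ans = some v := by
            unfold label at h7
            split_ifs at h7
            exact h7
          refine hfree (.north v) (.inr (.inr (.inl ⟨v, hl, ?_, rfl⟩)))
          rw [hpq, hd, h3, pos_answer_add]

/-! ### The tiles that can be added -/

theorem exists_of_two_le_sum {f : Dir → ℕ} (h : 2 ≤ ∑ d, f d) :
    (∃ d, 2 ≤ f d) ∨ ∃ d d', d ≠ d' ∧ 0 < f d ∧ 0 < f d' := by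
  by_contra hc
  push Not at hc
  obtain ⟨h1, h2⟩ := hc
  have h0 : ∃ d, f d ≠ 0 := by
    by_contra h0
    push Not at h0
    simp [h0] at h
  obtain ⟨d, hd⟩ := h0
  rw [Finset.sum_eq_single d] at h
  · have := h1 d; omega
  · intro d' _ hne
    have := h2 d d' hne.symm (Nat.pos_of_ne_zero hd)
    omega
  · simp

/-- The only tiles that can be added are the next one of a track, the decision, and the tile that
spreads it. -/
theorem Valid.attach_cases {x : b.St} (hx : x.Valid) {p : ℤ × ℤ} {t : b.Tile}
    (hp : x.asm p = none) (h : 2 ≤ b.tileSet.strengthAt x.asm t p) :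
    (∃ i k, k + 1 = x.len i ∧ p = b.pos i (k + 1) ∧ t = x.trackTile i (k + 1) ∧
        b.cont i (x.s i) (x.label i k) (b.cap k) ∧
        (k = b.m + 2 → (b.prop i (x.s i)).isSome → x.ans.isSome)) ∨
      (∃ i v, t = .dec i v ∧ p = b.mid ∧ b.prop i (x.s i) = some v ∧ b.m + 2 < x.len i) ∨
      (∃ i v, t = .north v ∧ p = b.top ∧ x.dec = some (i, v)) := by
  have hle := b.le_K
  -- two bonds, or one that is strong
  have main : ∃ d, 0 < b.tileSet.bondAt x.asm t p d ∧
      (2 ≤ b.tileSet.bondAt x.asm t p d ∨ ∃ d', d ≠ d' ∧ 0 < b.tileSet.bondAt x.asm t p d') := by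
    rcases exists_of_two_le_sum h with ⟨d, hd⟩ | ⟨d, d', hne, hd, hd'⟩
    · exact ⟨d, by omega, .inl hd⟩
    · exact ⟨d, hd, .inr ⟨d', hne, hd'⟩⟩
  -- A tile that binds to the end of a track is the intended one. Its label is forced by the
  -- incoming link, except at the answer site, where the link does not carry the answer; there the
  -- last premise supplies the label. Processes without a proposal have passed that site by
  -- validity.
  have key : ∀ {i k w'} {c : Fin (b.K + 1)} {d : Dir}, k + 1 = x.len i → p = b.pos i (k + 1) →
      t = .track i (x.s i) w' c → c = b.cap (k + 1) →
      b.cont i (x.s i) (x.label i k) (b.cap k) →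
      x.label i k = (if c.val = b.m + 3 then none else w') →
      (k = b.m + 2 → (b.prop i (x.s i)).isSome → w' = x.ans ∧ x.ans.isSome) →
      ∃ i k, k + 1 = x.len i ∧ p = b.pos i (k + 1) ∧ t = x.trackTile i (k + 1) ∧
        b.cont i (x.s i) (x.label i k) (b.cap k) ∧
        (k = b.m + 2 → (b.prop i (x.s i)).isSome → x.ans.isSome) := by
    intro i k w' c d hlen hpk ht hc hcont hw hans
    refine ⟨i, k, hlen, hpk, ?_, hcont, fun h1 h2 => (hans h1 h2).2⟩
    rw [ht, hc, trackTile]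
    congr 1
    simp only [hc, cap_val_eq (show b.m + 3 < b.m + 5 by omega)] at hw
    by_cases hk : k + 1 = b.m + 3
    · have hk' : k = b.m + 2 := by omega
      cases hpr : b.prop i (x.s i) with
      | none => have := hx.le_len i hpr; omega
      | some v =>
        have := hans hk' (by simp [hpr])
        rw [label, if_pos ⟨by omega, by simp [hpr]⟩, this.1]
    · rw [if_neg hk] at hw
      rw [← hw]
      unfold label
      by_cases hk2 : b.m + 3 ≤ k
      · simp [hk2, show b.m + 3 ≤ k + 1 by omega]
      · simp [show ¬ b.m + 3 ≤ k by omega, show ¬ b.m + 3 ≤ k + 1 by omega]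
  obtain ⟨d, hd, hmore⟩ := main
  rcases hx.bond_cases hp hd with ⟨i, k, w', c, hlen, hpk, ht, hdi, hc, hcont, hw, hone⟩ | h2 | h2 |
    ⟨v, hone, hdd, hpt, hans, ht⟩
  · left
    refine key (d := d) hlen hpk ht hc hcont hw ?_
    -- At the answer site the link has strength 1 only. The second bond must be an acknowledgement
    -- from `top`, and this fixes the label.
    intro hk hpr
    rcases hmore with h2 | ⟨d', hne, hd'⟩
    · rw [hone ⟨hk, hpr⟩] at h2; omega
    · rcases hx.bond_cases hp hd' with ⟨i', k', w'', c', -, -, ht', hdi', -⟩ | ⟨i', v, h2, -⟩ |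
        ⟨i', v, h2, -⟩ | ⟨v, -, -, -, hans, ht'⟩
      · rw [ht] at ht'
        cases ht'
        exact absurd (hdi.trans hdi'.symm) hne
      · rw [ht] at h2; cases h2
      · rw [ht] at h2; cases h2
      · rcases ht' with ht' | ⟨i', s', c', ht', -⟩
        · rw [ht] at ht'; cases ht'
        · rw [ht] at ht'
          injection ht' with h5 h6 h7 h8
          rw [hans, h7]
          simp
  · exact .inr (.inl h2)
  · exact .inr (.inr h2)
  · rcases hmore with h2 | ⟨d', hne, hd'⟩
    · omega
    · rcases hx.bond_cases hp hd' with ⟨i', k', w'', c', hlen, hpk, ht', hdi', hc, hcont, hw, -⟩ | h2 | h2 |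
        ⟨v', -, -, hpt', -⟩
      · left
        refine key (d := d) hlen hpk ht' hc hcont hw ?_
        intro hk hpr
        rcases ht with ht | ⟨i, s, c, ht, -⟩
        · rw [ht] at ht'; cases ht'
        · rw [ht] at ht'
          injection ht' with h5 h6 h7 h8
          rw [hans, ← h7]
          simp
      · exact .inr (.inl h2)
      · exact .inr (.inr h2)
      · rw [hpt] at hpt'
        have h3 := Dir.vec_injective (add_left_cancel hpt')
        have h4 := congrArg Dir.opp h3
        rw [Dir.opp_opp, Dir.opp_opp] at h4
        exact absurd h4 hne

end St

end Blueprint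

namespace Blueprint

variable {b : Blueprint}

/-! ### Blockages -/

/-- `p` is neither equal nor adjacent to `q`. -/
def Apart (q p : ℤ × ℤ) : Prop := p ≠ q ∧ ∀ d : Dir, p + d.vec ≠ q

/-- Binding at `p` is not impeded by blockages in `E`. -/
def Free (E : Finset (ℤ × ℤ)) (p : ℤ × ℤ) : Prop := ∀ q ∈ E, Apart q p

variable (b) in
/-- A blockage here stops the invocation of the object by process `i`, and the receipt of the
answer, but not the answer itself. -/
def trap (i : Fin 2) : ℤ × ℤ := (2 * sgn i, b.m + 1)

/-- The column of the decision site separates the two sides, so a blockage on one side never impedes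
the track on the other. -/
theorem apart_of_side {i j : Fin 2} (hij : i ≠ j) {p q : ℤ × ℤ} (hq : 1 ≤ sgn i * q.1)
    (hp : 1 ≤ sgn j * p.1) : Apart q p := by
  obtain ⟨x, y⟩ := p
  obtain ⟨x', y'⟩ := q
  rcases sgn_cases i with ⟨rfl, h1, -⟩ | ⟨rfl, h1, -⟩ <;>
  rcases sgn_cases j with ⟨rfl, h2, -⟩ | ⟨rfl, h2, -⟩ <;> simp only [ne_eq, not_true_eq_false] at hij
  all_goals
    simp only [h1, h2] at hp hq
    refine ⟨?_, fun d => ?_⟩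
    · simp only [ne_eq, Prod.mk.injEq]; omega
    · cases d <;> simp only [Dir.vec, Prod.mk_add_mk, ne_eq, Prod.mk.injEq] <;> omega

theorem one_le_sgn_mul_trap (i : Fin 2) : 1 ≤ sgn i * (b.trap i).1 := by
  rcases sgn_cases i with ⟨rfl, h1, -⟩ | ⟨rfl, h1, -⟩ <;> simp [trap, h1]

theorem trap_ne_pos (i j : Fin 2) (k : ℕ) : b.trap i ≠ b.pos j k := by
  rcases sgn_cases i with ⟨rfl, h1, -⟩ | ⟨rfl, h1, -⟩ <;>
  rcases sgn_cases j with ⟨rfl, h2, -⟩ | ⟨rfl, h2, -⟩ <;>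
  · simp only [trap, pos, h1, h2]
    split_ifs <;> simp only [ne_eq, Prod.mk.injEq] <;> omega

theorem trap_ne_mid (i : Fin 2) : b.trap i ≠ b.mid := by
  rcases sgn_cases i with ⟨rfl, h1, -⟩ | ⟨rfl, h1, -⟩ <;> simp [trap, mid, h1]

theorem trap_ne_top (i : Fin 2) : b.trap i ≠ b.top := by
  rcases sgn_cases i with ⟨rfl, h1, -⟩ | ⟨rfl, h1, -⟩ <;> simp [trap, top, h1]

theorem trap_not_seed (i : Fin 2) : ¬ IsSeedSite (b.trap i) := by
  simp only [IsSeedSite, trap]; omega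

theorem apart_trap_answer (i : Fin 2) : Apart (b.trap i) (b.pos i (b.m + 3)) := by
  rcases sgn_cases i with ⟨rfl, h1, -⟩ | ⟨rfl, h1, -⟩ <;>
  · refine ⟨(trap_ne_pos _ _ _).symm, fun d => ?_⟩
    cases d <;> simp [trap, pos, h1, Dir.vec]

theorem apart_trap_mid (i : Fin 2) : Apart (b.trap i) b.mid := by
  rcases sgn_cases i with ⟨rfl, h1, -⟩ | ⟨rfl, h1, -⟩ <;>
  · refine ⟨(trap_ne_mid _).symm, fun d => ?_⟩
    cases d <;> simp [trap, mid, h1, Dir.vec]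

theorem apart_trap_top (i : Fin 2) : Apart (b.trap i) b.top := by
  rcases sgn_cases i with ⟨rfl, h1, -⟩ | ⟨rfl, h1, -⟩ <;>
  · refine ⟨(trap_ne_top _).symm, fun d => ?_⟩
    cases d <;> simp [trap, top, h1, Dir.vec]

/-- The sites excluded here include the pending site, which is adjacent to `mid`; a blockage there
would stop the object for the other process. For the indices excluded, `trap` is used. -/
theorem apart_pos_mid (i : Fin 2) {k : ℕ} (hk : k < b.m + 2 ∨ b.m + 4 < k) :
    Apart (b.pos i k) b.mid := by
  rcases sgn_cases i with ⟨rfl, h1, -⟩ | ⟨rfl, h1, -⟩ <;>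
  · refine ⟨(pos_ne_mid _ _).symm, fun d => ?_⟩
    simp only [mid, pos, h1]
    cases d <;> split_ifs <;> simp only [Dir.vec, Prod.mk_add_mk, ne_eq, Prod.mk.injEq] <;> omega

theorem apart_pos_top (i : Fin 2) {k : ℕ} (hk : k < b.m + 2 ∨ b.m + 4 < k) :
    Apart (b.pos i k) b.top := by
  rcases sgn_cases i with ⟨rfl, h1, -⟩ | ⟨rfl, h1, -⟩ <;>
  · refine ⟨(pos_ne_top _ _).symm, fun d => ?_⟩
    simp only [top, pos, h1]
    cases d <;> split_ifs <;> simp only [Dir.vec, Prod.mk_add_mk, ne_eq, Prod.mk.injEq] <;> omega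

theorem trap_adj_pending (i : Fin 2) : b.pos i (b.m + 2) + (sideOf i).vec = b.trap i := by
  rcases sgn_cases i with ⟨rfl, h1, h2, -⟩ | ⟨rfl, h1, h2, -⟩ <;>
    simp [trap, pos, h1, h2, Dir.vec]

theorem trap_adj_receive (i : Fin 2) : b.pos i (b.m + 4) + Dir.S.vec = b.trap i := by
  rcases sgn_cases i with ⟨rfl, h1, -⟩ | ⟨rfl, h1, -⟩ <;>
  · simp [trap, pos, h1, Dir.vec]
    ring

theorem trap_add_south (i : Fin 2) : b.trap i + Dir.S.vec = b.pos i b.m := by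
  simp [trap, pos, Dir.vec]

namespace St

noncomputable def full (x : b.St) (E : Finset (ℤ × ℤ)) : b.tileSet.Placement := fun p =>
  match x.asm p with
  | some t => some t
  | none => if p ∈ E then some .wall else none

/-- The tile configuration that represents the state `x` with blockages in `E`. -/
noncomputable def form (x : b.St) (E : Finset (ℤ × ℤ)) : b.tileSet.Assembly := ⟨x.full E, E⟩

theorem full_of_asm {x : b.St} {E : Finset (ℤ × ℤ)} {p : ℤ × ℤ} {t : b.Tile}
    (h : x.asm p = some t) : x.full E p = some t := by simp only [full, h]

theorem full_wall {x : b.St} {E : Finset (ℤ × ℤ)} {p : ℤ × ℤ} (h : x.asm p = none) (hp : p ∈ E) :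
    x.full E p = some .wall := by simp only [full, h, if_pos hp]

theorem full_eq_none {x : b.St} {E : Finset (ℤ × ℤ)} {p : ℤ × ℤ} :
    x.full E p = none ↔ x.asm p = none ∧ p ∉ E := by
  unfold full
  cases h : x.asm p <;> simp

theorem full_cases {x : b.St} {E : Finset (ℤ × ℤ)} {p : ℤ × ℤ} {t : b.Tile}
    (h : x.full E p = some t) : x.asm p = some t ∨ (t = .wall ∧ p ∈ E) := by
  unfold full at h
  cases hp : x.asm p with
  | some t' => rw [hp] at h; exact .inl h
  | none =>
    rw [hp] at h
    simp only at h
    split_ifs at h with h1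
    cases h
    exact .inr ⟨rfl, h1⟩

/-- Walls bind to nothing, so they matter only by impeding the sites around them. -/
theorem strengthAt_full (x : b.St) (E : Finset (ℤ × ℤ)) (t : b.Tile) (p : ℤ × ℤ) :
    b.tileSet.strengthAt (x.full E) t p = b.tileSet.strengthAt x.asm t p := by
  refine Finset.sum_congr rfl fun d _ => ?_
  unfold TileSet.bondAt
  cases h : x.asm (p + d.vec) with
  | some t' => rw [full_of_asm h]
  | none =>
    cases h' : x.full E (p + d.vec) with
    | none => rfl
    | some t' =>
      rcases full_cases h' with h2 | ⟨rfl, -⟩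
      · rw [h] at h2; cases h2
      · exact bond_wall t d

theorem full_update {x y : b.St} {p : ℤ × ℤ} {t : b.Tile}
    (h : y.asm = Function.update x.asm p (some t)) (E : Finset (ℤ × ℤ)) :
    y.full E = Function.update (x.full E) p (some t) := by
  funext q
  by_cases hq : q = p
  · subst hq; simp [full, h]
  · simp [full, h, hq]

/-! ### Additions of tiles -/

def setLen (x : b.St) (i : Fin 2) (n : ℕ) : b.St := { x with len := Function.update x.len i n }

def decide (x : b.St) (i : Fin 2) (v : b.V) : b.St := { x with dec := some (i, v) }

def spread (x : b.St) (v : b.V) : b.St := { x with ans := some v }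

theorem asm_ext {x y : b.St} {p : ℤ × ℤ} {t : b.Tile}
    (h : ∀ q s, y.Occ q s ↔ (q = p ∧ s = t) ∨ x.Occ q s) (hp : x.asm p = none) :
    y.asm = Function.update x.asm p (some t) := by
  funext q
  by_cases hq : q = p
  · subst hq
    rw [Function.update_self]
    exact asm_eq_some.2 ((h _ _).2 (.inl ⟨rfl, rfl⟩))
  · rw [Function.update_of_ne hq]
    cases hx : x.asm q with
    | some s => exact asm_eq_some.2 ((h _ _).2 (.inr (asm_eq_some.1 hx)))
    | none =>
      refine asm_eq_none.2 fun s hs => ?_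
      rcases (h _ _).1 hs with ⟨h1, -⟩ | h1
      · exact hq h1
      · exact asm_eq_none.1 hx s h1

theorem asm_setLen (x : b.St) (i : Fin 2) :
    (x.setLen i (x.len i + 1)).asm =
      Function.update x.asm (b.pos i (x.len i)) (some (x.trackTile i (x.len i))) := by
  refine asm_ext (fun q s => ?_) (asm_pos_none le_rfl)
  have hsucc : ∀ j k, k < (x.setLen i (x.len i + 1)).len j ↔ (j = i ∧ k = x.len i) ∨ k < x.len j := by
    intro j k
    by_cases hj : j = i
    · subst hj; simp only [setLen, Function.update_self, true_and]; omega
    · simp [setLen, hj]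
  constructor
  · rintro (h | h | h | ⟨j, k, hk, rfl, rfl⟩)
    · exact .inr (.inl h)
    · exact .inr (.inr (.inl h))
    · exact .inr (.inr (.inr (.inl h)))
    · rcases (hsucc j k).1 hk with ⟨rfl, rfl⟩ | hk
      · exact .inl ⟨rfl, rfl⟩
      · exact .inr (.inr (.inr (.inr ⟨j, k, hk, rfl, rfl⟩)))
  · rintro (⟨rfl, rfl⟩ | h | h | h | ⟨j, k, hk, rfl, rfl⟩)
    · exact .inr (.inr (.inr ⟨i, x.len i, (hsucc _ _).2 (.inl ⟨rfl, rfl⟩), rfl, rfl⟩))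
    · exact .inl h
    · exact .inr (.inl h)
    · exact .inr (.inr (.inl h))
    · exact .inr (.inr (.inr ⟨j, k, (hsucc _ _).2 (.inr hk), rfl, rfl⟩))

theorem asm_decide {x : b.St} (h : x.dec = none) (i : Fin 2) (v : b.V) :
    (x.decide i v).asm = Function.update x.asm b.mid (some (.dec i v)) := by
  refine asm_ext (fun q s => ?_) (by simp [asm_mid, h])
  constructor
  · rintro (h1 | ⟨j, w, h1, rfl, rfl⟩ | h1 | h1)
    · exact .inr (.inl h1)
    · cases h1; exact .inl ⟨rfl, rfl⟩
    · exact .inr (.inr (.inr (.inl h1)))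
    · exact .inr (.inr (.inr (.inr h1)))
  · rintro (⟨rfl, rfl⟩ | h1 | ⟨j, w, h1, -⟩ | h1 | h1)
    · exact .inr (.inl ⟨i, v, rfl, rfl, rfl⟩)
    · exact .inl h1
    · rw [h] at h1; cases h1
    · exact .inr (.inr (.inl h1))
    · exact .inr (.inr (.inr h1))

theorem asm_spread {x : b.St} (h : x.ans = none)
    (hx : ∀ i, b.m + 4 ≤ x.len i → (b.prop i (x.s i)).isSome → x.ans.isSome) (v : b.V) :
    (x.spread v).asm = Function.update x.asm b.top (some (.north v)) := by
  -- Spreading the answer does not relabel any tile in place: without an answer no invoking process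
  -- has a tile from `m + 3` on, and the others carry no label.
  have hl : ∀ i k, k < x.len i → (x.spread v).trackTile i k = x.trackTile i k := by
    intro i k hk
    have : (x.spread v).label i k = x.label i k := by
      unfold label
      by_cases hc : b.m + 3 ≤ k ∧ (b.prop i (x.s i)).isSome
      · have := hx i (by omega) hc.2
        simp [h] at this
      · rw [if_neg hc]; exact if_neg hc
    unfold trackTile
    rw [this]; rfl
  refine asm_ext (fun q s => ?_) (by simp [asm_top, h])
  constructor
  · rintro (h1 | h1 | ⟨w, h1, rfl, rfl⟩ | ⟨i, k, hk, rfl, rfl⟩)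
    · exact .inr (.inl h1)
    · exact .inr (.inr (.inl h1))
    · cases h1; exact .inl ⟨rfl, rfl⟩
    · exact .inr (.inr (.inr (.inr ⟨i, k, hk, rfl, hl i k hk⟩)))
  · rintro (⟨rfl, rfl⟩ | h1 | h1 | ⟨w, h1, -⟩ | ⟨i, k, hk, rfl, rfl⟩)
    · exact .inr (.inr (.inl ⟨v, rfl, rfl, rfl⟩))
    · exact .inl h1
    · exact .inr (.inl h1)
    · rw [h] at h1; cases h1
    · exact .inr (.inr (.inr ⟨i, k, hk, rfl, (hl i k hk).symm⟩))

/-! ### The intended additions are possible -/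

theorem canAttach_form {x : b.St} {E : Finset (ℤ × ℤ)} {p : ℤ × ℤ} {t : b.Tile}
    (hp : x.asm p = none) (hE : Free E p) (h : 2 ≤ b.tileSet.strengthAt x.asm t p) :
    (x.form E).CanAttach p t :=
  ⟨full_eq_none.2 ⟨hp, fun h => (hE p h).1 rfl⟩, fun d hd => (hE _ hd).2 d rfl,
    (strengthAt_full x E t p).symm ▸ h⟩

theorem bondAt_le_strengthAt (a : b.tileSet.Placement) (t : b.Tile) (p : ℤ × ℤ) (d : Dir) :
    b.tileSet.bondAt a t p d ≤ b.tileSet.strengthAt a t p :=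
  Finset.single_le_sum (f := fun d => b.tileSet.bondAt a t p d) (fun _ _ => Nat.zero_le _)
    (Finset.mem_univ d)

theorem add_bondAt_le_strengthAt (a : b.tileSet.Placement) (t : b.Tile) (p : ℤ × ℤ) {d d' : Dir}
    (h : d ≠ d') :
    b.tileSet.bondAt a t p d + b.tileSet.bondAt a t p d' ≤ b.tileSet.strengthAt a t p := by
  rw [← Finset.sum_pair h]
  exact Finset.sum_le_sum_of_subset (Finset.subset_univ _)

theorem bondAt_asm {x : b.St} {p q : ℤ × ℤ} {t t' : b.Tile} {d : Dir} (hq : p + d.vec = q)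
    (hx : x.asm q = some t') : b.tileSet.bondAt x.asm t p d = b.tileSet.bond t d t' := by
  unfold TileSet.bondAt
  rw [hq, hx]

theorem glue_inn (i : Fin 2) (s : b.S i) (w : Option b.V) (c : Fin (b.K + 1)) :
    b.glue (.track i s w c) (b.innDir i c) =
      (if c.val = 0 then .root else .link i s (if c.val = b.m + 3 then none else w) c,
        if c.val = b.m + 3 ∧ (b.prop i s).isSome then 1 else 2) := by
  simp [glue, trackGlue]

theorem glue_out (i : Fin 2) (s : b.S i) (w : Option b.V) (c : Fin (b.K + 1)) [Decidable (b.cont i s w c)] :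
    b.glue (.track i s w c) (b.outDir i c) =
      (if b.cont i s w c then .link i s w (min (c + 1) b.K) else .blank,
        if c.val = b.m + 2 ∧ (b.prop i s).isSome then 1 else 2) := by
  simp [glue, trackGlue, (innDir_ne_outDir i c).symm]

theorem sideOf_ne_inward (i : Fin 2) : sideOf i ≠ inward i := (Dir.opp_ne _).symm

theorem north_ne_inward (i : Fin 2) : Dir.N ≠ inward i ∧ Dir.S ≠ inward i ∧ Dir.N ≠ sideOf i ∧
    Dir.S ≠ sideOf i := by
  rcases sgn_cases i with ⟨rfl, h1, h2, h3⟩ | ⟨rfl, h1, h2, h3⟩ <;> simp [h2, h3]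

/-- The track can grow if its site is unimpeded, its last tile permits a successor, and, at the
answer site of an invoking process, the answer has been spread. -/
theorem canAttach_track {x : b.St} {E : Finset (ℤ × ℤ)} {i : Fin 2}
    (hE : Free E (b.pos i (x.len i)))
    (hc : ∀ k, k + 1 = x.len i → b.cont i (x.s i) (x.label i k) (b.cap k))
    (ha : x.len i = b.m + 3 → (b.prop i (x.s i)).isSome → x.ans.isSome) :
    (x.form E).CanAttach (b.pos i (x.len i)) (x.trackTile i (x.len i)) := by
  classical
  refine canAttach_form (asm_pos_none le_rfl) hE ?_
  rcases Nat.eq_zero_or_eq_succ_pred (x.len i) with h0 | h0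
  · rw [h0]
    refine le_trans ?_ (bondAt_le_strengthAt _ _ _ (inward i))
    rw [bondAt_asm rfl (asm_seed (isSeedSite_pos_zero_add i))]
    have h1 : b.glue (x.trackTile i 0) (inward i) = (.root, 2) := by
      have h := glue_inn i (x.s i) (x.label i 0) (b.cap 0)
      simpa [trackTile, innDir_cap, innDir_zero, cap_val] using h
    have h2 : b.glue .seed (inward i).opp = (.root, 2) := by
      rw [inward, Dir.opp_opp]
      rcases sgn_cases i with ⟨rfl, -, h2, h3⟩ | ⟨rfl, -, h2, h3⟩ <;> simp [glue, h2]
    rw [bond_eq (by rw [h1, h2]; exact .root) (by rw [h1, h2]), h1]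
    simp
  · generalize (x.len i).pred = k at h0
    have hk := hc k h0.symm
    have hle := b.le_K
    have hd : b.pos i (x.len i) + (b.innDir i (x.len i)).vec = b.pos i k := by
      rw [h0]; exact pos_add_innDir i k
    have hb := bondAt_asm (t := x.trackTile i (x.len i)) hd (asm_pos (show k < x.len i by omega))
    have h1 : b.glue (x.trackTile i (x.len i)) (b.innDir i (x.len i)) =
        (.link i (x.s i) (x.label i k) (min (k + 1) b.K),
          if k = b.m + 2 ∧ (b.prop i (x.s i)).isSome then 1 else 2) := by
      have h := glue_inn i (x.s i) (x.label i (x.len i)) (b.cap (x.len i))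
      rw [innDir_cap] at h
      refine h.trans ?_
      have e1 : (b.cap (x.len i)).val = b.m + 3 ↔ k = b.m + 2 := by
        rw [cap_val_eq (by omega)]; omega
      have e2 : (b.cap (x.len i)).val ≠ 0 := by rw [cap_val]; omega
      simp only [e1, e2, if_false]
      simp only [cap_val, h0]
      congr 2
      unfold label
      grind
    have h2 : b.glue (x.trackTile i k) (b.innDir i (x.len i)).opp =
        (.link i (x.s i) (x.label i k) (min (k + 1) b.K),
          if k = b.m + 2 ∧ (b.prop i (x.s i)).isSome then 1 else 2) := by
      rw [h0, Nat.succ_eq_add_one, innDir_succ, Dir.opp_opp, ← outDir_cap]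
      refine (glue_out i (x.s i) (x.label i k) (b.cap k)).trans ?_
      rw [if_pos hk]
      simp only [cap_val_eq (show b.m + 2 < b.m + 5 by omega)]
      simp only [cap_val]
      congr 2
      omega
    rw [bond_eq (by rw [h1, h2]; exact .link _ _ _ _) (by rw [h1, h2]), h1] at hb
    -- The answer tile adds one unit from the pending tile in the south to one unit from `top`;
    -- every other track tile has a link of strength 2.
    by_cases hs : k = b.m + 2 ∧ (b.prop i (x.s i)).isSome
    · have hlen : x.len i = b.m + 3 := by omega
      obtain ⟨v, hv⟩ := Option.isSome_iff_exists.1 (ha hlen hs.2)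
      have hb' := bondAt_asm (t := x.trackTile i (x.len i)) (hlen ▸ pos_answer_add i)
        (x := x) (t' := .north v) (by rw [asm_top, hv]; rfl)
      have hin : b.innDir i (b.m + 3) = .S := by simp [innDir]
      have h3 : b.glue (x.trackTile i (x.len i)) (inward i) = (.ack v, 1) := by
        have hcv : (b.cap (b.m + 3)).val = b.m + 3 := cap_val_of_lt (by omega)
        have hout : b.outDir i (b.m + 3) = sideOf i := by simp [outDir]
        simp [trackTile, glue, trackGlue, hlen, label, hs.2, hv, hcv, hin, hout,
          (north_ne_inward i).2.1.symm, (sideOf_ne_inward i).symm]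
      have h4 : b.glue (.north v) (inward i).opp = (.ack v, 1) := by
        rw [inward, Dir.opp_opp]
        simp [glue, (north_ne_inward i).2.2.1.symm, (north_ne_inward i).2.2.2.symm]
      rw [bond_eq (by rw [h3, h4]; exact .ack _) (by rw [h3, h4]), h3] at hb'
      refine le_trans ?_ (add_bondAt_le_strengthAt _ _ _ (d := b.innDir i (x.len i))
        (d' := inward i) ?_)
      · rw [hb, hb', if_pos hs]; simp
      · rw [hlen, hin]; exact (north_ne_inward i).2.1
    · refine le_trans ?_ (bondAt_le_strengthAt _ _ _ (b.innDir i (x.len i)))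
      rw [hb, if_neg hs]; simp

theorem canAttach_dec {x : b.St} {E : Finset (ℤ × ℤ)} {i : Fin 2} {v : b.V} (hE : Free E b.mid)
    (hd : x.dec = none) (hv : b.prop i (x.s i) = some v) (hl : b.m + 2 < x.len i) :
    (x.form E).CanAttach b.mid (.dec i v) := by
  refine canAttach_form (by simp [asm_mid, hd]) hE ?_
  refine le_trans ?_ (bondAt_le_strengthAt _ _ _ (sideOf i))
  rw [bondAt_asm (mid_add_sideOf i) (asm_pos hl)]
  have h1 : b.glue (.dec i v) (sideOf i) = (.val v, 2) := by
    simp [glue, (north_ne_inward i).2.2.1.symm, (north_ne_inward i).2.2.2.symm]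
  have h2 : b.glue (x.trackTile i (b.m + 2)) (sideOf i).opp = (.prp v, 2) := by
    have hcv : (b.cap (b.m + 2)).val = b.m + 2 := cap_val_of_lt (by omega)
    have hin : b.innDir i (b.m + 2) = .S := by simp [innDir]
    have hout : b.outDir i (b.m + 2) = .N := by simp [outDir]
    change b.glue (x.trackTile i (b.m + 2)) (inward i) = _
    simp [trackTile, glue, trackGlue, hcv, hin, hout, hv,
      (north_ne_inward i).2.1.symm, (north_ne_inward i).1.symm]
  rw [bond_eq (by rw [h1, h2]; exact .valPrp _) (by rw [h1, h2]), h1]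
  simp

theorem canAttach_north {x : b.St} {E : Finset (ℤ × ℤ)} {i : Fin 2} {v : b.V} (hE : Free E b.top)
    (ha : x.ans = none) (hd : x.dec = some (i, v)) :
    (x.form E).CanAttach b.top (.north v) := by
  refine canAttach_form (by simp [asm_top, ha]) hE ?_
  refine le_trans ?_ (bondAt_le_strengthAt _ _ _ .S)
  rw [bondAt_asm top_add_south (t' := .dec i v) (by simp [asm_mid, hd])]
  have h1 : b.glue (.north v) .S = (.ack v, 2) := by simp [glue]
  have h2 : b.glue (.dec i v) (Dir.S).opp = (.ack v, 2) := by simp [glue, Dir.opp]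
  rw [bond_eq (by rw [h1, h2]; exact .ack _) (by rw [h1, h2]), h1]
  simp

theorem attach_track {x : b.St} {E : Finset (ℤ × ℤ)} {i : Fin 2}
    (hE : Free E (b.pos i (x.len i)))
    (hc : ∀ k, k + 1 = x.len i → b.cont i (x.s i) (x.label i k) (b.cap k))
    (ha : x.len i = b.m + 3 → (b.prop i (x.s i)).isSome → x.ans.isSome) :
    (x.form E).Attach ((x.setLen i (x.len i + 1)).form E) :=
  ⟨_, _, canAttach_track hE hc ha, full_update (asm_setLen x i) E, rfl⟩

theorem attach_dec {x : b.St} {E : Finset (ℤ × ℤ)} {i : Fin 2} {v : b.V} (hE : Free E b.mid)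
    (hd : x.dec = none) (hv : b.prop i (x.s i) = some v) (hl : b.m + 2 < x.len i) :
    (x.form E).Attach ((x.decide i v).form E) :=
  ⟨_, _, canAttach_dec hE hd hv hl, full_update (asm_decide hd i v) E, rfl⟩

theorem attach_north {x : b.St} {E : Finset (ℤ × ℤ)} {i : Fin 2} {v : b.V} (hE : Free E b.top)
    (hx : ∀ i, b.m + 4 ≤ x.len i → (b.prop i (x.s i)).isSome → x.ans.isSome)
    (ha : x.ans = none) (hd : x.dec = some (i, v)) :
    (x.form E).Attach ((x.spread v).form E) :=
  ⟨_, _, canAttach_north hE ha hd, full_update (asm_spread ha hx v) E, rfl⟩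

/-- Where a blockage is put to represent a crash of process `i`. -/
def blk (x : b.St) (i : Fin 2) : ℤ × ℤ :=
  if b.m + 2 ≤ x.len i ∧ x.len i ≤ b.m + 4 then b.trap i else b.pos i (x.len i)

theorem asm_trap (x : b.St) (i : Fin 2) : x.asm (b.trap i) = none := by
  rw [asm_eq_none]
  rintro t (⟨h2, rfl⟩ | ⟨j, w, h2, h3, rfl⟩ | ⟨w, h2, h3, rfl⟩ | ⟨j, n, h2, h3, rfl⟩)
  · exact trap_not_seed _ h2
  · exact trap_ne_mid _ h3
  · exact trap_ne_top _ h3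
  · exact trap_ne_pos _ _ _ h3

theorem asm_blk (x : b.St) (i : Fin 2) : x.asm (x.blk i) = none := by
  unfold blk
  split_ifs
  · exact asm_trap x i
  · exact asm_pos_none le_rfl

theorem one_le_sgn_mul_blk (x : b.St) (i : Fin 2) : 1 ≤ sgn i * (x.blk i).1 := by
  unfold blk
  split_ifs
  · exact one_le_sgn_mul_trap i
  · exact one_le_sgn_mul_pos i _

theorem apart_blk_mid (x : b.St) (i : Fin 2) : Apart (x.blk i) b.mid := by
  unfold blk
  split_ifs
  · exact apart_trap_mid i
  · exact apart_pos_mid i (by omega)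

theorem apart_blk_top (x : b.St) (i : Fin 2) : Apart (x.blk i) b.top := by
  unfold blk
  split_ifs
  · exact apart_trap_top i
  · exact apart_pos_top i (by omega)

/-- A wall binds with strength 0 everywhere, and it always finds a nonzero glue to abut on: the
north of tile `m` at `trap`, and otherwise the outgoing side of the last tile, even if the track has
come to its end. -/
theorem block_form {x : b.St} {i : Fin 2} (h1 : 1 ≤ x.len i) {E : Finset (ℤ × ℤ)}
    (hE : x.blk i ∉ E) : (x.form E).Block (x.form (insert (x.blk i) E)) := by
  classical
  refine ⟨x.blk i, .wall, full_eq_none.2 ⟨asm_blk x i, hE⟩, ?_, ?_, ?_, rfl⟩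
  · rw [show (x.form E).tile = x.full E from rfl, strengthAt_full]
    have : b.tileSet.strengthAt x.asm Tile.wall (x.blk i) = 0 := by
      refine Finset.sum_eq_zero fun d _ => ?_
      unfold TileSet.bondAt
      cases x.asm (x.blk i + d.vec) with
      | none => rfl
      | some t' => exact wall_bond t' d
    omega
  · have hle := b.le_K
    unfold blk
    split_ifs with hb
    · refine ⟨.S, x.trackTile i b.m, ?_, ?_, wall_bond _ _⟩
      · rw [trap_add_south]
        exact full_of_asm (asm_pos (by omega))
      · have hcv : (b.cap b.m).val = b.m := cap_val_of_lt (by omega)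
        have hm := b.one_le_m
        have hin : b.innDir i b.m = .S := by simp [innDir]; omega
        have hout : b.outDir i b.m = inward i := by simp [outDir]
        simp [trackTile, glue, trackGlue, hcv, hin, hout, Dir.opp, (north_ne_inward i).1]
    · obtain ⟨k, hk⟩ := Nat.exists_eq_add_of_le' h1
      refine ⟨b.innDir i (x.len i), x.trackTile i k, ?_, ?_, wall_bond _ _⟩
      · rw [hk, pos_add_innDir]
        exact full_of_asm (asm_pos (by omega))
      · rw [hk, innDir_succ, Dir.opp_opp, ← outDir_cap]
        change (b.glue (.track i (x.s i) (x.label i k) (b.cap k)) (b.outDir i (b.cap k))).2 ≠ 0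
        rw [glue_out]
        dsimp only
        split_ifs <;> decide
  · funext q
    by_cases hq : q = x.blk i
    · subst hq
      simp only [form, Function.update_self]
      exact full_wall (asm_blk x i) (Finset.mem_insert_self _ _)
    · simp only [form, Function.update_of_ne hq, full, Finset.mem_insert, hq, false_or]

end St

end Blueprint

namespace Blueprint

variable {b : Blueprint}

namespace St

/-! ### Growth of states -/

/-- The state `y` may be reached from `x`. -/
structure Le (x y : b.St) : Prop where
  s : y.s = x.s
  len : ∀ i, x.len i ≤ y.len i
  dec : ∀ e, x.dec = some e → y.dec = some e
  ans : ∀ v, x.ans = some v → y.ans = some v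

theorem Le.refl (x : b.St) : x.Le x := ⟨rfl, fun _ => le_rfl, fun _ h => h, fun _ h => h⟩

theorem Le.trans {x y z : b.St} (h : x.Le y) (h' : y.Le z) : x.Le z :=
  ⟨h'.s.trans h.s, fun i => (h.len i).trans (h'.len i), fun _ he => h'.dec _ (h.dec _ he),
    fun _ he => h'.ans _ (h.ans _ he)⟩

/-- Validity makes the answer present before the first tile that carries it, so later growth cannot
change a label. -/
theorem Le.label {x y : b.St} (hx : x.Valid) (h : x.Le y) {i : Fin 2} {k : ℕ} (hk : k < x.len i) :
    y.label i k = x.label i k := by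
  unfold St.label
  rw [h.s]
  split_ifs with hc
  · obtain ⟨v, hv⟩ := Option.isSome_iff_exists.1 (hx.ans_of_len i (by omega) hc.2)
    rw [hv, h.ans v hv]
  · rfl

theorem Le.trackTile {x y : b.St} (hx : x.Valid) (h : x.Le y) {i : Fin 2} {k : ℕ}
    (hk : k < x.len i) : y.trackTile i k = x.trackTile i k := by
  unfold St.trackTile
  rw [h.label hx hk, h.s]

theorem Le.sub {x y : b.St} (hx : x.Valid) (h : x.Le y) : x.asm.Sub y.asm := by
  intro p t hp
  rw [asm_eq_some] at hp ⊢
  rcases hp with h1 | ⟨i, v, h1, h2⟩ | ⟨v, h1, h2⟩ | ⟨i, k, hk, h2, rfl⟩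
  · exact .inl h1
  · exact .inr (.inl ⟨i, v, h.dec _ h1, h2⟩)
  · exact .inr (.inr (.inl ⟨v, h.ans _ h1, h2⟩))
  · exact .inr (.inr (.inr ⟨i, k, hk.trans_le (h.len i), h2, (h.trackTile hx hk).symm⟩))

/-- No blockage in `E` lies on an occupied site. -/
def Clear (x : b.St) (E : Finset (ℤ × ℤ)) : Prop := ∀ p ∈ E, x.asm p = none

theorem Le.sub_full {x y : b.St} (hx : x.Valid) (h : x.Le y) {E : Finset (ℤ × ℤ)}
    (hy : y.Clear E) : (x.full E).Sub (y.full E) := by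
  intro p t hp
  rcases full_cases hp with h1 | ⟨rfl, h1⟩
  · exact full_of_asm (h.sub hx p t h1)
  · exact full_wall (hy p h1) h1

theorem Valid.setLen {x : b.St} (hx : x.Valid) (i : Fin 2)
    (ha : x.len i = b.m + 3 → (b.prop i (x.s i)).isSome → x.ans.isSome) :
    (x.setLen i (x.len i + 1)).Valid := by
  have hlen : ∀ j, x.len j ≤ (x.setLen i (x.len i + 1)).len j := by
    intro j
    by_cases hj : j = i
    · subst hj; simp [St.setLen]
    · simp [St.setLen, hj]
  refine ⟨fun j => (hx.one_le_len j).trans (hlen j), fun j hj => (hx.le_len j hj).trans (hlen j),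
    hx.dec_of_ans, fun j v hj => ⟨(hx.prop_of_dec j v hj).1, (hx.prop_of_dec j v hj).2.trans (hlen j)⟩,
    fun j hj hp => ?_⟩
  change b.m + 4 ≤ Function.update x.len i (x.len i + 1) j at hj
  by_cases hji : j = i
  · subst hji
    rw [Function.update_self] at hj
    by_cases h4 : b.m + 4 ≤ x.len j
    · exact hx.ans_of_len j h4 hp
    · exact ha (by omega) hp
  · rw [Function.update_of_ne hji] at hj
    exact hx.ans_of_len j hj hp

theorem Valid.decide {x : b.St} (hx : x.Valid) (hd : x.dec = none) {i : Fin 2} {v : b.V}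
    (hv : b.prop i (x.s i) = some v) (hl : b.m + 2 < x.len i) : (x.decide i v).Valid := by
  refine ⟨hx.one_le_len, hx.le_len, fun w hw => ?_, ?_, hx.ans_of_len⟩
  · obtain ⟨j, hj⟩ := hx.dec_of_ans w hw
    rw [hd] at hj; cases hj
  · rintro j w hj
    cases hj
    exact ⟨hv, hl⟩

theorem Valid.spread {x : b.St} (hx : x.Valid) {i : Fin 2} {v : b.V} (hd : x.dec = some (i, v)) :
    (x.spread v).Valid := by
  refine ⟨hx.one_le_len, hx.le_len, ?_, hx.prop_of_dec, fun _ _ _ => rfl⟩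
  rintro w hw
  cases hw
  exact ⟨i, hd⟩

theorem le_setLen (x : b.St) (i : Fin 2) : x.Le (x.setLen i (x.len i + 1)) := by
  refine ⟨rfl, fun j => ?_, fun _ h => h, fun _ h => h⟩
  by_cases hj : j = i
  · subst hj; simp [St.setLen]
  · simp [St.setLen, hj]

theorem le_decide {x : b.St} (hd : x.dec = none) (i : Fin 2) (v : b.V) : x.Le (x.decide i v) :=
  ⟨rfl, fun _ => le_rfl, fun _ h => (by rw [hd] at h; cases h), fun _ h => h⟩

theorem le_spread {x : b.St} (ha : x.ans = none) (v : b.V) : x.Le (x.spread v) :=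
  ⟨rfl, fun _ => le_rfl, fun _ h => h, fun _ h => by rw [ha] at h; cases h⟩

theorem Clear.update {x y : b.St} {p : ℤ × ℤ} {t : b.Tile} {E : Finset (ℤ × ℤ)}
    (h : y.asm = Function.update x.asm p (some t)) (hp : p ∉ E) (hx : x.Clear E) : y.Clear E := by
  intro q hq
  have : q ≠ p := by rintro rfl; exact hp hq
  rw [h, Function.update_of_ne this]
  exact hx q hq

/-- A legal addition leads to another state, unless the track in question is blocked. -/
theorem Valid.of_attach {x : b.St} (hx : x.Valid) {E : Finset (ℤ × ℤ)} (hE : x.Clear E)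
    {β : b.tileSet.Assembly} (h : (x.form E).Attach β) :
    ∃ y : b.St, y.Valid ∧ y.Clear E ∧ x.Le y ∧ β = y.form E ∧
      ∀ i, ¬ Free E (b.pos i (x.len i)) → y.len i = x.len i := by
  obtain ⟨p, t, ⟨hp, hn, hs⟩, ht, he⟩ := h
  have hp := full_eq_none.1 hp
  rw [show (x.form E).tile = x.full E from rfl, strengthAt_full] at hs
  have hβ : ∀ {y : b.St}, y.asm = Function.update x.asm p (some t) → β = y.form E := by
    intro y hy
    exact TileSet.Assembly.ext' (ht.trans (full_update hy E).symm) he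
  rcases hx.attach_cases hp.1 hs with ⟨i, k, hk, rfl, rfl, hc, ha⟩ | ⟨i, v, rfl, rfl, hv, hl⟩ |
    ⟨i, v, rfl, rfl, hd⟩
  · rw [hk] at hp hβ hn
    have hy := asm_setLen x i
    refine ⟨x.setLen i (x.len i + 1), hx.setLen i fun h1 h2 => ha (by omega) h2,
      hE.update hy hp.2, le_setLen x i, hβ hy, fun j hj => ?_⟩
    have : j ≠ i := by
      rintro rfl
      refine hj fun q hq => ⟨?_, fun d hd => hn d (hd ▸ hq)⟩
      rintro rfl
      exact hp.2 hq
    simp [St.setLen, this]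
  · have hd : x.dec = none := by
      have := hp.1
      rw [asm_mid] at this
      simpa using this
    have hy := asm_decide hd i v
    exact ⟨x.decide i v, hx.decide hd hv hl, hE.update hy hp.2, le_decide hd i v, hβ hy,
      fun _ _ => rfl⟩
  · have ha : x.ans = none := by
      have := hp.1
      rw [asm_top] at this
      simpa using this
    have hy := asm_spread ha hx.ans_of_len v
    exact ⟨x.spread v, hx.spread hd, hE.update hy hp.2, le_spread ha v, hβ hy, fun _ _ => rfl⟩

/-- The states that a fair assembly sequence goes through. -/
structure Follows (x : b.St) (E : Finset (ℤ × ℤ)) (seq : ℕ → b.tileSet.Assembly) (X : ℕ → b.St) :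
    Prop where
  fairSeq : (x.form E).FairSeq seq
  zero : X 0 = x
  eq : ∀ n, seq n = (X n).form E
  valid : ∀ n, (X n).Valid
  clear : ∀ n, (X n).Clear E
  mono : ∀ n n', n ≤ n' → (X n).Le (X n')
  blocked : ∀ n i, ¬ Free E (b.pos i (x.len i)) → (X n).len i = x.len i

theorem Valid.exists_follows {x : b.St} (hx : x.Valid) {E : Finset (ℤ × ℤ)} (hE : x.Clear E)
    {seq : ℕ → b.tileSet.Assembly} (h : (x.form E).FairSeq seq) :
    ∃ X, x.Follows E seq X := by
  let Q : ℕ → b.St → Prop := fun n y => seq n = y.form E ∧ y.Valid ∧ y.Clear E ∧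
    ∀ i, ¬ Free E (b.pos i (x.len i)) → y.len i = x.len i
  have hstep : ∀ n y, Q n y → ∃ z, Q (n + 1) z ∧ y.Le z := by
    rintro n y ⟨h1, h2, h3, h4⟩
    rcases h.step n with h5 | h5
    · exact ⟨y, ⟨h5.trans h1, h2, h3, h4⟩, Le.refl y⟩
    · rw [h1] at h5
      obtain ⟨z, hz1, hz2, hz3, hz4, hz5⟩ := h2.of_attach h3 h5
      refine ⟨z, ⟨hz4, hz1, hz2, fun i hi => ?_⟩, hz3⟩
      rw [hz5 i (by rw [h4 i hi]; exact hi), h4 i hi]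
  choose! f hf hf' using hstep
  -- The states are chosen along the sequence, each from the previous one, so that they increase.
  let X : ℕ → b.St := fun n => Nat.rec x (fun n y => f n y) n
  have hQ : ∀ n, Q n (X n) := by
    intro n
    induction n with
    | zero => exact ⟨h.start, hx, hE, fun _ _ => rfl⟩
    | succ n ih => exact hf n _ ih
  refine ⟨X, h, rfl, fun n => (hQ n).1, fun n => (hQ n).2.1, fun n => (hQ n).2.2.1, ?_,
    fun n => (hQ n).2.2.2⟩
  intro n n' hn
  induction n', hn using Nat.le_induction with
  | base => exact Le.refl _
  | succ k _ ih => exact ih.trans (hf' k _ (hQ k))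

namespace Follows

variable {x : b.St} {E : Finset (ℤ × ℤ)} {seq : ℕ → b.tileSet.Assembly} {X : ℕ → b.St}

/-- Fairness gives a later stage at which the site is not open to binding. As all conditions for the
addition persist, the tile must be in place by then. -/
theorem grows (h : x.Follows E seq X) {n : ℕ} {i : Fin 2} {k : ℕ} (hk : (X n).len i = k + 1)
    (hE : Free E (b.pos i (k + 1)))
    (hc : b.cont i ((X n).s i) ((X n).label i k) (b.cap k))
    (ha : k + 1 = b.m + 3 → (b.prop i ((X n).s i)).isSome → (X n).ans.isSome) :
    ∃ n', n ≤ n' ∧ k + 1 < (X n').len i := by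
  obtain ⟨n', hn, hno⟩ := h.fairSeq.fair (b.pos i (k + 1)) n
  have hle := h.mono n n' hn
  refine ⟨n', hn, ?_⟩
  by_contra hlt
  have hlen : (X n').len i = k + 1 := by have := hle.len i; omega
  apply hno
  rw [h.eq n']
  have := canAttach_track (x := X n') (E := E) (i := i) (hlen ▸ hE) ?_ ?_
  · rw [hlen] at this; exact ⟨_, this⟩
  · intro k' hk'
    obtain rfl : k' = k := by omega
    rw [hle.label (h.valid n) (by omega), hle.s]
    exact hc
  · intro h1 h2
    rw [hle.s] at h2
    obtain ⟨v, hv⟩ := Option.isSome_iff_exists.1 (ha (by omega) h2)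
    rw [hle.ans v hv]; rfl

/-- The decision may come from either process; a pending proposal only ensures that the site cannot
stay empty. -/
theorem decides (h : x.Follows E seq X) {n : ℕ} {i : Fin 2} {v : b.V} (hE : Free E b.mid)
    (hv : b.prop i ((X n).s i) = some v) (hl : b.m + 2 < (X n).len i) :
    ∃ n', n ≤ n' ∧ (X n').dec.isSome := by
  obtain ⟨n', hn, hno⟩ := h.fairSeq.fair b.mid n
  have hle := h.mono n n' hn
  refine ⟨n', hn, ?_⟩
  by_contra hd
  apply hno
  rw [h.eq n']
  exact ⟨_, canAttach_dec hE (by simpa using hd) (by rw [hle.s]; exact hv)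
    (hl.trans_le (hle.len i))⟩

theorem spreads (h : x.Follows E seq X) {n : ℕ} {i : Fin 2} {v : b.V} (hE : Free E b.top)
    (hd : (X n).dec = some (i, v)) : ∃ n', n ≤ n' ∧ (X n').ans = some v := by
  obtain ⟨n', hn, hno⟩ := h.fairSeq.fair b.top n
  have hle := h.mono n n' hn
  refine ⟨n', hn, ?_⟩
  cases ha : (X n').ans with
  | some w =>
    obtain ⟨j, hj⟩ := (h.valid n').dec_of_ans w ha
    rw [hle.dec _ hd] at hj
    cases hj
    rfl
  | none =>
    exfalso
    apply hno
    rw [h.eq n']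
    exact ⟨_, canAttach_north hE ha (hle.dec _ hd)⟩

end Follows

/-! ### The rays that carry the answers -/

theorem linked_of {x : b.St} {E : Finset (ℤ × ℤ)} {g : b.Glue} {p q : ℤ × ℤ} {t t' : b.Tile}
    {d : Dir} {n : Fin 3} (hq : p + d.vec = q) (hp : x.asm p = some t) (hq' : x.asm q = some t')
    (hg : b.Binds g g) (h1 : b.glue t d = (g, n)) (h2 : b.glue t' d.opp = (g, n)) (hn : n ≠ 0) :
    (x.form E).Linked g p q := by
  refine ⟨d, t, t', hq.symm, full_of_asm hp, full_of_asm hq', congrArg Prod.fst h1,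
    congrArg Prod.fst h2, ?_⟩
  rw [bond_eq (by rw [h1, h2]; exact hg) (by rw [h1, h2]), h1]
  simp only [Fin.val_pos_iff]
  exact Fin.pos_of_ne_zero hn

theorem glue_answer (i : Fin 2) (s : b.S i) (v : b.V) :
    b.glue (.track i s (some v) (b.cap (b.m + 3))) (inward i) = (.ack v, 1) := by
  have hcv : (b.cap (b.m + 3)).val = b.m + 3 := cap_val_of_lt (by omega)
  have hin : b.innDir i (b.m + 3) = .S := by simp [innDir]
  have hout : b.outDir i (b.m + 3) = sideOf i := by simp [outDir]
  simp [glue, trackGlue, hcv, hin, hout, (north_ne_inward i).2.1.symm, (sideOf_ne_inward i).symm]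

theorem glue_north_side (i : Fin 2) (v : b.V) : b.glue (.north v) (sideOf i) = (.ack v, 1) := by
  simp [glue, (north_ne_inward i).2.2.1.symm, (north_ne_inward i).2.2.2.symm]

theorem onSide_pos {i j : Fin 2} {k : ℕ} : OnSide j b.mid (b.pos i k) ↔ i = j := by
  have := one_le_sgn_mul_pos (b := b) i k
  rcases sgn_cases i with ⟨rfl, h1, -⟩ | ⟨rfl, h1, -⟩ <;>
  rcases sgn_cases j with ⟨rfl, h2, -⟩ | ⟨rfl, h2, -⟩ <;>
  · rw [h1] at this
    simp [OnSide, mid]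
    omega

theorem not_onSide {j : Fin 2} {p : ℤ × ℤ} (hp : p.1 = 0) : ¬ OnSide j b.mid p := by
  unfold OnSide mid
  split_ifs <;> simp [hp]

theorem Valid.ray_iff {x : b.St} (hx : x.Valid) (E : Finset (ℤ × ℤ)) (j : Fin 2) (w : b.V) :
    (∃ p, OnSide j b.mid p ∧ ReflTransGen ((x.form E).Linked (.ack w)) b.mid p) ↔
      x.ans = some w ∧ (b.prop j (x.s j)).isSome ∧ b.m + 4 ≤ x.len j := by
  constructor
  · rintro ⟨p, hp, hr⟩
    -- The last bond of the ray suffices: on the side of process `j` only its answer tile shows an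
    -- acknowledgement glue.
    rcases ReflTransGen.cases_tail hr with h | ⟨q, -, d, t, t', -, -, ht, -, hg, -⟩
    · exact absurd hp (not_onSide (h ▸ rfl))
    · rcases full_cases ht with ht | ⟨rfl, -⟩
      · rw [asm_eq_some] at ht
        rcases ht with ⟨h2, rfl⟩ | ⟨i, v, h2, rfl, rfl⟩ | ⟨v, h2, rfl, rfl⟩ | ⟨i, k, hk, rfl, rfl⟩
        · change (b.glue .seed d.opp).1 = .ack w at hg
          simp only [glue] at hg
          split_ifs at hg
        · exact absurd hp (not_onSide rfl)
        · exact absurd hp (not_onSide rfl)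
        · obtain rfl := onSide_pos.1 hp
          rcases glue_ack hg with ⟨i', h5, -⟩ | ⟨h5, -⟩ | ⟨h5, -⟩ | ⟨i', s, c, h5, hc, -⟩
          · cases h5
          · cases h5
          · cases h5
          · unfold St.trackTile at h5
            injection h5 with h5 h6 h7 h8
            subst h5 h8
            rw [cap_val_eq (by omega)] at hc
            unfold St.label at h7
            split_ifs at h7 with h9
            exact ⟨h7, h9.2, by omega⟩
      · change (b.glue .wall d.opp).1 = .ack w at hg
        cases hg
  · rintro ⟨ha, hp, hl⟩
    obtain ⟨i, hd⟩ := hx.dec_of_ans w ha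
    have hmid : x.asm b.mid = some (.dec i w) := by rw [asm_mid, hd]; rfl
    have htop : x.asm b.top = some (.north w) := by rw [asm_top, ha]; rfl
    refine ⟨b.pos j (b.m + 3), onSide_pos.2 rfl, ReflTransGen.tail (ReflTransGen.single
      (linked_of mid_add_north hmid htop (.ack w) (n := 2) (by simp [glue])
        (by simp [glue, Dir.opp]) (by decide))) ?_⟩
    refine linked_of (top_add_sideOf j) htop (asm_pos (by omega)) (.ack w)
      (glue_north_side j w) ?_ (by decide : (1 : Fin 3) ≠ 0)
    have : x.label j (b.m + 3) = some w := by
      unfold St.label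
      rw [if_pos ⟨le_rfl, hp⟩, ha]
    unfold St.trackTile
    rw [this]
    exact glue_answer j _ w

end St

/-! ### The seed -/

variable (b) in
open Classical in
noncomputable def seed : b.tileSet.Placement := fun p => if IsSeedSite p then some .seed else none

theorem seed_bond {d : Dir} (hd : d = .E ∨ d = .W) : b.tileSet.bond Tile.seed d Tile.seed = 2 := by
  have h1 : b.glue .seed d = (.root, 2) := by simp [glue, hd]
  have h2 : b.glue .seed d.opp = (.root, 2) := by
    rcases hd with rfl | rfl <;> simp [glue, Dir.opp]
  rw [bond_eq (by rw [h1, h2]; exact .root) (by rw [h1, h2]), h1]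
  rfl

theorem isSeedSite_iff {p : ℤ × ℤ} : IsSeedSite p ↔ p = (-1, 0) ∨ p = (0, 0) ∨ p = (1, 0) := by
  obtain ⟨x, y⟩ := p
  simp only [IsSeedSite, Prod.mk.injEq]
  omega

theorem seed_ne_none {p : ℤ × ℤ} : b.seed p ≠ none ↔ IsSeedSite p := by
  unfold seed
  split_ifs with h <;> simp [h]

theorem seed_stable : b.seed.Stable := by
  have edge : ∀ (p : ℤ × ℤ) (d : Dir), (d = .E ∨ d = .W) → IsSeedSite p → IsSeedSite (p + d.vec) →
      b.tileSet.edgeStrength b.seed p d = 2 := by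
    intro p d hd h1 h2
    unfold TileSet.edgeStrength TileSet.bondAt seed
    rw [if_pos h1, if_pos h2]
    exact seed_bond hd
  have cut : ∀ (A : Set (ℤ × ℤ)) (p : ℤ × ℤ) (d : Dir), (d = .E ∨ d = .W) → IsSeedSite p → IsSeedSite (p + d.vec) →
      p ∈ A → p + d.vec ∉ A → ∃ F : Finset ((ℤ × ℤ) × Dir),
        (∀ e ∈ F, e.1 ∈ A ∧ e.1 + e.2.vec ∉ A) ∧
          2 ≤ ∑ e ∈ F, b.tileSet.edgeStrength b.seed e.1 e.2 := by
    intro A p d hd h1 h2 h3 h4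
    refine ⟨{(p, d)}, ?_, ?_⟩
    · intro e he
      rw [Finset.mem_singleton] at he
      subst he
      exact ⟨h3, h4⟩
    · rw [Finset.sum_singleton, edge p d hd h1 h2]
  rintro A ⟨p, hpA, hp⟩ ⟨q, hqA, hq⟩
  rw [seed_ne_none, isSeedSite_iff] at hp hq
  -- Any cut of the three seed tiles separates the middle one from a neighbour, and that single bond
  -- has strength 2.
  by_cases h0 : ((0, 0) : ℤ × ℤ) ∈ A
  · rcases hq with rfl | rfl | rfl
    · exact cut A (0, 0) .W (.inr rfl) (by simp [IsSeedSite]) (by simp [IsSeedSite, Dir.vec]) h0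
        (by simpa [Dir.vec] using hqA)
    · exact absurd h0 hqA
    · exact cut A (0, 0) .E (.inl rfl) (by simp [IsSeedSite]) (by simp [IsSeedSite, Dir.vec]) h0
        (by simpa [Dir.vec] using hqA)
  · rcases hp with rfl | rfl | rfl
    · exact cut A (-1, 0) .E (.inl rfl) (by simp [IsSeedSite]) (by simp [IsSeedSite, Dir.vec]) hpA
        (by simpa [Dir.vec] using h0)
    · exact absurd hpA h0
    · exact cut A (1, 0) .W (.inr rfl) (by simp [IsSeedSite]) (by simp [IsSeedSite, Dir.vec]) hpA
        (by simpa [Dir.vec] using h0)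

variable (b) in
noncomputable abbrev tileSystem : TileSystem where
  toTileSet := b.tileSet
  seed := b.seed
  seed_finite := by
    refine Set.Finite.subset (Set.toFinite {(-1, 0), (0, 0), (1, 0)}) fun p hp => ?_
    have := isSeedSite_iff.1 (seed_ne_none.1 hp)
    simpa using this
  seed_nonempty := ⟨(0, 0), seed_ne_none.2 (by simp [IsSeedSite])⟩
  seed_stable := seed_stable

theorem seedAssembly_sound : b.tileSystem.seedAssembly.Sound := by
  refine ⟨?_, fun p hp => by simp [TileSystem.seedAssembly] at hp⟩
  have : b.tileSystem.seedAssembly.correct = b.seed := by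
    funext p
    simp [TileSet.Assembly.correct, TileSystem.seedAssembly]
  unfold TileSet.Assembly.Stable
  rw [this]
  exact seed_stable

namespace St

theorem form_zero (s : ∀ i, b.S i) :
    (⟨s, fun _ => 0, none, none⟩ : b.St).form ∅ = b.tileSystem.seedAssembly := by
  refine TileSet.Assembly.ext' (funext fun p => ?_) rfl
  change full _ ∅ p = b.seed p
  unfold seed
  split_ifs with h
  · exact full_of_asm (asm_seed h)
  · refine full_eq_none.2 ⟨asm_eq_none.2 ?_, by simp⟩
    rintro t (⟨h2, rfl⟩ | ⟨j, w, h2, h3, rfl⟩ | ⟨w, h2, h3, rfl⟩ | ⟨j, n, h2, h3, rfl⟩)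
    · exact h h2
    · cases h2
    · cases h2
    · exact absurd h2 (Nat.not_lt_zero n)

theorem setLen_setLen (x : b.St) (i : Fin 2) (n n' : ℕ) :
    (x.setLen i n).setLen i n' = x.setLen i n' := by
  simp [St.setLen]

/-- A state with an empty track is not valid, so the growth of the initial assembly out of the seed
is shown directly. -/
theorem producesCleanly_setLen (x : b.St) (i : Fin 2) (h0 : x.len i = 0) (n : ℕ)
    (hc : ∀ k, k + 1 < n → b.cont i (x.s i) (x.label i k) (b.cap k))
    (ha : b.m + 3 < n → (b.prop i (x.s i)).isSome → x.ans.isSome) :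
    (x.form ∅).ProducesCleanly ((x.setLen i n).form ∅) := by
  induction n with
  | zero =>
    have : x.setLen i 0 = x := by
      unfold St.setLen
      rw [← h0, Function.update_eq_self]
    rw [this]
    exact ReflTransGen.refl
  | succ n ih =>
    refine ReflTransGen.tail (ih (fun k hk => hc k (by omega)) fun h => ha (by omega)) ?_
    have hlen : (x.setLen i n).len i = n := by simp [St.setLen]
    have := attach_track (x := x.setLen i n) (E := ∅) (i := i) (fun q hq => by simp at hq)
      (fun k hk => hc k (by omega)) (fun h => ha (by omega))
    rwa [hlen, setLen_setLen] at this

end St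

end Blueprint

/-! ### One process and its interface as a deterministic machine -/

namespace DetProc

variable {V : Type u} (P : DetProc.{u, v} V)

/-- The current state, the states before it, and the interface to the object. -/
abbrev Local := P.State × List P.State × Port V

/-- The next event that concerns the process, if the answer of the object is `w`. -/
def move (w : Option V) : P.Local → Option P.Local
  | (c, p, .idle) =>
    match P.next c with
    | .halt => none
    | .step s => some (s, c :: p, .idle)
    | .invoke v _ => some (c, p, .pending v)
  | (c, p, .pending _) => w.map fun w => (c, p, .acked w)
  | (c, p, .acked w) =>
    match P.next c with
    | .invoke _ k => some (k w, c :: p, .idle)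
    | _ => none

/-- The local state after `n` events, the answer of the object being counted as one of them. With `w
= none` the trajectory ends at the invocation, because the answer never comes. -/
def traj (w : Option V) (s : P.State) : ℕ → Option P.Local
  | 0 => some (s, [], .idle)
  | n + 1 => (traj w s n).bind (P.move w)

variable {P}

theorem move_eq {w w' : Option V} {x : P.Local} (h : ∀ v, x.2.2 ≠ .pending v) :
    P.move w x = P.move w' x := by
  obtain ⟨c, p, _ | v | w⟩ := x
  · rfl
  · exact absurd rfl (h v)
  · rfl

theorem move_of_none {w : Option V} {x y : P.Local} (h : P.move none x = some y) :
    P.move w x = some y := by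
  obtain ⟨c, p, _ | v | w⟩ := x
  · exact h
  · cases h
  · exact h

/-- What happens before the answer does not depend on the answer. -/
theorem traj_of_none {w : Option V} {s : P.State} {n : ℕ} {x : P.Local}
    (h : P.traj none s n = some x) : P.traj w s n = some x := by
  induction n generalizing x with
  | zero => exact h
  | succ n ih =>
    obtain ⟨y, hy, hm⟩ := Option.bind_eq_some_iff.1 h
    exact Option.bind_eq_some_iff.2 ⟨y, ih hy, move_of_none hm⟩

theorem traj_eq_none_of_le {w : Option V} {s : P.State} {n n' : ℕ} (hn : n ≤ n')
    (h : P.traj w s n = none) : P.traj w s n' = none := by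
  induction n', hn using Nat.le_induction with
  | base => exact h
  | succ k _ ih => simp [traj, ih]

theorem traj_isSome_of_le {w : Option V} {s : P.State} {n n' : ℕ} (hn : n ≤ n')
    (h : (P.traj w s n').isSome) : (P.traj w s n).isSome := by
  by_contra hc
  have := traj_eq_none_of_le hn (by simpa using hc)
  rw [this] at h
  cases h

/-- Started in `s`, the process invokes the object with the value `v` in its `n`-th event. -/
def Pends (s : P.State) (n : ℕ) (v : V) : Prop :=
  ∃ x : P.Local, P.traj none s n = some x ∧ x.2.2 = .pending v

theorem Pends.traj_succ {s : P.State} {n : ℕ} {v : V} (h : P.Pends s n v) :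
    P.traj none s (n + 1) = none := by
  obtain ⟨⟨c, p, q⟩, hx, rfl⟩ := h
  simp [traj, hx, move]

theorem Pends.le {s : P.State} {n n' : ℕ} {v : V} (h : P.Pends s n v)
    (h' : (P.traj none s n').isSome) : n' ≤ n := by
  by_contra hlt
  rw [traj_eq_none_of_le (show n + 1 ≤ n' by omega) h.traj_succ] at h'
  cases h'

/-- Without an answer the trajectory ends right after an invocation, so it contains at most one. -/
theorem Pends.unique {s : P.State} {n n' : ℕ} {v v' : V} (h : P.Pends s n v)
    (h' : P.Pends s n' v') : n = n' ∧ v = v' := by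
  have h1 : n = n' := by
    obtain ⟨x, hx, -⟩ := id h
    obtain ⟨x', hx', -⟩ := id h'
    exact le_antisymm (h'.le (by simp [hx])) (h.le (by simp [hx']))
  subst h1
  obtain ⟨x, hx, hv⟩ := h
  obtain ⟨x', hx', hv'⟩ := h'
  rw [hx] at hx'
  cases hx'
  rw [hv] at hv'
  cases hv'
  exact ⟨rfl, rfl⟩

variable (P) in
open Classical in
/-- The value with which the process invokes the object if it is started in `s`. -/
noncomputable def proposal (s : P.State) : Option V :=
  if h : ∃ v, ∃ n, P.Pends s n v then some h.choose else none

variable (P) in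
open Classical in
/-- The time of the invocation if the process is started in `s`. -/
noncomputable def time (s : P.State) : ℕ := if h : ∃ n, ∃ v, P.Pends s n v then h.choose else 0

theorem pends_of_proposal {s : P.State} {v : V} (h : P.proposal s = some v) :
    P.Pends s (P.time s) v := by
  unfold proposal at h
  split_ifs at h with h1
  cases h
  obtain ⟨n, hn⟩ := h1.choose_spec
  have h2 : ∃ n, ∃ v, P.Pends s n v := ⟨n, _, hn⟩
  unfold time
  rw [dif_pos h2]
  obtain ⟨v', hv'⟩ := h2.choose_spec
  exact (hn.unique hv').1 ▸ hn

theorem Pends.spec {s : P.State} {n : ℕ} {v : V} (h : P.Pends s n v) :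
    P.proposal s = some v ∧ P.time s = n := by
  have h1 : ∃ v, ∃ n, P.Pends s n v := ⟨v, n, h⟩
  have h2 : P.proposal s = some h1.choose := dif_pos h1
  have := (pends_of_proposal h2).unique h
  exact ⟨h2.trans (congrArg some this.2), this.1⟩

/-- A process that never invokes the object behaves the same whatever the answer would be. -/
theorem traj_none_of_proposal {s : P.State} (h : P.proposal s = none) {w : Option V} {n : ℕ}
    {x : P.Local} (hx : P.traj w s n = some x) : P.traj none s n = some x := by
  induction n generalizing x with
  | zero => exact hx
  | succ n ih =>
    obtain ⟨y, hy, hm⟩ := Option.bind_eq_some_iff.1 hx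
    refine Option.bind_eq_some_iff.2 ⟨y, ih hy, ?_⟩
    rw [← hm]
    refine move_eq fun v hv => ?_
    have : P.Pends s n v := ⟨y, ih hy, hv⟩
    rw [this.spec.1] at h
    cases h

/-- The number of events so far, apart from the answer of the object. -/
def Local.count (x : P.Local) : ℕ :=
  x.2.1.length + match x.2.2 with
    | .pending _ => 1
    | _ => 0

/-- The initial state. -/
def Local.ini (x : P.Local) : P.State := x.2.1.getLast?.getD x.1

theorem move_count {w : Option V} {x y : P.Local} (h : P.move w x = some y)
    (hx : ∀ v, x.2.2 ≠ .pending v) : Local.count y = Local.count x + 1 := by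
  obtain ⟨c, p, _ | v | w⟩ := x
  · simp only [move] at h
    split at h <;> cases h <;> simp [Local.count]
  · exact absurd rfl (hx v)
  · simp only [move] at h
    split at h <;> cases h
    simp [Local.count]

/-- The recorded history retains the initial state as its last entry; this is how a configuration
knows the input. -/
theorem move_ini {w : Option V} {x y : P.Local} (h : P.move w x = some y) :
    Local.ini y = Local.ini x := by
  have hc : ∀ (c s : P.State) (p : List P.State),
      (c :: p).getLast?.getD s = p.getLast?.getD c := by
    intro c s p
    rw [List.getLast?_cons]
    rfl
  obtain ⟨c, p, _ | v | w'⟩ := x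
  · simp only [move] at h
    split at h <;> cases h <;> simp [Local.ini, hc]
  · simp only [move, Option.map_eq_some_iff] at h
    obtain ⟨w, -, rfl⟩ := h
    rfl
  · simp only [move] at h
    split at h <;> cases h
    simp [Local.ini, hc]

end DetProc

/-! ### Executions -/

namespace DistSystem

variable {V : Type u} {M : DistSystem.{u, v} V}

namespace Config

def loc (C : M.Config) (i : Fin 2) : (M.proc i).Local :=
  ((C.proc i).cur, (C.proc i).past, C.obj.port i)

theorem ext' {C C' : M.Config} (h1 : ∀ i, C.loc i = C'.loc i)
    (h2 : ∀ i, (C.proc i).crashed = (C'.proc i).crashed) (h3 : C.obj.log = C'.obj.log) :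
    C = C' := by
  obtain ⟨p, ⟨q, l⟩⟩ := C
  obtain ⟨p', ⟨q', l'⟩⟩ := C'
  simp only [loc, Prod.mk.injEq] at h1 h2 h3
  obtain rfl : p = p' := by
    funext i
    have h4 := h1 i
    have h5 := h2 i
    cases hp : p i
    cases hp' : p' i
    simp_all
  obtain rfl : q = q' := funext fun i => (h1 i).2.2
  rw [h3]

/-- The value that has been decided. -/
def decided (C : M.Config) : Option V := C.obj.log.head?.map Prod.snd

/-- The object has answered process `i`. -/
def Answered (C : M.Config) (i : Fin 2) : Prop := ∃ w, (i, w) ∈ C.obj.log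

open Classical in
/-- The number of events so far that concern process `i`. -/
noncomputable def count (C : M.Config) (i : Fin 2) : ℕ :=
  -- One of the two is the answer. The other is the invocation, which `Local.count` counts only
  -- while it is pending: afterwards the next entry of the history stands for the receipt.
  DetProc.Local.count (C.loc i) + if C.Answered i then 2 else 0

def ini (C : M.Config) (i : Fin 2) : (M.proc i).State := DetProc.Local.ini (C.loc i)

end Config

/-! ### The effect of the events on local states -/

theorem step_comp {C C' : M.Config} {i : Fin 2} (h : Step C (.comp i) C') :
    (C.proc i).crashed = false ∧ (∀ v, C.obj.port i ≠ .pending v) ∧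
      (M.proc i).move none (C.loc i) = some (C'.loc i) ∧ (∀ j, j ≠ i → C'.loc j = C.loc j) ∧
      C'.obj.log = C.obj.log ∧ ∀ j, (C'.proc j).crashed = (C.proc j).crashed := by
  cases h with
  | internal alive port act =>
    refine ⟨alive, by simp [port], ?_, ?_, rfl, ?_⟩
    · rw [Config.action] at act
      simp [Config.loc, DetProc.move, port, act, Config.advance]
    · intro j hj
      simp [Config.loc, Config.advance, hj]
    · intro j
      by_cases hj : j = i
      · subst hj; simp [Config.advance]
      · simp [Config.advance, hj]
  | invoke alive port act =>
    refine ⟨alive, by simp [port], ?_, ?_, rfl, fun _ => rfl⟩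
    · rw [Config.action] at act
      simp [Config.loc, DetProc.move, port, act, Config.setPort]
    · intro j hj
      simp [Config.loc, Config.setPort, hj]
  | receive alive port act =>
    refine ⟨alive, by simp [port], ?_, ?_, rfl, ?_⟩
    · rw [Config.action] at act
      simp [Config.loc, DetProc.move, port, act, Config.advance, Config.setPort]
    · intro j hj
      simp [Config.loc, Config.advance, Config.setPort, hj]
    · intro j
      by_cases hj : j = i
      · subst hj; simp [Config.advance, Config.setPort]
      · simp [Config.advance, Config.setPort, hj]

theorem step_respond {C C' : M.Config} {i : Fin 2} (h : Step C (.respond i) C') :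
    ∃ v, C.obj.port i = .pending v ∧
      C'.loc i = ((C.proc i).cur, (C.proc i).past, .acked (C.obj.answer v)) ∧
      (∀ j, j ≠ i → C'.loc j = C.loc j) ∧
      C'.obj.log = C.obj.log ++ [(i, C.obj.answer v)] ∧
      ∀ j, (C'.proc j).crashed = (C.proc j).crashed := by
  cases h with
  | @respond _ v port =>
    refine ⟨v, port, ?_, ?_, rfl, fun _ => rfl⟩
    · simp [Config.loc, Config.setPort, Config.addLog]
    · intro j hj
      simp [Config.loc, Config.setPort, Config.addLog, hj]

theorem step_crash {C C' : M.Config} {i : Fin 2} (h : Step C (.crash i) C') :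
    (∀ j, (C.proc j).crashed = false) ∧ (∀ j, C'.loc j = C.loc j) ∧
      C'.obj.log = C.obj.log ∧ ∀ j, (C'.proc j).crashed = true ↔ j = i := by
  cases h with
  | crash alive =>
    refine ⟨alive, ?_, rfl, ?_⟩
    · intro j
      by_cases hj : j = i
      · subst hj; simp [Config.loc, Config.setCrashed]
      · simp [Config.loc, Config.setCrashed, hj]
    · intro j
      by_cases hj : j = i
      · subst hj; simp [Config.setCrashed]
      · simp [Config.setCrashed, hj, alive j]

theorem exists_step_comp {C : M.Config} {i : Fin 2} (ha : (C.proc i).crashed = false)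
    (hp : ∀ v, C.obj.port i ≠ .pending v) (hm : ((M.proc i).move none (C.loc i)).isSome) :
    ∃ C', Step C (.comp i) C' := by
  cases hport : C.obj.port i with
  | pending v => exact absurd hport (hp v)
  | idle =>
    cases hact : C.action i with
    | halt =>
      have : (M.proc i).next (C.proc i).cur = .halt := hact
      simp [Config.loc, DetProc.move, hport, this] at hm
    | step s => exact ⟨_, .internal ha hport hact⟩
    | invoke v k => exact ⟨_, .invoke ha hport hact⟩
  | acked w =>
    cases hact : C.action i with
    | halt =>
      have : (M.proc i).next (C.proc i).cur = .halt := hact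
      simp [Config.loc, DetProc.move, hport, this] at hm
    | step s =>
      have : (M.proc i).next (C.proc i).cur = .step s := hact
      simp [Config.loc, DetProc.move, hport, this] at hm
    | invoke v k => exact ⟨_, .receive ha hport hact⟩

/-- What holds in all configurations that occur in executions. -/
structure Inv (C : M.Config) : Prop where
  ini : ∀ i, C.ini i ∈ (M.proc i).init
  traj : ∀ i, (M.proc i).traj C.decided (C.ini i) (C.count i) = some (C.loc i)
  pre : ∀ i, ¬ C.Answered i → (M.proc i).traj none (C.ini i) (C.count i) = some (C.loc i)
  pending : ∀ i v, C.obj.port i = .pending v → ¬ C.Answered i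
  acked : ∀ i w, C.obj.port i = .acked w → C.Answered i
  log : C.obj.log = [] ∨ (∃ i v, C.obj.log = [(i, v)]) ∨
    ∃ i j v, i ≠ j ∧ C.obj.log = [(i, v), (j, v)]
  answered : ∀ i, C.Answered i → ∃ v, (M.proc i).proposal (C.ini i) = some v ∧
    (M.proc i).time (C.ini i) + 1 ≤ C.count i
  first : ∀ i v, C.obj.log.head? = some (i, v) → (M.proc i).proposal (C.ini i) = some v
  alive : ∃ i, (C.proc i).crashed = false

/-! ### The invariant of executions -/

theorem IsInitial.inv {C : M.Config} (h : M.IsInitial C) : Inv C := by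
  have hA : ∀ i, ¬ C.Answered i := by
    rintro i ⟨w, hw⟩
    rw [h.log] at hw
    cases hw
  have hloc : ∀ i, C.loc i = ((C.proc i).cur, [], .idle) := by
    intro i
    simp [Config.loc, h.past, h.port]
  have hini : ∀ i, C.ini i = (C.proc i).cur := by
    intro i
    rw [Config.ini, hloc]
    rfl
  have hcount : ∀ i, C.count i = 0 := by
    intro i
    rw [Config.count, hloc, if_neg (hA i)]
    rfl
  have htraj : ∀ i w, (M.proc i).traj w (C.ini i) (C.count i) = some (C.loc i) := by
    intro i w
    rw [hcount, hini, hloc]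
    rfl
  refine ⟨fun i => hini i ▸ h.cur i, fun i => htraj i _, fun i _ => htraj i _, ?_, ?_, .inl h.log,
    fun i hi => absurd hi (hA i), ?_, ⟨0, h.alive 0⟩⟩
  · intro i v hi; rw [h.port i] at hi; cases hi
  · intro i v hi; rw [h.port i] at hi; cases hi
  · intro i v hi; rw [h.log] at hi; cases hi

theorem count_of_loc {C C' : M.Config} {i : Fin 2} (h : C'.loc i = C.loc i)
    (h' : C'.Answered i ↔ C.Answered i) : C'.count i = C.count i := by
  unfold Config.count
  rw [h]
  by_cases hA : C.Answered i
  · rw [if_pos hA, if_pos (h'.2 hA)]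
  · rw [if_neg hA, if_neg (mt h'.1 hA)]

theorem answered_append {C C' : M.Config} {i : Fin 2} {w : V}
    (h : C'.obj.log = C.obj.log ++ [(i, w)]) (j : Fin 2) : C'.Answered j ↔ C.Answered j ∨ j = i := by
  unfold Config.Answered
  rw [h]
  constructor
  · rintro ⟨w', hw'⟩
    rcases List.mem_append.1 hw' with h1 | h1
    · exact .inl ⟨w', h1⟩
    · rw [List.mem_singleton] at h1
      cases h1
      exact .inr rfl
  · rintro (⟨w', hw'⟩ | rfl)
    · exact ⟨w', List.mem_append_left _ hw'⟩
    · exact ⟨w, List.mem_append_right _ (List.mem_singleton.2 rfl)⟩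

/-- If the object has no answer to give, this is what it answers. -/
theorem answer_eq {C : M.Config} (v : V) : C.obj.answer v = C.decided.getD v := by
  unfold ObjState.answer Config.decided
  cases C.obj.log.head? <;> rfl

theorem comp_count {C C' : M.Config} {i : Fin 2} (h : Step C (.comp i) C') :
    C'.count i = C.count i + 1 := by
  obtain ⟨-, hp, hm, -, hlog, -⟩ := step_comp h
  have hA : C'.Answered i ↔ C.Answered i := by simp only [Config.Answered, hlog]
  have := DetProc.move_count hm hp
  unfold Config.count
  rw [this]
  by_cases hAi : C.Answered i
  · rw [if_pos hAi, if_pos (hA.2 hAi)]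
  · rw [if_neg hAi, if_neg (mt hA.1 hAi)]

theorem comp_ini {C C' : M.Config} {i : Fin 2} (h : Step C (.comp i) C') (j : Fin 2) :
    C'.ini j = C.ini j := by
  obtain ⟨-, -, hm, hj, -⟩ := step_comp h
  by_cases hji : j = i
  · subst hji; exact DetProc.move_ini hm
  · rw [Config.ini, hj j hji]; rfl

theorem respond_ini {C C' : M.Config} {i : Fin 2} (h : Step C (.respond i) C') (j : Fin 2) :
    C'.ini j = C.ini j := by
  obtain ⟨v, -, hl, hj, -⟩ := step_respond h
  by_cases hji : j = i
  · subst hji; rw [Config.ini, hl]; rfl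
  · rw [Config.ini, hj j hji]; rfl

theorem respond_count {C C' : M.Config} {i : Fin 2} (hC : Inv C) (h : Step C (.respond i) C') :
    C'.count i = C.count i + 1 := by
  obtain ⟨v, hp, hl, hj, hlog, -⟩ := step_respond h
  have hA := hC.pending i v hp
  have hA' : C'.Answered i := (answered_append hlog i).2 (.inr rfl)
  unfold Config.count
  rw [if_neg hA, if_pos hA', hl]
  simp [DetProc.Local.count, Config.loc, hp]

theorem count_of_ne {C C' : M.Config} {i j : Fin 2} {e : Event} (hij : j ≠ i)
    (he : e = .comp i ∨ e = .respond i) (h : Step C e C') : C'.count j = C.count j := by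
  rcases he with rfl | rfl
  · obtain ⟨-, -, -, hl, hlog, -⟩ := step_comp h
    exact count_of_loc (hl j hij) (by simp only [Config.Answered, hlog])
  · obtain ⟨v, -, -, hl, hlog, -⟩ := step_respond h
    exact count_of_loc (hl j hij) (by rw [answered_append hlog]; simp [hij])

theorem decided_of_respond {C C' : M.Config} {i : Fin 2} {v : V}
    (h : C'.obj.log = C.obj.log ++ [(i, C.obj.answer v)]) :
    C'.decided = some (C.obj.answer v) := by
  unfold Config.decided ObjState.answer
  unfold ObjState.answer at h
  rw [h]
  cases C.obj.log <;> simp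

/-- That nobody invokes the object a second time is needed only for the event of invocation: a
pending process has not been answered before. -/
theorem Inv.step {C C' : M.Config} {e : Event} (hC : Inv C)
    (hM : ∀ i, M.AboutToInvoke C i → ¬ C.Answered i) (h : Step C e C') : Inv C' := by
  rcases e with i | i | i
  · obtain ⟨ha, hp, hm, hl, hlog, hcr⟩ := step_comp h
    have hA : ∀ j, C'.Answered j ↔ C.Answered j := fun j => by simp only [Config.Answered, hlog]
    have hd : C'.decided = C.decided := by unfold Config.decided; rw [hlog]
    have hini := comp_ini h
    have hcount := comp_count h
    have hcount' : ∀ j, j ≠ i → C'.count j = C.count j := fun j hj => count_of_ne hj (.inl rfl) h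
    refine ⟨?_, ?_, ?_, ?_, ?_, hlog ▸ hC.log, ?_, ?_, ?_⟩
    · intro j; rw [hini]; exact hC.ini j
    · intro j
      rw [hini, hd]
      by_cases hj : j = i
      · subst hj
        rw [hcount, DetProc.traj, hC.traj j]
        exact DetProc.move_of_none hm
      · rw [hcount' j hj, hl j hj]; exact hC.traj j
    · intro j hjA
      rw [hA] at hjA
      rw [hini]
      by_cases hj : j = i
      · subst hj
        rw [hcount, DetProc.traj, hC.pre j hjA]
        exact hm
      · rw [hcount' j hj, hl j hj]; exact hC.pre j hjA
    · intro j v hv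
      rw [hA]
      by_cases hj : j = i
      · subst hj
        cases h with
        | internal alive port act =>
          change C.obj.port j = _ at hv
          exact absurd hv (hp v)
        | @invoke _ v' k alive port act => exact hM j ⟨alive, port, v', k, act⟩
        | receive alive port act =>
          simp [Config.setPort] at hv
      · exact hC.pending j v ((congrArg (·.2.2) (hl j hj)).symm.trans hv)
    · intro j w hw
      rw [hA]
      by_cases hj : j = i
      · subst hj
        cases h with
        | internal alive port act =>
          change C.obj.port j = _ at hw
          exact hC.acked j w hw
        | invoke alive port act => simp [Config.setPort] at hw
        | receive alive port act => simp [Config.setPort] at hw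
      · exact hC.acked j w ((congrArg (·.2.2) (hl j hj)).symm.trans hw)
    · intro j hjA
      rw [hini]
      obtain ⟨v, hv, ht⟩ := hC.answered j ((hA j).1 hjA)
      refine ⟨v, hv, ht.trans ?_⟩
      by_cases hj : j = i
      · subst hj; omega
      · rw [hcount' j hj]
    · intro j v hv
      rw [hlog] at hv
      rw [hini]
      exact hC.first j v hv
    · obtain ⟨j, hj⟩ := hC.alive
      exact ⟨j, (hcr j).trans hj⟩
  · obtain ⟨v, hp, hli, hl, hlog, hcr⟩ := step_respond h
    have hA := answered_append hlog
    have hiA := hC.pending i v hp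
    have hd := decided_of_respond hlog
    have hini := respond_ini h
    have hcount := respond_count hC h
    have hcount' : ∀ j, j ≠ i → C'.count j = C.count j := fun j hj => count_of_ne hj (.inr rfl) h
    -- Before its answer a process follows the trajectory with `w = none`; this identifies the
    -- pending invocation with its unique proposal and time.
    have hpend : (M.proc i).Pends (C.ini i) (C.count i) v := ⟨_, hC.pre i hiA, hp⟩
    refine ⟨?_, ?_, ?_, ?_, ?_, ?_, ?_, ?_, ?_⟩
    · intro j; rw [hini]; exact hC.ini j
    · intro j
      rw [hini, hd]
      by_cases hj : j = i
      · subst hj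
        rw [hcount, DetProc.traj, DetProc.traj_of_none (hC.pre j hiA), hli]
        simp [DetProc.move, Config.loc, hp]
      · rw [hcount' j hj, hl j hj]
        have h1 := hC.traj j
        -- For the other process nothing changes: either the decision stays the same, or there was
        -- none so far and its trajectory does not depend on one.
        have h2 := answer_eq (C := C) v
        cases hd' : C.decided with
        | none => rw [hd'] at h1; exact DetProc.traj_of_none h1
        | some w =>
          rw [hd'] at h1 h2
          rw [h2]
          exact h1
    · intro j hjA
      rw [hA] at hjA
      push Not at hjA
      rw [hini, hcount' j hjA.2, hl j hjA.2]
      exact hC.pre j hjA.1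
    · intro j w hw
      rw [hA]
      by_cases hj : j = i
      · subst hj
        have : C'.obj.port j = .acked (C.obj.answer v) := congrArg (·.2.2) hli
        rw [this] at hw
        cases hw
      · have := hC.pending j w ((congrArg (·.2.2) (hl j hj)).symm.trans hw)
        tauto
    · intro j w hw
      rw [hA]
      by_cases hj : j = i
      · exact .inr hj
      · exact .inl (hC.acked j w ((congrArg (·.2.2) (hl j hj)).symm.trans hw))
    · rw [hlog]
      rcases hC.log with h0 | ⟨j, w, h0⟩ | ⟨j, k, w, hjk, h0⟩
      · right; left
        exact ⟨i, C.obj.answer v, by rw [h0]; rfl⟩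
      · right; right
        have hji : j ≠ i := by
          rintro rfl
          exact hiA ⟨w, by rw [h0]; simp⟩
        refine ⟨j, i, w, hji, ?_⟩
        rw [h0]
        simp [ObjState.answer, h0]
      · exfalso
        have h1 : i ≠ j := by
          rintro rfl
          exact hiA ⟨w, by rw [h0]; simp⟩
        have h2 : i ≠ k := by
          rintro rfl
          exact hiA ⟨w, by rw [h0]; simp⟩
        omega
    · intro j hjA
      rw [hini]
      by_cases hj : j = i
      · subst hj
        exact ⟨v, hpend.spec.1, by rw [hcount, hpend.spec.2]⟩
      · rw [hcount' j hj]
        rw [hA] at hjA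
        exact hC.answered j (by tauto)
    · intro j w hw
      rw [hini]
      cases hlog0 : C.obj.log with
      | nil =>
        rw [hlog, hlog0] at hw
        simp only [List.nil_append, List.head?_cons, Option.some.injEq, Prod.mk.injEq] at hw
        obtain ⟨rfl, rfl⟩ := hw
        rw [hpend.spec.1]
        simp [ObjState.answer, hlog0]
      | cons a l =>
        rw [hlog, hlog0] at hw
        exact hC.first j w (by rw [hlog0]; simpa using hw)
    · obtain ⟨j, hj⟩ := hC.alive
      exact ⟨j, (hcr j).trans hj⟩
  · obtain ⟨ha, hl, hlog, hcr⟩ := step_crash h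
    have hA : ∀ j, C'.Answered j ↔ C.Answered j := fun j => by simp only [Config.Answered, hlog]
    have hd : C'.decided = C.decided := by unfold Config.decided; rw [hlog]
    have hini : ∀ j, C'.ini j = C.ini j := fun j => by unfold Config.ini; rw [hl]
    have hcount : ∀ j, C'.count j = C.count j := fun j => count_of_loc (hl j) (hA j)
    have hport : ∀ j, C'.obj.port j = C.obj.port j := fun j => congrArg (·.2.2) (hl j)
    refine ⟨?_, ?_, ?_, ?_, ?_, hlog ▸ hC.log, ?_, ?_, ?_⟩
    · intro j; rw [hini]; exact hC.ini j
    · intro j; rw [hini, hd, hcount, hl]; exact hC.traj j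
    · intro j hj; rw [hini, hcount, hl]; exact hC.pre j (mt (hA j).2 hj)
    · intro j v hv; rw [hA]; exact hC.pending j v (hport j ▸ hv)
    · intro j v hv; rw [hA]; exact hC.acked j v (hport j ▸ hv)
    · intro j hj; rw [hini, hcount]; exact hC.answered j ((hA j).1 hj)
    · intro j v hv; rw [hini]; exact hC.first j v (hlog ▸ hv)
    · by_contra hc
      push Not at hc
      have h0 := (hcr 0).1 (by simpa using hc 0)
      have h1 := (hcr 1).1 (by simpa using hc 1)
      omega

theorem Reachable.tail {C C' : M.Config} {e : Event} (h : M.Reachable C) (hs : Step C e C') :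
    M.Reachable C' := by
  obtain ⟨C₀, h0, h1⟩ := h
  exact ⟨C₀, h0, ReflTransGen.tail h1 ⟨e, hs⟩⟩

theorem Reachable.trans {C C' : M.Config} (h : M.Reachable C) (hs : M.Reaches C C') :
    M.Reachable C' := by
  obtain ⟨C₀, h0, h1⟩ := h
  exact ⟨C₀, h0, ReflTransGen.trans h1 hs⟩

/-- A process that has invoked the object had been about to do so. -/
theorem Reachable.exists_invocation {C : M.Config} (h : M.Reachable C) (i : Fin 2)
    (hi : C.Answered i ∨ C.obj.port i ≠ .idle) :
    ∃ A B, M.Reachable A ∧ M.AboutToInvoke A i ∧ Step A (.comp i) B ∧ M.Reaches B C := by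
  obtain ⟨C₀, h0, hr⟩ := h
  induction hr with
  | refl =>
    exfalso
    rcases hi with ⟨w, hw⟩ | hi
    · rw [h0.log] at hw; cases hw
    · exact hi (h0.port i)
  | @tail D D' hD hs ih =>
    by_cases hDi : D.Answered i ∨ D.obj.port i ≠ .idle
    · obtain ⟨A, B, h1, h2, h3, h4⟩ := ih hDi
      exact ⟨A, B, h1, h2, h3, ReflTransGen.tail h4 hs⟩
    · push Not at hDi
      obtain ⟨e, hs⟩ := hs
      rcases e with j | j | j
      · obtain ⟨ha, hp, hm, hl, hlog, -⟩ := step_comp hs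
        have hi' : D'.obj.port i ≠ .idle := by
          rcases hi with ⟨w, hw⟩ | hi
          · exact absurd ⟨w, hlog ▸ hw⟩ hDi.1
          · exact hi
        by_cases hij : i = j
        · subst hij
          refine ⟨D, D', ⟨C₀, h0, hD⟩, ?_, hs, ReflTransGen.refl⟩
          cases hs with
          | internal alive port act => exact absurd port hi'
          | @invoke _ v k alive port act => exact ⟨alive, port, v, k, act⟩
          | receive alive port act => rw [port] at hDi; exact absurd hDi.2 (by simp)
        · exact absurd ((congrArg (·.2.2) (hl i hij)).trans hDi.2) hi'
      · obtain ⟨v, hp, hli, hl, hlog, -⟩ := step_respond hs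
        have hij : i ≠ j := by
          rintro rfl
          rw [hp] at hDi
          exact absurd hDi.2 (by simp)
        exfalso
        rcases hi with hi | hi
        · rw [answered_append hlog] at hi
          tauto
        · exact hi ((congrArg (·.2.2) (hl i hij)).trans hDi.2)
      · obtain ⟨-, hl, hlog, -⟩ := step_crash hs
        exfalso
        rcases hi with ⟨w, hw⟩ | hi
        · exact hDi.1 ⟨w, hlog ▸ hw⟩
        · exact hi ((congrArg (·.2.2) (hl i)).trans hDi.2)

/-- An answer stems from an earlier invocation, so another invocation would be the second. -/
theorem InvokesAtMostOnce.not_answered (hM : M.InvokesAtMostOnce) {C : M.Config}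
    (h : M.Reachable C) (i : Fin 2) (hi : M.AboutToInvoke C i) : ¬ C.Answered i := by
  intro hA
  obtain ⟨A, B, h1, h2, h3, h4⟩ := h.exists_invocation i (.inl hA)
  exact hM i A B C h1 h2 h3 h4 hi

theorem InvokesAtMostOnce.inv (hM : M.InvokesAtMostOnce) {C : M.Config} (h : M.Reachable C) :
    Inv C := by
  obtain ⟨C₀, h0, hr⟩ := h
  induction hr with
  | refl => exact h0.inv
  | @tail D D' hD hs ih =>
    obtain ⟨e, hs⟩ := hs
    exact ih.step (fun i => hM.not_answered ⟨C₀, h0, hD⟩ i) hs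

end DistSystem

namespace DistSystem

variable {V : Type u} (M : DistSystem.{u, v} V)

instance (i : Fin 2) : Finite (M.proc i).init := (M.proc i).init_finite.to_subtype

/-! ### The tile system of a distributed system -/

theorem exists_time_bound :
    ∃ m, 1 ≤ m ∧ ∀ i, ∀ s ∈ (M.proc i).init, (M.proc i).time s ≤ m := by
  obtain ⟨m, hm⟩ := (Set.finite_range fun x : Σ i, (M.proc i).init =>
    (M.proc x.1).time x.2).bddAbove
  -- The added 1 makes the bound positive: otherwise tile `m` would be the first tile of the track,
  -- and its incoming side would coincide with its outgoing one.
  exact ⟨m + 1, by omega, fun i s hs => (hm ⟨⟨i, s, hs⟩, rfl⟩).trans (by omega)⟩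

/-- There are finitely many triples of a process, an input and an answer; the bound is the largest
of the termination times chosen for those that terminate. -/
theorem exists_horizon [Finite V] :
    ∃ n, ∀ i, ∀ s ∈ (M.proc i).init, ∀ w, (∃ k, (M.proc i).traj w s k = none) →
      (M.proc i).traj w s n = none := by
  classical
  let f : (Σ i, (M.proc i).init × Option V) → ℕ := fun x =>
    if h : ∃ k, (M.proc x.1).traj x.2.2 x.2.1 k = none then h.choose else 0
  obtain ⟨n, hn⟩ := (Set.finite_range f).bddAbove
  refine ⟨n, fun i s hs w h => ?_⟩
  refine DetProc.traj_eq_none_of_le (hn ⟨⟨i, ⟨s, hs⟩, w⟩, rfl⟩) ?_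
  have : f ⟨i, ⟨s, hs⟩, w⟩ = h.choose := dif_pos h
  rw [this]
  exact h.choose_spec

/-- A bound for the times of the invocations. -/
noncomputable def bound : ℕ := M.exists_time_bound.choose

/-- Processes that have not halted by then never halt. -/
noncomputable def horizon [Finite V] : ℕ := M.exists_horizon.choose

theorem one_le_bound : 1 ≤ M.bound := M.exists_time_bound.choose_spec.1

theorem time_le_bound {i : Fin 2} {s : (M.proc i).State} (hs : s ∈ (M.proc i).init) :
    (M.proc i).time s ≤ M.bound := M.exists_time_bound.choose_spec.2 i s hs

theorem traj_isSome_of_horizon [Finite V] {i : Fin 2} {s : (M.proc i).State} (hs : s ∈ (M.proc i).init)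
    {w : Option V} {n : ℕ} (hn : M.horizon ≤ n) (h : ((M.proc i).traj w s n).isSome) (k : ℕ) :
    ((M.proc i).traj w s k).isSome := by
  by_contra hc
  have h0 := M.exists_horizon.choose_spec i s hs w ⟨k, by simpa using hc⟩
  rw [DetProc.traj_eq_none_of_le hn h0] at h
  cases h

/-- The index of the first tile of the track that stands for an event; the tiles before it make
the invocation happen at a fixed site. -/
noncomputable def off (i : Fin 2) (s : (M.proc i).State) : ℕ :=
  -- The tile that stands for the state after `n` events has index `off + n`, so an invocation gets
  -- the index `m + 2`. A process that never invokes starts at `m + 4`, just beyond the answer site.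
  if ((M.proc i).proposal s).isSome then M.bound + 2 - (M.proc i).time s else M.bound + 4

/-- Tiles and glues live in the lowest universe, so inputs and values enter them through copies of
these finite types. -/
noncomputable def decode (i : Fin 2) (s : Shrink.{0} (M.proc i).init) : (M.proc i).State :=
  ((equivShrink.{0} (M.proc i).init).symm s).1

open Classical in
noncomputable def encode (i : Fin 2) (s : (M.proc i).State) : Shrink.{0} (M.proc i).init :=
  equivShrink.{0} _ (if h : s ∈ (M.proc i).init then ⟨s, h⟩ else
    ⟨(M.proc i).init_nonempty.some, (M.proc i).init_nonempty.some_mem⟩)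

variable {M} in
theorem decode_encode {i : Fin 2} {s : (M.proc i).State} (h : s ∈ (M.proc i).init) :
    M.decode i (M.encode i s) = s := by
  simp [decode, encode, h]

variable [Finite V]

/-- A track goes on in four cases: at the repeating tile, which is reached only by processes that
never halt; in the padding; behind the pending tile, where the trajectory without an answer would
stop; and where the trajectory has a further state. The next tile represents `c + 1 - off` events.
-/
noncomputable def blueprint : Blueprint where
  V := Shrink.{0} V
  S i := Shrink.{0} (M.proc i).init
  finite_V := inferInstance
  finite_S _ := inferInstance
  m := M.bound
  K := M.bound + 5 + M.horizon
  one_le_m := M.one_le_bound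
  le_K := by omega
  prop i s := ((M.proc i).proposal (M.decode i s)).map (equivShrink.{0} V)
  cont i s w c := c = M.bound + 5 + M.horizon ∨ c < M.off i (M.decode i s) ∨
    (c = M.bound + 2 ∧ ((M.proc i).proposal (M.decode i s)).isSome) ∨
    ((M.proc i).traj (w.map (equivShrink.{0} V).symm) (M.decode i s)
      (c + 1 - M.off i (M.decode i s))).isSome

variable {M}

/-- The state of the tracks that represents a configuration. -/
noncomputable def Config.state (C : M.Config) : M.blueprint.St where
  s i := M.encode i (C.ini i)
  len i := M.off i (C.ini i) + C.count i + 1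
  dec := C.obj.log.head?.map fun e => (e.1, equivShrink.{0} V e.2)
  ans := C.decided.map (equivShrink.{0} V)

/-- The blockages that represent the crashes. -/
noncomputable def Config.blockages (C : M.Config) : Finset (ℤ × ℤ) :=
  (Finset.univ.filter fun i => (C.proc i).crashed = true).image C.state.blk

/-- The tile configuration that represents a configuration. -/
noncomputable def Config.tiles (C : M.Config) : M.blueprint.tileSystem.Assembly :=
  C.state.form C.blockages

theorem mem_blockages {C : M.Config} {p : ℤ × ℤ} :
    p ∈ C.blockages ↔ ∃ i, (C.proc i).crashed = true ∧ C.state.blk i = p := by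
  simp [Config.blockages]

/-! ### Reading the history off the tracks -/

theorem Inv.decode_s {C : M.Config} (hC : Inv C) (i : Fin 2) :
    M.decode i (C.state.s i) = C.ini i := decode_encode (hC.ini i)

theorem Inv.prop {C : M.Config} (hC : Inv C) (i : Fin 2) :
    M.blueprint.prop i (C.state.s i) = ((M.proc i).proposal (C.ini i)).map (equivShrink.{0} V) := by
  change ((M.proc i).proposal (M.decode i (C.state.s i))).map (equivShrink.{0} V) = _
  rw [hC.decode_s]

theorem Inv.prop_isSome {C : M.Config} (hC : Inv C) (i : Fin 2) :
    (M.blueprint.prop i (C.state.s i)).isSome ↔ ((M.proc i).proposal (C.ini i)).isSome := by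
  rw [hC.prop]
  cases (M.proc i).proposal (C.ini i) <;> rfl

theorem Inv.len_of_some {C : M.Config} (hC : Inv C) {i : Fin 2} {v : V}
    (h : (M.proc i).proposal (C.ini i) = some v) :
    C.state.len i + (M.proc i).time (C.ini i) = M.bound + 3 + C.count i := by
  have := M.time_le_bound (hC.ini i)
  change M.off i (C.ini i) + C.count i + 1 + _ = _
  unfold off
  rw [if_pos (by rw [h]; rfl)]
  omega

theorem Inv.len_of_none {C : M.Config} {i : Fin 2}
    (h : (M.proc i).proposal (C.ini i) = none) :
    C.state.len i = M.bound + 5 + C.count i := by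
  change M.off i (C.ini i) + C.count i + 1 = _
  unfold off
  rw [if_neg (by rw [h]; simp)]
  omega

/-- The padding puts the answer at index `m + 3` for every input. A process without its answer
cannot pass the time of its invocation, so its track ends before that site. -/
theorem Inv.answered_iff {C : M.Config} (hC : Inv C) (i : Fin 2) :
    C.Answered i ↔ (M.blueprint.prop i (C.state.s i)).isSome ∧ M.bound + 4 ≤ C.state.len i := by
  rw [hC.prop_isSome]
  constructor
  · intro h
    obtain ⟨v, hv, ht⟩ := hC.answered i h
    have := hC.len_of_some hv
    exact ⟨by rw [hv]; rfl, by omega⟩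
  · rintro ⟨h1, h2⟩
    obtain ⟨v, hv⟩ := Option.isSome_iff_exists.1 h1
    by_contra hA
    have h3 := (DetProc.pends_of_proposal hv).le (by rw [hC.pre i hA]; rfl)
    have := hC.len_of_some hv
    omega

theorem Inv.pending_iff {C : M.Config} (hC : Inv C) (i : Fin 2) :
    (∃ v, C.obj.port i = .pending v) ↔
      (M.blueprint.prop i (C.state.s i)).isSome ∧ C.state.len i = M.bound + 3 := by
  rw [hC.prop_isSome]
  constructor
  · rintro ⟨v, hv⟩
    have h : (M.proc i).Pends (C.ini i) (C.count i) v :=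
      ⟨_, hC.pre i (hC.pending i v hv), hv⟩
    have := hC.len_of_some h.spec.1
    have := h.spec.2
    exact ⟨by rw [h.spec.1]; rfl, by omega⟩
  · rintro ⟨h1, h2⟩
    obtain ⟨v, hv⟩ := Option.isSome_iff_exists.1 h1
    have hA : ¬ C.Answered i := by
      rw [hC.answered_iff]; omega
    have := hC.len_of_some hv
    obtain ⟨x, hx, hp⟩ := DetProc.pends_of_proposal hv
    rw [show (M.proc i).time (C.ini i) = C.count i by omega, hC.pre i hA] at hx
    cases hx
    exact ⟨v, hp⟩

theorem Inv.prop_of_pending {C : M.Config} (hC : Inv C) {i : Fin 2} {v : V}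
    (h : C.obj.port i = .pending v) :
    M.blueprint.prop i (C.state.s i) = some (equivShrink.{0} V v) := by
  have h : (M.proc i).Pends (C.ini i) (C.count i) v :=
    ⟨_, hC.pre i (hC.pending i v h), h⟩
  rw [hC.prop, h.spec.1]
  rfl

theorem ans_eq {C : M.Config} : C.state.ans = C.state.dec.map Prod.snd := by
  change (C.obj.log.head?.map Prod.snd).map _ = (C.obj.log.head?.map _).map _
  cases C.obj.log.head? <;> rfl

theorem dec_eq_none {C : M.Config} : C.state.dec = none ↔ C.obj.log = [] := by
  change C.obj.log.head?.map _ = none ↔ _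
  cases C.obj.log <;> simp

theorem Inv.dec_isSome_of_answered {C : M.Config} {i : Fin 2} (h : C.Answered i) :
    C.state.dec.isSome := by
  by_contra hc
  obtain ⟨w, hw⟩ := h
  rw [dec_eq_none.1 (by simpa using hc)] at hw
  cases hw

theorem Inv.answered_of_dec {C : M.Config} {i : Fin 2} {w : M.blueprint.V}
    (h : C.state.dec = some (i, w)) : C.Answered i := by
  change C.obj.log.head?.map _ = _ at h
  obtain ⟨⟨j, v⟩, hjv, he⟩ := Option.map_eq_some_iff.1 h
  cases he
  exact ⟨v, List.mem_of_head? hjv⟩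

theorem Inv.valid {C : M.Config} (hC : Inv C) : C.state.Valid := by
  refine ⟨fun i => ?_, fun i hi => ?_, fun w hw => ?_, fun i w hi => ⟨?_, ?_⟩, fun i h1 h2 => ?_⟩
  · change 1 ≤ M.off i (C.ini i) + C.count i + 1
    omega
  · rw [hC.prop] at hi
    have := Inv.len_of_none (Option.map_eq_none_iff.1 hi)
    change M.bound + 4 ≤ _
    omega
  · rw [ans_eq] at hw
    obtain ⟨⟨j, v⟩, hjv, rfl⟩ := Option.map_eq_some_iff.1 hw
    exact ⟨j, hjv⟩
  · change C.obj.log.head?.map _ = _ at hi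
    obtain ⟨⟨j, v⟩, hjv, he⟩ := Option.map_eq_some_iff.1 hi
    cases he
    rw [hC.prop, hC.first _ v hjv]
    rfl
  · have := ((hC.answered_iff i).1 (Inv.answered_of_dec hi)).2
    change M.bound + 3 ≤ _
    omega
  · have := Inv.dec_isSome_of_answered ((hC.answered_iff i).2 ⟨h2, h1⟩)
    rw [ans_eq]
    simpa using this

/-- The track goes on exactly if the process can go on or waits for an answer. -/
theorem Inv.cont_iff {C : M.Config} (hC : Inv C) {i : Fin 2} {k : ℕ} (hk : k + 1 = C.state.len i) :
    M.blueprint.cont i (C.state.s i) (C.state.label i k) (M.blueprint.cap k) ↔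
      (∃ v, C.obj.port i = .pending v) ∨ ((M.proc i).move none (C.loc i)).isSome := by
  have hk' : k = M.off i (C.ini i) + C.count i := by
    change k + 1 = M.off i (C.ini i) + C.count i + 1 at hk
    omega
  have hoff : M.off i (C.ini i) ≤ M.bound + 4 := by unfold off; split_ifs <;> omega
  change (min k (M.bound + 5 + M.horizon) = _ ∨ min k (M.bound + 5 + M.horizon) < _ ∨
    (min k (M.bound + 5 + M.horizon) = _ ∧ _) ∨ _) ↔ _
  rw [hC.decode_s]
  by_cases hp : ∃ v, C.obj.port i = .pending v
  · simp only [hp, true_or, iff_true]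
    obtain ⟨h1, h2⟩ := (hC.pending_iff i).1 hp
    exact .inr (.inr (.inl ⟨by omega, (hC.prop_isSome i).1 h1⟩))
  · simp only [hp, false_or]
    have hport : ∀ v, (C.loc i).2.2 ≠ .pending v := fun v hv => hp ⟨v, hv⟩
    -- At the repeating tile at least `horizon` events have happened, so the process never stops; it
    -- is not waiting for the object either, and so can move by itself.
    by_cases hkK : M.bound + 5 + M.horizon ≤ k
    · have : ((M.proc i).move none (C.loc i)).isSome := by
        have h1 := M.traj_isSome_of_horizon (hC.ini i) (n := C.count i) (by omega)
          (by rw [hC.traj i]; rfl) (C.count i + 1)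
        rw [DetProc.traj, hC.traj i] at h1
        rwa [DetProc.move_eq (w' := C.decided) hport]
      simp only [this, iff_true]
      left; omega
    · rw [min_eq_left (by omega), show M.blueprint.cap k = (⟨k, by
        change k < M.bound + 5 + M.horizon + 1; omega⟩ : Fin (M.blueprint.K + 1)) from
        Fin.ext (min_eq_left (by change k ≤ M.bound + 5 + M.horizon; omega))]
      have h3 : ¬ (k = M.bound + 2 ∧ ((M.proc i).proposal (C.ini i)).isSome) := by
        rintro ⟨h1, h2⟩
        exact hp ((hC.pending_iff i).2 ⟨(hC.prop_isSome i).2 h2, by omega⟩)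
      -- The label determines the trajectory up to here: from the answer site on it contains the
      -- decision, and before that the trajectory is the one without an answer, as it is for a
      -- process that never invokes.
      have h4 : (M.proc i).traj ((C.state.label i k).map (equivShrink.{0} V).symm) (C.ini i)
          (k + 1 - M.off i (C.ini i)) = (M.proc i).move none (C.loc i) := by
        rw [show k + 1 - M.off i (C.ini i) = C.count i + 1 by omega, DetProc.traj]
        unfold Blueprint.St.label
        split_ifs with hl
        · have : (C.state.ans).map (equivShrink.{0} V).symm = C.decided := by
            change (C.decided.map (equivShrink.{0} V)).map _ = _
            cases C.decided <;> simp
          rw [this, hC.traj i]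
          exact DetProc.move_eq hport
        · have : (M.proc i).traj none (C.ini i) (C.count i) = some (C.loc i) := by
            cases hpr : (M.proc i).proposal (C.ini i) with
            | none => exact DetProc.traj_none_of_proposal hpr (hC.traj i)
            | some v =>
              refine hC.pre i fun hA => ?_
              rw [hC.answered_iff] at hA
              refine hl ⟨?_, hA.1⟩
              change M.bound + 3 ≤ k
              omega
          change ((M.proc i).traj none (C.ini i) (C.count i)).bind _ = _
          rw [this]
          rfl
      rw [h4]
      have h1 : k ≠ M.bound + 5 + M.horizon := by omega
      have h2 : ¬ k < M.off i (C.ini i) := by omega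
      simp only [h1, h2, h3, false_or]

/-! ### Events and additions of tiles -/

theorem Inv.clear (C : M.Config) : C.state.Clear C.blockages := by
  intro p hp
  obtain ⟨i, -, rfl⟩ := mem_blockages.1 hp
  exact C.state.asm_blk i

theorem free_mid (C : M.Config) : Blueprint.Free C.blockages M.blueprint.mid := by
  intro p hp
  obtain ⟨i, -, rfl⟩ := mem_blockages.1 hp
  exact C.state.apart_blk_mid i

theorem free_top (C : M.Config) : Blueprint.Free C.blockages M.blueprint.top := by
  intro p hp
  obtain ⟨i, -, rfl⟩ := mem_blockages.1 hp
  exact C.state.apart_blk_top i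

theorem free_of_alive {C : M.Config} {i : Fin 2} (h : (C.proc i).crashed = false) (k : ℕ) :
    Blueprint.Free C.blockages (M.blueprint.pos i k) := by
  intro p hp
  obtain ⟨j, hj, rfl⟩ := mem_blockages.1 hp
  refine Blueprint.apart_of_side (i := j) (j := i) ?_ (C.state.one_le_sgn_mul_blk j)
    (Blueprint.one_le_sgn_mul_pos i k)
  rintro rfl
  rw [h] at hj
  cases hj

/-- The object may answer a process that has crashed while waiting: at this length its blockage is
at `trap`, which does not touch the answer site. -/
theorem free_answer {C : M.Config} {i : Fin 2} (h : C.state.len i = M.bound + 3) :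
    Blueprint.Free C.blockages (M.blueprint.pos i (M.bound + 3)) := by
  intro p hp
  obtain ⟨j, hj, rfl⟩ := mem_blockages.1 hp
  by_cases hij : j = i
  · subst hij
    unfold Blueprint.St.blk
    rw [if_pos (by change M.bound + 2 ≤ _ ∧ _ ≤ M.bound + 4; omega)]
    exact Blueprint.apart_trap_answer j
  · exact Blueprint.apart_of_side hij (C.state.one_le_sgn_mul_blk j)
      (Blueprint.one_le_sgn_mul_pos i _)

theorem state_comp {C C' : M.Config} {i : Fin 2} (h : Step C (.comp i) C') :
    C'.state = C.state.setLen i (C.state.len i + 1) := by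
  obtain ⟨-, -, -, -, hlog, -⟩ := step_comp h
  have h1 : C'.state.s = C.state.s := by
    funext j
    change M.encode j (C'.ini j) = M.encode j (C.ini j)
    rw [comp_ini h]
  have h2 : C'.state.len = Function.update C.state.len i (C.state.len i + 1) := by
    funext j
    change M.off j (C'.ini j) + C'.count j + 1 = _
    rw [comp_ini h]
    by_cases hj : j = i
    · subst hj
      rw [comp_count h, Function.update_self]
      rfl
    · rw [count_of_ne hj (.inl rfl) h, Function.update_of_ne hj]
      rfl
  have h3 : C'.state.dec = C.state.dec := by
    change C'.obj.log.head?.map _ = C.obj.log.head?.map _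
    rw [hlog]
  have h4 : C'.state.ans = C.state.ans := by rw [ans_eq, h3, ans_eq]
  generalize C'.state = y at *
  cases y
  simp only at h1 h2 h3 h4
  subst h1 h2 h3 h4
  rfl

theorem blockages_comp {C C' : M.Config} {i : Fin 2} (h : Step C (.comp i) C') :
    C'.blockages = C.blockages := by
  obtain ⟨ha, -, -, -, -, hcr⟩ := step_comp h
  ext p
  rw [mem_blockages, mem_blockages]
  refine exists_congr fun j => ?_
  rw [hcr]
  refine and_congr_right fun hj => ?_
  have hji : j ≠ i := by
    rintro rfl
    rw [ha] at hj
    cases hj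
  rw [state_comp h]
  simp [Blueprint.St.blk, Blueprint.St.setLen, hji]

theorem tiles_comp {C C' : M.Config} {i : Fin 2} (h : Step C (.comp i) C') :
    C'.tiles = (C.state.setLen i (C.state.len i + 1)).form C.blockages := by
  unfold Config.tiles
  rw [state_comp h, blockages_comp h]

theorem Inv.cont_of_comp {C C' : M.Config} (hC : Inv C) {i : Fin 2} (h : Step C (.comp i) C')
    {k : ℕ} (hk : k + 1 = C.state.len i) :
    M.blueprint.cont i (C.state.s i) (C.state.label i k) (M.blueprint.cap k) := by
  obtain ⟨-, -, hm, -⟩ := step_comp h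
  exact (hC.cont_iff hk).2 (.inr (by rw [hm]; rfl))

theorem Inv.len_ne_of_comp {C C' : M.Config} (hC : Inv C) {i : Fin 2} (h : Step C (.comp i) C')
    (hp : (M.blueprint.prop i (C.state.s i)).isSome) : C.state.len i ≠ M.bound + 3 := by
  intro h1
  obtain ⟨-, hport, -⟩ := step_comp h
  obtain ⟨v, hv⟩ := (hC.pending_iff i).2 ⟨hp, h1⟩
  exact hport v hv

theorem Inv.attach_comp {C C' : M.Config} (hC : Inv C) {i : Fin 2} (h : Step C (.comp i) C') :
    C.tiles.Attach C'.tiles := by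
  rw [tiles_comp h]
  exact Blueprint.St.attach_track (free_of_alive (step_comp h).1 _)
    (fun k hk => hC.cont_of_comp h hk) fun h1 h2 => absurd h1 (hC.len_ne_of_comp h h2)

theorem state_respond {C C' : M.Config} (hC : Inv C) {i : Fin 2} {v : V}
    (hp : C.obj.port i = .pending v) (h : Step C (.respond i) C') :
    C'.state = (if C.state.dec = none then
      (C.state.decide i (equivShrink.{0} V v)).spread (equivShrink.{0} V v) else C.state).setLen i
        (C.state.len i + 1) := by
  obtain ⟨v', hp', -, -, hlog, -⟩ := step_respond h
  rw [hp] at hp'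
  cases hp'
  have h1 : C'.state.s = C.state.s := by
    funext j
    change M.encode j (C'.ini j) = M.encode j (C.ini j)
    rw [respond_ini h]
  have h2 : C'.state.len = Function.update C.state.len i (C.state.len i + 1) := by
    funext j
    change M.off j (C'.ini j) + C'.count j + 1 = _
    rw [respond_ini h]
    by_cases hj : j = i
    · subst hj
      rw [respond_count hC h, Function.update_self]
      rfl
    · rw [count_of_ne hj (.inr rfl) h, Function.update_of_ne hj]
      rfl
  have h4 := ans_eq (C := C')
  have h5 := ans_eq (C := C)
  by_cases hd : C.state.dec = none
  · have h3 : C'.state.dec = some (i, equivShrink.{0} V v) := by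
      rw [dec_eq_none] at hd
      change C'.obj.log.head?.map _ = _
      rw [hlog, hd]
      simp [ObjState.answer, hd]
      rfl
    rw [if_pos hd]
    generalize C'.state = y at *
    cases y
    simp only at h1 h2 h3 h4
    subst h1 h2 h3 h4
    rfl
  · have h3 : C'.state.dec = C.state.dec := by
      rw [dec_eq_none] at hd
      change C'.obj.log.head?.map _ = _
      rw [hlog, List.head?_append_of_ne_nil _ hd]
      rfl
    rw [if_neg hd]
    rw [h3, ← h5] at h4
    generalize C'.state = y at *
    cases y
    simp only at h1 h2 h3 h4
    subst h1 h2 h3 h4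
    rfl

/-- An answer extends a track from length `m + 3` to `m + 4`. Both lengths put a blockage at `trap`,
so the blockage of a crashed process need not move. -/
theorem blockages_respond {C C' : M.Config} (hC : Inv C) {i : Fin 2} (h : Step C (.respond i) C') :
    C'.blockages = C.blockages := by
  obtain ⟨v, hp, -, -, -, hcr⟩ := step_respond h
  have hlen : C'.state.len = Function.update C.state.len i (C.state.len i + 1) := by
    rw [state_respond hC hp h]
    split_ifs <;> rfl
  have hi := ((hC.pending_iff i).1 ⟨v, hp⟩).2
  ext p
  rw [mem_blockages, mem_blockages]
  refine exists_congr fun j => ?_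
  rw [hcr]
  refine and_congr_right fun hj => ?_
  unfold Blueprint.St.blk
  rw [hlen]
  by_cases hji : j = i
  · subst hji
    rw [Function.update_self, if_pos (by change M.bound + 2 ≤ _ ∧ _ ≤ M.bound + 4; omega),
      if_pos (by change M.bound + 2 ≤ _ ∧ _ ≤ M.bound + 4; omega)]
  · rw [Function.update_of_ne hji]

/-- The first answer takes three tiles: the decision, the tile that spreads it, and the answer tile.
The second answer takes only the last of these. -/
theorem Inv.producesCleanly_respond {C C' : M.Config} (hC : Inv C) {i : Fin 2}
    (h : Step C (.respond i) C') : C.tiles.ProducesCleanly C'.tiles := by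
  obtain ⟨v, hp, -⟩ := step_respond h
  obtain ⟨hpr, hlen⟩ := (hC.pending_iff i).1 ⟨v, hp⟩
  have hprop := hC.prop_of_pending hp
  have hval := hC.valid
  unfold Config.tiles
  rw [blockages_respond hC h, state_respond hC hp h]
  have track : ∀ x : M.blueprint.St, x.s = C.state.s → x.len = C.state.len → x.ans.isSome →
      (x.form C.blockages).Attach ((x.setLen i (C.state.len i + 1)).form C.blockages) := by
    intro x hs hl ha
    have := Blueprint.St.attach_track (x := x) (E := C.blockages) (i := i)
      (by rw [hl, hlen]; exact free_answer hlen) ?_ (fun _ _ => ha)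
    · rwa [hl] at this
    · intro k hk
      have hkm : k = M.bound + 2 := by rw [hl] at hk; omega
      have hlab : x.label i k = C.state.label i k := by
        unfold Blueprint.St.label
        have : ¬ M.blueprint.m + 3 ≤ k := by change ¬ M.bound + 3 ≤ k; omega
        simp [this]
      rw [hs, hlab]
      exact (hC.cont_iff (by rw [hl] at hk; exact hk)).2 (.inl ⟨v, hp⟩)
  split_ifs with hd
  · have hans : C.state.ans = none := by rw [ans_eq, hd]; rfl
    have hval' := hval.decide hd hprop (show M.bound + 2 < C.state.len i by omega)
    refine ReflTransGen.head (Blueprint.St.attach_dec (free_mid C) hd hprop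
      (show M.bound + 2 < C.state.len i by omega)) ?_
    refine ReflTransGen.head (Blueprint.St.attach_north (free_top C) hval'.ans_of_len hans rfl) ?_
    exact ReflTransGen.single (track _ rfl rfl rfl)
  · refine ReflTransGen.single (track _ rfl rfl ?_)
    rw [ans_eq]
    cases hd' : C.state.dec with
    | none => exact absurd hd' hd
    | some e => rfl

theorem state_crash {C C' : M.Config} {i : Fin 2} (h : Step C (.crash i) C') :
    C'.state = C.state := by
  obtain ⟨-, hl, hlog, -⟩ := step_crash h
  have hini : ∀ j, C'.ini j = C.ini j := fun j => by unfold Config.ini; rw [hl]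
  have hcount : ∀ j, C'.count j = C.count j := fun j =>
    count_of_loc (hl j) (by simp only [Config.Answered, hlog])
  have hd : C'.decided = C.decided := by unfold Config.decided; rw [hlog]
  unfold Config.state
  simp only [hini, hcount, hd, hlog]

theorem tiles_crash {C C' : M.Config} {i : Fin 2} (h : Step C (.crash i) C') :
    C.blockages = ∅ ∧ C'.blockages = {C.state.blk i} := by
  obtain ⟨ha, -, -, hcr⟩ := step_crash h
  constructor
  · refine Finset.eq_empty_of_forall_notMem fun p hp => ?_
    obtain ⟨j, hj, -⟩ := mem_blockages.1 hp
    rw [ha j] at hj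
    cases hj
  · ext p
    rw [mem_blockages, state_crash h, Finset.mem_singleton]
    simp only [hcr]
    constructor
    · rintro ⟨j, rfl, rfl⟩; rfl
    · rintro rfl; exact ⟨i, rfl, rfl⟩

theorem Inv.block_crash {C C' : M.Config} (hC : Inv C) {i : Fin 2} (h : Step C (.crash i) C') :
    C.tiles.Block C'.tiles := by
  obtain ⟨h1, h2⟩ := tiles_crash h
  unfold Config.tiles
  rw [state_crash h, h1, h2]
  exact Blueprint.St.block_form (hC.valid.one_le_len i) (by simp)

theorem Inv.producesCleanly {C C' : M.Config} (hC : Inv C) {e : Event} (h : Step C e C')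
    (he : ¬ e.IsCrash) : C.tiles.ProducesCleanly C'.tiles := by
  rcases e with i | i | i
  · exact ReflTransGen.single (hC.attach_comp h)
  · exact hC.producesCleanly_respond h
  · exact absurd trivial he

theorem Inv.produces {C C' : M.Config} (hC : Inv C) {e : Event} (h : Step C e C') :
    C.tiles.Produces C'.tiles := by
  rcases e with i | i | i
  · exact (hC.producesCleanly h id).produces
  · exact (hC.producesCleanly h id).produces
  · exact ReflTransGen.single (.inr (hC.block_crash h))

theorem IsInitial.producesCleanly {C : M.Config} (h : M.IsInitial C) :
    M.blueprint.tileSystem.seedAssembly.ProducesCleanly C.tiles := by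
  have hC := h.inv
  have hb : C.blockages = ∅ := by
    refine Finset.eq_empty_of_forall_notMem fun p hp => ?_
    obtain ⟨j, hj, -⟩ := mem_blockages.1 hp
    rw [h.alive j] at hj
    cases hj
  have hA : ∀ i, ¬ C.Answered i := by
    rintro i ⟨w, hw⟩
    rw [h.log] at hw
    cases hw
  have hcount : ∀ i, C.count i = 0 := by
    intro i
    rw [Config.count, if_neg (hA i)]
    simp [DetProc.Local.count, Config.loc, h.past, h.port]
  have hdec : C.state.dec = none := dec_eq_none.2 h.log
  have hans : C.state.ans = none := by rw [ans_eq, hdec]; rfl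
  have hcont : ∀ i k w, k + 1 < C.state.len i →
      M.blueprint.cont i (C.state.s i) w (M.blueprint.cap k) := by
    intro i k w hk
    change k + 1 < M.off i (C.ini i) + C.count i + 1 at hk
    rw [hcount] at hk
    right; left
    rw [hC.decode_s]
    exact (min_le_left _ _).trans_lt (by omega)
  have hlen : ∀ i, M.blueprint.m + 3 < C.state.len i →
      ¬ (M.blueprint.prop i (C.state.s i)).isSome :=
    fun i h1 h2 => hA i ((hC.answered_iff i).2 ⟨h2, h1⟩)
  -- The two tracks are grown from the bare seed, one after the other. Neither needs an answer,
  -- because an invoking process has not passed its answer site in an initial configuration.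
  let x₀ : M.blueprint.St := ⟨C.state.s, fun _ => 0, none, none⟩
  have h0 := x₀.producesCleanly_setLen 0 rfl (C.state.len 0) (fun k hk => hcont 0 k _ hk)
    (fun h1 h2 => absurd h2 (hlen 0 h1))
  have h1 := (x₀.setLen 0 (C.state.len 0)).producesCleanly_setLen 1 (by simp [x₀, Blueprint.St.setLen])
    (C.state.len 1) (fun k hk => hcont 1 k _ hk) (fun h1 h2 => absurd h2 (hlen 1 h1))
  have hx : (x₀.setLen 0 (C.state.len 0)).setLen 1 (C.state.len 1) = C.state := by
    have hl : Function.update (Function.update (fun _ => 0) 0 (C.state.len 0)) 1 (C.state.len 1) =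
        C.state.len := by
      funext i
      fin_cases i <;> simp
    simp only [Blueprint.St.setLen, x₀, hl]
    generalize C.state = y at *
    cases y
    simp only at hdec hans
    subst hdec hans
    rfl
  rw [← Blueprint.St.form_zero C.state.s]
  unfold Config.tiles
  rw [hb, ← hx]
  exact ReflTransGen.trans h0 h1

end DistSystem

namespace Blueprint.St

variable {b : Blueprint}

/-! ### States are determined by their placements -/

/-- The first tile of a track shows the input, the occupied sites show the length, and `mid` and
`top` show the decision. Walls cannot be confused with any of these tiles. -/
theorem le_of_sub {x y : b.St} (hx : ∀ i, 1 ≤ x.len i) {E E' : Finset (ℤ × ℤ)}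
    (h : (x.full E).Sub (y.full E')) : x.Le y := by
  have key : ∀ p t, x.asm p = some t → t ≠ .wall → y.asm p = some t := by
    intro p t hp ht
    rcases full_cases (h p t (full_of_asm hp)) with h1 | ⟨h1, -⟩
    · exact h1
    · exact absurd h1 ht
  have track : ∀ i k, k < x.len i → k < y.len i ∧ y.trackTile i k = x.trackTile i k := by
    intro i k hk
    have h1 := key _ _ (asm_pos hk) (by simp [trackTile])
    by_cases hk' : k < y.len i
    · rw [asm_pos hk'] at h1
      exact ⟨hk', Option.some_injective _ h1⟩
    · rw [asm_pos_none (by omega)] at h1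
      cases h1
  refine ⟨funext fun i => ?_, fun i => ?_, fun e he => ?_, fun v hv => ?_⟩
  · have h1 := (track i 0 (hx i)).2
    unfold trackTile at h1
    injection h1
  · by_contra hc
    have := (track i (y.len i) (by omega)).1
    omega
  · have h1 := key b.mid (.dec e.1 e.2) (by simp [asm_mid, he]) (by simp)
    rw [asm_mid] at h1
    obtain ⟨e', he', h2⟩ := Option.map_eq_some_iff.1 h1
    injection h2 with h3 h4
    rw [he', Prod.ext h3 h4]
  · have h1 := key b.top (.north v) (by simp [asm_top, hv]) (by simp)
    rw [asm_top] at h1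
    obtain ⟨e', he', h2⟩ := Option.map_eq_some_iff.1 h1
    injection h2 with h3
    rw [he', h3]

theorem Le.antisymm {x y : b.St} (h : x.Le y) (h' : y.Le x) : x = y := by
  obtain ⟨s, l, d, a⟩ := x
  obtain ⟨s', l', d', a'⟩ := y
  obtain rfl : s' = s := h.s
  obtain rfl : l = l' := funext fun i => le_antisymm (h.len i) (h'.len i)
  obtain rfl : d = d' := Option.ext fun e => ⟨h.dec e, h'.dec e⟩
  obtain rfl : a = a' := Option.ext fun e => ⟨h.ans e, h'.ans e⟩
  rfl

theorem eq_of_blk_eq {x y : b.St} {i j : Fin 2} (h : x.blk i = y.blk j) : i = j := by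
  have h1 := x.one_le_sgn_mul_blk i
  have h2 := y.one_le_sgn_mul_blk j
  rw [h] at h1
  rcases sgn_cases i with ⟨rfl, h3, -⟩ | ⟨rfl, h3, -⟩ <;>
  rcases sgn_cases j with ⟨rfl, h4, -⟩ | ⟨rfl, h4, -⟩ <;> rw [h3] at h1 <;> rw [h4] at h2 <;>
  first | rfl | omega

end Blueprint.St

namespace DistSystem

variable {V : Type u} {M : DistSystem.{u, v} V}

/-! ### Configurations are determined by their tiles -/

/-- The log has at most two entries, for different processes and with the same value; its head and
the set of answered processes determine it. -/
theorem Inv.log_eq {C C' : M.Config} (hC : Inv C) (hC' : Inv C')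
    (h : C.obj.log.head? = C'.obj.log.head?) (hA : ∀ i, C.Answered i ↔ C'.Answered i) :
    C.obj.log = C'.obj.log := by
  have key : ∀ {i j k : Fin 2}, i ≠ j → i ≠ k → j = k := by omega
  have h1 : ∀ {D : M.Config} {i : Fin 2} {v : V}, D.obj.log = [(i, v)] →
      ∀ j, D.Answered j → j = i := by
    rintro D i v hD j ⟨w, hw⟩
    rw [hD, List.mem_singleton] at hw
    exact congrArg Prod.fst hw
  have h2 : ∀ {D : M.Config} {i j : Fin 2} {v : V}, D.obj.log = [(i, v), (j, v)] →
      D.Answered j := by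
    intro D i j v hD
    exact ⟨v, by rw [hD]; simp⟩
  rcases hC.log with hl | ⟨i, v, hl⟩ | ⟨i, j, v, hij, hl⟩ <;>
  rcases hC'.log with hl' | ⟨i', v', hl'⟩ | ⟨i', j', v', hij', hl'⟩ <;>
  rw [hl, hl'] at h <;> simp only [List.head?_nil, List.head?_cons, Option.some.injEq,
    Prod.mk.injEq, reduceCtorEq] at h <;> rw [hl, hl']
  · rw [h.1, h.2]
  · exact absurd (h.1.symm.trans (h1 hl _ ((hA _).2 (h2 hl'))).symm) hij'
  · exact absurd (h.1.trans (h1 hl' _ ((hA _).1 (h2 hl))).symm) hij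
  · obtain ⟨rfl, rfl⟩ := h
    rw [key hij hij']

variable [Finite V]

theorem head_eq_of_dec {C C' : M.Config} (h : C.state.dec = C'.state.dec) :
    C.obj.log.head? = C'.obj.log.head? := by
  have hf : Function.Injective fun e : Fin 2 × V => (e.1, equivShrink.{0} V e.2) :=
    fun e e' h => Prod.ext (Prod.mk.inj h).1 ((equivShrink.{0} V).injective (Prod.mk.inj h).2)
  exact Option.map_injective hf h

/-- The trajectories recover the local states with their histories from the input, the number of
events and the decision. -/
theorem Inv.eq_of_state {C C' : M.Config} (hC : Inv C) (hC' : Inv C') (h : C.state = C'.state)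
    (hcr : ∀ i, (C.proc i).crashed = (C'.proc i).crashed) : C = C' := by
  have hini : ∀ i, C.ini i = C'.ini i := by
    intro i
    rw [← hC.decode_s, ← hC'.decode_s, h]
  have hcount : ∀ i, C.count i = C'.count i := by
    intro i
    have h1 : C.state.len i = C'.state.len i := by rw [h]
    change M.off i (C.ini i) + C.count i + 1 = M.off i (C'.ini i) + C'.count i + 1 at h1
    rw [hini] at h1
    omega
  have hhead := head_eq_of_dec (show C.state.dec = C'.state.dec by rw [h])
  have hdec : C.decided = C'.decided := by unfold Config.decided; rw [hhead]
  refine Config.ext' (fun i => ?_) hcr (hC.log_eq hC' hhead fun i => ?_)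
  · have h1 := hC.traj i
    rw [hini, hcount, hdec, hC'.traj i] at h1
    exact (Option.some_injective _ h1).symm
  · rw [hC.answered_iff, hC'.answered_iff, h]

theorem crashed_iff {C : M.Config} {i : Fin 2} :
    (C.proc i).crashed = true ↔ C.state.blk i ∈ C.blockages := by
  rw [mem_blockages]
  constructor
  · exact fun h => ⟨i, h, rfl⟩
  · rintro ⟨j, hj, h⟩
    rwa [← Blueprint.St.eq_of_blk_eq h]

theorem le_of_produces {C C' : M.Config} (h : C.tiles.Produces C'.tiles) : C.state.Le C'.state :=
  Blueprint.St.le_of_sub (fun i => by change 1 ≤ M.off i _ + _ + 1; omega)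
    (TileSet.Assembly.Produces.sub h).1

theorem Inv.tiles_injective {C C' : M.Config} (hC : Inv C) (hC' : Inv C')
    (h : C.tiles = C'.tiles) : C = C' := by
  have hs : C.state = C'.state :=
    (le_of_produces (h ▸ ReflTransGen.refl)).antisymm (le_of_produces (h ▸ ReflTransGen.refl))
  refine hC.eq_of_state hC' hs fun i => ?_
  rw [Bool.eq_iff_iff, crashed_iff, crashed_iff, hs, show C.blockages = C'.blockages from
    congrArg TileSet.Assembly.err h]

/-! ### What the tiles can do, the processes can do -/

/-- What becomes of the track of a crashed process. -/
theorem crashed_of_produces {C C' : M.Config} (h : C.tiles.Produces C'.tiles)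
    {i : Fin 2} (hi : (C.proc i).crashed = true) :
    (C'.proc i).crashed = true ∧ (C'.state.len i = C.state.len i ∨
      (C.state.len i = M.bound + 3 ∧ C'.state.len i = M.bound + 4)) := by
  have hle := (le_of_produces h).len i
  have hmem : C.state.blk i ∈ C.blockages := crashed_iff.1 hi
  obtain ⟨j, hj, hblk⟩ := mem_blockages.1 ((TileSet.Assembly.Produces.sub h).2 hmem)
  obtain rfl := Blueprint.St.eq_of_blk_eq hblk
  refine ⟨hj, ?_⟩
  have hm : M.blueprint.m = M.bound := rfl
  unfold Blueprint.St.blk at hblk hmem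
  split_ifs at hblk hmem with h1 h2 h2
  · by_cases h3 : C.state.len j = M.bound + 2
    · left
      by_contra hne
      have h4 : C.tiles.tile (M.blueprint.pos j (M.bound + 2)) = none := by
        refine Blueprint.St.full_eq_none.2 ⟨Blueprint.St.asm_pos_none h3.le, fun h5 => ?_⟩
        obtain ⟨k, -, hk⟩ := mem_blockages.1 h5
        have hside := C.state.one_le_sgn_mul_blk k
        have hside' := Blueprint.one_le_sgn_mul_pos (b := M.blueprint) j (M.bound + 2)
        have hkj : k = j := by
          by_contra hkj
          exact (Blueprint.apart_of_side hkj hside hside').1 hk.symm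
        subst hkj
        unfold Blueprint.St.blk at hk
        rw [if_pos h2] at hk
        exact Blueprint.trap_ne_pos _ _ _ hk
      have h5 : M.blueprint.pos j (M.bound + 2) ∉ C'.tiles.err := by
        intro h5
        obtain ⟨k, -, hk⟩ := mem_blockages.1 h5
        have hside := C'.state.one_le_sgn_mul_blk k
        have hside' := Blueprint.one_le_sgn_mul_pos (b := M.blueprint) j (M.bound + 2)
        have hkj : k = j := by
          by_contra hkj
          exact (Blueprint.apart_of_side hkj hside hside').1 hk.symm
        subst hkj
        unfold Blueprint.St.blk at hk
        rw [if_pos h1] at hk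
        exact Blueprint.trap_ne_pos _ _ _ hk
      have h6 := TileSet.Assembly.Produces.eq_none_of_adj h (d := sideOf j) h4
        (by rw [show M.bound = M.blueprint.m from rfl, Blueprint.trap_adj_pending]; exact hmem) h5
      rw [show C'.tiles.tile _ = _ from Blueprint.St.full_of_asm
        (Blueprint.St.asm_pos (show M.bound + 2 < C'.state.len j by omega))] at h6
      cases h6
    · omega
  · exact absurd hblk (Blueprint.trap_ne_pos _ _ _)
  · exact absurd hblk.symm (Blueprint.trap_ne_pos _ _ _)
  · exact .inl (Blueprint.pos_injective hblk).2

theorem Inv.prop_isSome_of_len {C : M.Config} {i : Fin 2} (hC : Inv C)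
    (h : C.state.len i ≤ M.bound + 4) : (M.blueprint.prop i (C.state.s i)).isSome := by
  rw [hC.prop_isSome]
  by_contra hc
  have := Inv.len_of_none (C := C) (i := i) (by simpa using hc)
  omega

/-- The trajectory of the later configuration passes through the present local state: an answer
already given is the same in both, and an answer not yet given has had no influence. So the process
has a next event, and it does not wait for the object. -/
theorem Inv.exists_step_comp_of_le {C C' : M.Config} (hC : Inv C) (hC' : Inv C')
    (h : C.state.Le C'.state) {i : Fin 2} (hi : C.state.len i < C'.state.len i)
    (ha : (C.proc i).crashed = false) (hp : ∀ v, C.obj.port i ≠ .pending v) :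
    ∃ D, Step C (.comp i) D := by
  refine exists_step_comp ha hp ?_
  have hini : C'.ini i = C.ini i := by rw [← hC.decode_s, ← hC'.decode_s, h.s]
  have hcount : C.count i + 1 ≤ C'.count i := by
    change M.off i (C.ini i) + C.count i + 1 < M.off i (C'.ini i) + C'.count i + 1 at hi
    rw [hini] at hi
    omega
  have h1 := DetProc.traj_isSome_of_le hcount (by rw [hC'.traj i]; rfl)
  have h2 : (M.proc i).traj C'.decided (C.ini i) (C.count i) = some (C.loc i) := by
    by_cases hA : C.Answered i
    · have h3 : C'.obj.log.head? = C.obj.log.head? := by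
        obtain ⟨e, he⟩ := Option.isSome_iff_exists.1 (Inv.dec_isSome_of_answered hA)
        exact head_eq_of_dec ((h.dec e he).trans he.symm)
      rw [show C'.decided = C.decided by unfold Config.decided; rw [h3]]
      exact hC.traj i
    · exact DetProc.traj_of_none (hC.pre i hA)
  rw [DetProc.traj, hini, h2] at h1
  rwa [DetProc.move_eq (w' := C'.decided) hp]

/-- A configuration that the tiles may turn into another one. -/
structure Precedes (C C' : M.Config) : Prop where
  le : C.state.Le C'.state
  crashed : ∀ i, (C.proc i).crashed = true → (C'.proc i).crashed = true ∧
    (C'.state.len i = C.state.len i ∨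
      (C.state.len i = M.bound + 3 ∧ C'.state.len i = M.bound + 4))

theorem Inv.len_of_dec {C' : M.Config} (hC' : Inv C') {i : Fin 2} {w : M.blueprint.V} (hd : C'.state.dec = some (i, w)) :
    (M.blueprint.prop i (C'.state.s i)).isSome ∧ M.bound + 4 ≤ C'.state.len i :=
  (hC'.answered_iff i).1 (Inv.answered_of_dec hd)

/-- If a decision is still to come, the process behind it must go first, because the first answer
fixes the decision. Its track is still short: otherwise it would have been answered already. -/
theorem Precedes.exists_next {C C' : M.Config} (hC : Inv C) (hC' : Inv C') (h : Precedes C C')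
    (hlt : ∃ i, C.state.len i < C'.state.len i) :
    ∃ i, C.state.len i < C'.state.len i ∧ ∀ e, C.state.dec = none → C'.state.dec = some e →
      e.1 = i := by
  by_cases hd : ∃ e, C.state.dec = none ∧ C'.state.dec = some e
  · obtain ⟨⟨i, w⟩, h1, h2⟩ := hd
    refine ⟨i, ?_, fun e _ he => ?_⟩
    · by_contra hc
      have h3 := hC'.len_of_dec h2
      rw [h.le.s] at h3
      have := Inv.dec_isSome_of_answered ((hC.answered_iff i).2 ⟨h3.1, by omega⟩)
      rw [h1] at this
      cases this
    · rw [h2] at he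
      cases he
      rfl
  · obtain ⟨i, hi⟩ := hlt
    exact ⟨i, hi, fun e h1 h2 => absurd ⟨e, h1, h2⟩ hd⟩

/-- A pending process is answered, even if it has crashed; any other process with a track to extend
is alive and can make a computation step. The choice of the process makes a new decision agree with
the final one. -/
theorem Precedes.step {C C' : M.Config} (hC : Inv C) (hC' : Inv C') (h : Precedes C C')
    (hlt : ∃ i, C.state.len i < C'.state.len i) :
    ∃ e D i, Step C e D ∧ Precedes D C' ∧
      D.state.len = Function.update C.state.len i (C.state.len i + 1) ∧
      C.state.len i < C'.state.len i := by
  obtain ⟨i, hi, hfirst⟩ := h.exists_next hC hC' hlt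
  have hlen : ∀ j, Function.update C.state.len i (C.state.len i + 1) j ≤ C'.state.len j := by
    intro j
    by_cases hj : j = i
    · subst hj; simpa using hi
    · simpa [hj] using h.le.len j
  by_cases hp : ∃ v, C.obj.port i = .pending v
  · obtain ⟨v, hv⟩ := hp
    obtain ⟨hpr, hl⟩ := (hC.pending_iff i).1 ⟨v, hv⟩
    have hs : Step C (.respond i) _ := Step.respond hv
    generalize ((C.addLog i (C.obj.answer v)).setPort i (.acked (C.obj.answer v))) = D at hs
    have hD := state_respond hC hv hs
    have hlen' : D.state.len = Function.update C.state.len i (C.state.len i + 1) := by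
      rw [hD]; split_ifs <;> rfl
    refine ⟨_, D, i, hs, ⟨⟨?_, ?_, ?_, ?_⟩, fun j hj => ?_⟩, hlen', hi⟩
    · rw [hD, h.le.s]; split_ifs <;> rfl
    · intro j
      rw [hlen']
      exact hlen j
    · rw [hD]
      split_ifs with hd
      · rintro e he
        cases he
        have h1 := hC'.valid.ans_of_len i (by change M.bound + 4 ≤ _; omega) (by rw [h.le.s]; exact hpr)
        rw [ans_eq, Option.isSome_map] at h1
        obtain ⟨⟨j, w⟩, he⟩ := Option.isSome_iff_exists.1 h1
        obtain rfl : j = i := hfirst _ hd he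
        have h2 := (hC'.valid.prop_of_dec _ _ he).1
        rw [h.le.s, hC.prop_of_pending hv] at h2
        cases h2
        exact he
      · exact h.le.dec
    · rw [hD]
      split_ifs with hd
      · rintro w hw
        cases hw
        have h1 := hC'.valid.ans_of_len i (by change M.bound + 4 ≤ _; omega) (by rw [h.le.s]; exact hpr)
        rw [ans_eq, Option.isSome_map] at h1
        obtain ⟨⟨j, w⟩, he⟩ := Option.isSome_iff_exists.1 h1
        obtain rfl : j = i := hfirst _ hd he
        have h2 := (hC'.valid.prop_of_dec _ _ he).1
        rw [h.le.s, hC.prop_of_pending hv] at h2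
        cases h2
        rw [ans_eq, he]
        rfl
      · exact h.le.ans
    · obtain ⟨-, -, -, -, -, hcr⟩ := step_respond hs
      rw [hcr] at hj
      have h1 := h.crashed j hj
      refine ⟨h1.1, ?_⟩
      rw [hlen']
      by_cases hji : j = i
      · subst hji
        rw [Function.update_self]
        omega
      · rw [Function.update_of_ne hji]
        exact h1.2
  · have ha : (C.proc i).crashed = false := by
      by_contra hc
      rcases (h.crashed i (by simpa using hc)).2 with h1 | ⟨h1, -⟩
      · omega
      · exact hp ((hC.pending_iff i).2 ⟨hC.prop_isSome_of_len (by omega), h1⟩)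
    obtain ⟨D, hs⟩ := hC.exists_step_comp_of_le hC' h.le hi ha fun v hv => hp ⟨v, hv⟩
    have hD := state_comp hs
    have hlen' : D.state.len = Function.update C.state.len i (C.state.len i + 1) := by rw [hD]; rfl
    refine ⟨_, D, i, hs, ⟨⟨?_, ?_, ?_, ?_⟩, fun j hj => ?_⟩, hlen', hi⟩
    · rw [hD]; exact h.le.s
    · intro j
      rw [hlen']
      exact hlen j
    · rw [hD]; exact h.le.dec
    · rw [hD]; exact h.le.ans
    · obtain ⟨-, -, -, -, -, hcr⟩ := step_comp hs
      rw [hcr] at hj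
      have hji : j ≠ i := by
        rintro rfl
        rw [ha] at hj
        cases hj
      rw [hlen', Function.update_of_ne hji]
      exact h.crashed j hj

/-- The process that decided in `C'` was answered there, hence also in `C` if the lengths agree; so
the decisions agree too. -/
theorem Precedes.state_eq {C C' : M.Config} (hC : Inv C) (hC' : Inv C') (h : Precedes C C')
    (hlen : ∀ i, C'.state.len i ≤ C.state.len i) : C.state = C'.state := by
  have hdec : ∀ e, C'.state.dec = some e → C.state.dec = some e := by
    rintro ⟨i, w⟩ he
    have h1 := hC'.len_of_dec he
    rw [h.le.s] at h1
    obtain ⟨e, he'⟩ := Option.isSome_iff_exists.1 (Inv.dec_isSome_of_answered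
      ((hC.answered_iff i).2 ⟨h1.1, h1.2.trans (hlen i)⟩))
    rw [he', ← he, h.le.dec _ he']
  refine h.le.antisymm ⟨h.le.s.symm, hlen, hdec, fun w hw => ?_⟩
  rw [ans_eq] at hw ⊢
  obtain ⟨e, he, rfl⟩ := Option.map_eq_some_iff.1 hw
  rw [hdec e he]
  rfl

/-- Induction on the number of track tiles still missing. A crash that is new in `C'` is postponed
until all other events have happened. -/
theorem InvokesAtMostOnce.reaches_of_precedes (hM : M.InvokesAtMostOnce) {C C' : M.Config}
    (hC : M.Reachable C) (hC' : M.Reachable C') (h : Precedes C C') : M.Reaches C C' := by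
  induction hn : ∑ i, (C'.state.len i - C.state.len i) using Nat.strong_induction_on
    generalizing C with
  | h n ih =>
    by_cases hlt : ∃ i, C.state.len i < C'.state.len i
    · obtain ⟨e, D, i, hs, hD, hlen, hi⟩ := h.step (hM.inv hC) (hM.inv hC') hlt
      refine ReflTransGen.head ⟨e, hs⟩ (ih _ ?_ (hC.tail hs) hD rfl)
      rw [← hn]
      refine Finset.sum_lt_sum (fun j _ => ?_) ⟨i, Finset.mem_univ _, ?_⟩
      · rw [hlen]
        by_cases hj : j = i
        · subst hj
          rw [Function.update_self]
          omega
        · rw [Function.update_of_ne hj]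
      · rw [hlen, Function.update_self]
        omega
    · have hst := h.state_eq (hM.inv hC) (hM.inv hC') fun i => by
        by_contra hc
        exact hlt ⟨i, by omega⟩
      by_cases hcr : ∀ i, (C'.proc i).crashed = true → (C.proc i).crashed = true
      · rw [(hM.inv hC).eq_of_state (hM.inv hC') hst fun i =>
          Bool.eq_iff_iff.2 ⟨fun hi => (h.crashed i hi).1, hcr i⟩]
        exact ReflTransGen.refl
      · push Not at hcr
        obtain ⟨i, hi, hi'⟩ := hcr
        obtain ⟨k, hk⟩ := (hM.inv hC').alive
        -- One process is alive in `C'`, so the crashed one is the only one, and nobody has crashed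
        -- in `C`.
        have hki : ∀ j, j ≠ i → j = k := by
          have : k ≠ i := by
            rintro rfl
            rw [hk] at hi
            cases hi
          omega
        have halive : ∀ j, (C.proc j).crashed = false := by
          intro j
          by_contra hj
          have hj := (h.crashed j (by simpa using hj)).1
          have : j ≠ i := by
            rintro rfl
            simp_all
          rw [hki j this, hk] at hj
          cases hj
        have hs : Step C (.crash i) (C.setCrashed i) := Step.crash halive
        generalize C.setCrashed i = D at hs
        refine ReflTransGen.single ⟨.crash i, ?_⟩
        obtain rfl : D = C' := by
          refine (hM.inv (hC.tail hs)).eq_of_state (hM.inv hC') ((state_crash hs).trans hst) fun j => ?_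
          rw [Bool.eq_iff_iff, (step_crash hs).2.2.2]
          constructor
          · rintro rfl; exact hi
          · intro hj
            by_contra hji
            rw [hki j hji, hk] at hj
            cases hj
        exact hs

theorem InvokesAtMostOnce.reaches_of_produces (hM : M.InvokesAtMostOnce) {C C' : M.Config}
    (hC : M.Reachable C) (hC' : M.Reachable C') (h : C.tiles.Produces C'.tiles) :
    M.Reaches C C' :=
  hM.reaches_of_precedes hC hC' ⟨le_of_produces h, fun _ => crashed_of_produces h⟩

theorem InvokesAtMostOnce.stable (hM : M.InvokesAtMostOnce) {C : M.Config} (hC : M.Reachable C) :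
    C.tiles.Stable := by
  obtain ⟨C₀, h0, hr⟩ := hC
  suffices h : C.tiles.Sound from h.stable
  induction hr with
  | refl => exact M.blueprint.seedAssembly_sound.produces h0.producesCleanly.produces
  | tail hD hs ih =>
    obtain ⟨e, hs⟩ := hs
    exact ih.produces ((hM.inv ⟨C₀, h0, hD⟩).produces hs)

end DistSystem

theorem Blueprint.glue_dec (b : Blueprint) (i : Fin 2) (v : b.V) :
    b.glue (.dec i v) .N = (.ack v, 2) ∧ b.glue (.dec i v) .S = (.blank, 1) ∧
      b.glue (.dec i v) (sideOf i) = (.val v, 2) ∧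
      b.glue (.dec i v) (sideOf i).opp = (.blank, 0) := by
  fin_cases i <;> simp [glue, sideOf, Dir.opp]

namespace DistSystem

variable {V : Type u} {M : DistSystem.{u, v} V}

/-! ### Fair executions -/

/-- All events but the crashes, in turn. -/
def turn (n : ℕ) : Event := if n / 2 % 2 = 0 then .comp (Fin.ofNat 2 n) else .respond (Fin.ofNat 2 n)

theorem turn_not_crash (n : ℕ) : ¬ (turn n).IsCrash := by
  unfold turn
  split_ifs <;> exact id

theorem exists_turn {e : Event} (he : ¬ e.IsCrash) (n : ℕ) : ∃ m, n ≤ m ∧ turn m = e := by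
  rcases e with i | i | i
  · refine ⟨4 * n + i, by omega, ?_⟩
    rw [turn, if_pos (by omega), Event.comp.injEq, Fin.ext_iff]
    change (4 * n + i.val) % 2 = _
    omega
  · refine ⟨4 * n + 2 + i, by omega, ?_⟩
    rw [turn, if_neg (by omega), Event.respond.injEq, Fin.ext_iff]
    change (4 * n + 2 + i.val) % 2 = _
    omega
  · exact absurd trivial he

/-- Every event other than a crash gets its turn infinitely often and is taken if it is possible
then. -/
theorem exists_fairRun (C : M.Config) : ∃ run ev, M.FairRun C run ev := by
  classical
  let f : ℕ → M.Config → M.Config := fun n D =>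
    if h : ∃ D', Step D (turn n) D' then h.choose else D
  let run : ℕ → M.Config := fun n => Nat.rec C f n
  refine ⟨run, fun n => if ∃ D', Step (run n) (turn n) D' then some (turn n) else none,
    rfl, ?_, ?_, ?_, ?_⟩
  · intro n hn
    by_cases h : ∃ D', Step (run n) (turn n) D'
    · simp [h] at hn
    · exact dif_neg h
  · intro n e hn
    by_cases h : ∃ D', Step (run n) (turn n) D'
    · simp only [if_pos h, Option.some.injEq] at hn
      rw [← hn, show run (n + 1) = h.choose from dif_pos h]
      exact h.choose_spec
    · simp [h] at hn
  · intro n e hn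
    by_cases h : ∃ D', Step (run n) (turn n) D'
    · simp only [if_pos h, Option.some.injEq] at hn
      rw [← hn]
      exact turn_not_crash n
    · simp [h] at hn
  · intro e he n
    obtain ⟨m, hm, rfl⟩ := exists_turn he n
    refine ⟨m, hm, ?_⟩
    by_cases h : ∃ D', Step (run m) (turn m) D'
    · exact .inl (if_pos h)
    · exact .inr h

theorem FairRun.cons {C D : M.Config} {e : Event} (hs : Step C e D) (he : ¬ e.IsCrash)
    {run : ℕ → M.Config} {ev : ℕ → Option Event} (h : M.FairRun D run ev) :
    M.FairRun C (fun n => Nat.casesOn n C run) (fun n => Nat.casesOn n (some e) ev) := by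
  refine ⟨rfl, ?_, ?_, ?_, ?_⟩
  · rintro (_ | n) hn
    · cases hn
    · exact h.idle n hn
  · rintro (_ | n) e' hn
    · cases hn
      change Step C e (run 0)
      rw [h.start]
      exact hs
    · exact h.step n e' hn
  · rintro (_ | n) e' hn
    · cases hn
      exact he
    · exact h.no_crash n e' hn
  · intro e' he' n
    obtain ⟨m, hm, hf⟩ := h.fair e' he' n
    exact ⟨m + 1, by omega, hf⟩

/-- A fair run from `D`, preceded by the step from `C`, is a fair run from `C`; it does not meet `S`
at its start. -/
theorem MustAchieve.step {C D : M.Config} {S : Set M.Config} (h : M.MustAchieve C S) (hC : C ∉ S)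
    {e : Event} (hs : Step C e D) (he : ¬ e.IsCrash) : M.MustAchieve D S := by
  intro run ev hr
  obtain ⟨n, hn⟩ := h _ _ (hr.cons hs he)
  cases n with
  | zero => exact absurd hn hC
  | succ n => exact ⟨n, hn⟩

/-! ### Executions that a fair assembly sequence overtakes -/

variable [Finite V] {E : Finset (ℤ × ℤ)} {seq : ℕ → M.blueprint.tileSet.Assembly}
  {X : ℕ → M.blueprint.St} {x : M.blueprint.St}

theorem Inv.cont_of_pending {C : M.Config} (hC : Inv C) {i : Fin 2} {v : V}
    (hp : C.obj.port i = .pending v) {k : ℕ} (hk : k + 1 = C.state.len i) :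
    M.blueprint.cont i (C.state.s i) (C.state.label i k) (M.blueprint.cap k) :=
  (hC.cont_iff hk).2 (.inl ⟨v, hp⟩)

theorem Inv.exists_len_lt {C : M.Config} (hC : Inv C) (h : x.Follows C.blockages seq X) {n : ℕ}
    (hle : C.state.Le (X n)) {i : Fin 2}
    (hE : Blueprint.Free C.blockages (M.blueprint.pos i (C.state.len i)))
    (hc : ∀ k, k + 1 = C.state.len i →
      M.blueprint.cont i (C.state.s i) (C.state.label i k) (M.blueprint.cap k))
    (ha : C.state.len i = M.bound + 3 → (M.blueprint.prop i (C.state.s i)).isSome →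
      (X n).ans.isSome) :
    ∃ n', n ≤ n' ∧ C.state.len i < (X n').len i := by
  by_cases hlt : C.state.len i < (X n).len i
  · exact ⟨n, le_rfl, hlt⟩
  · have hl := hle.len i
    have h1 := hC.valid.one_le_len i
    obtain ⟨k, hk⟩ : ∃ k, k + 1 = C.state.len i := ⟨C.state.len i - 1, by omega⟩
    rw [← hk]
    refine h.grows (by omega) (hk ▸ hE) ?_ fun h2 h3 => ha (hk ▸ h2) (hle.s ▸ h3)
    rw [hle.label hC.valid (by omega), hle.s]
    exact hc k hk

theorem Inv.overtake_comp {C D : M.Config} (hC : Inv C) (h : x.Follows C.blockages seq X) {n : ℕ}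
    (hle : C.state.Le (X n)) {i : Fin 2} (hs : Step C (.comp i) D) :
    ∃ n', D.state.Le (X n') := by
  obtain ⟨n', hn, hlt⟩ := hC.exists_len_lt h hle (free_of_alive (step_comp hs).1 _)
    (fun k hk => hC.cont_of_comp hs hk) fun h1 h2 => absurd h1 (hC.len_ne_of_comp hs h2)
  have hle' := hle.trans (h.mono n n' hn)
  refine ⟨n', ?_⟩
  rw [state_comp hs]
  refine ⟨hle'.s, fun j => ?_, hle'.dec, hle'.ans⟩
  by_cases hj : j = i
  · subst hj
    simpa [Blueprint.St.setLen] using hlt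
  · simpa [Blueprint.St.setLen, hj] using hle'.len j

/-- Fairness brings the decision, then its spreading, then the answer tile. The decision of the
sequence is that of the execution because `hfirst` fixes its process, and the process fixes the
value. -/
theorem Inv.overtake_respond {C D : M.Config} (hC : Inv C) (h : x.Follows C.blockages seq X)
    {n : ℕ} (hle : C.state.Le (X n)) {i : Fin 2} (hs : Step C (.respond i) D)
    (hfirst : C.state.dec = none → ∀ n e, (X n).dec = some e → e.1 = i) :
    ∃ n', D.state.Le (X n') := by
  obtain ⟨v, hp, -⟩ := step_respond hs
  obtain ⟨hpr, hlen⟩ := (hC.pending_iff i).1 ⟨v, hp⟩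
  have hD := state_respond hC hp hs
  have hv := hC.prop_of_pending hp
  obtain ⟨n₁, hn₁, hdec⟩ : ∃ n₁, n ≤ n₁ ∧ ∃ e, D.state.dec = some e ∧ (X n₁).dec = some e := by
    cases hd : C.state.dec with
    | some e =>
      refine ⟨n, le_rfl, e, ?_, hle.dec e hd⟩
      rw [hD, if_neg (by simp [hd])]
      exact hd
    | none =>
      obtain ⟨n₁, hn₁, hsome⟩ := h.decides (n := n) (i := i) (free_mid C) (by rw [hle.s]; exact hv)
        ((show M.bound + 2 < C.state.len i by omega).trans_le (hle.len i))
      obtain ⟨⟨j, w⟩, he⟩ := Option.isSome_iff_exists.1 hsome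
      obtain rfl := hfirst hd n₁ _ he
      have h1 := ((h.valid n₁).prop_of_dec _ _ he).1
      rw [(hle.trans (h.mono n n₁ hn₁)).s, hv] at h1
      cases h1
      refine ⟨n₁, hn₁, _, ?_, he⟩
      rw [hD, if_pos hd]
      rfl
  obtain ⟨⟨j, w⟩, hDd, hXd⟩ := hdec
  obtain ⟨n₂, hn₂, hans⟩ := h.spreads (free_top C) hXd
  have hle₂ := hle.trans (h.mono n n₂ (hn₁.trans hn₂))
  obtain ⟨n₃, hn₃, hlt⟩ := hC.exists_len_lt h hle₂ (i := i) (by rw [hlen]; exact free_answer hlen)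
    (fun k hk => hC.cont_of_pending hp hk) fun _ _ => by rw [hans]; rfl
  have hle₃ := hle₂.trans (h.mono n₂ n₃ hn₃)
  have hle' := h.mono n₁ n₃ (hn₂.trans hn₃)
  refine ⟨n₃, ⟨?_, fun k => ?_, fun e he => ?_, fun w' hw => ?_⟩⟩
  · rw [hle₃.s, hD]
    split_ifs <;> rfl
  · have : D.state.len = Function.update C.state.len i (C.state.len i + 1) := by
      rw [hD]; split_ifs <;> rfl
    rw [this]
    by_cases hk : k = i
    · subst hk
      simpa using hlt
    · simpa [hk] using hle₃.len k
  · rw [hDd] at he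
    cases he
    exact hle'.dec _ hXd
  · rw [ans_eq, hDd] at hw
    cases hw
    exact (h.mono n₂ n₃ hn₃).ans _ hans

/-- A process that has crashed is stopped, unless it awaits an answer. -/
theorem not_free_of_crashed {C : M.Config} {i : Fin 2} (h : (C.proc i).crashed = true)
    (hl : C.state.len i ≠ M.bound + 3) :
    ¬ Blueprint.Free C.blockages (M.blueprint.pos i (C.state.len i)) := by
  intro hfree
  have h1 := hfree _ (crashed_iff.1 h)
  have hm : M.blueprint.m = M.bound := rfl
  unfold Blueprint.St.blk at h1
  split_ifs at h1 with h2
  · rcases (by omega : C.state.len i = M.blueprint.m + 2 ∨ C.state.len i = M.blueprint.m + 4)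
      with h3 | h3
    · rw [h3] at h1
      exact h1.2 _ (Blueprint.trap_adj_pending i)
    · rw [h3] at h1
      exact h1.2 _ (Blueprint.trap_adj_receive i)
  · exact h1.1 rfl

/-- A configuration between `C` and the stages of an assembly sequence. -/
structure Between (C : M.Config) (X : ℕ → M.blueprint.St) (D : M.Config) : Prop where
  reaches : M.Reaches C D
  blockages : D.blockages = C.blockages
  crashed : ∀ i, (D.proc i).crashed = (C.proc i).crashed
  le : C.state.Le D.state
  le_stage : ∃ n, D.state.Le (X n)

/-- Every event but a crash keeps an execution below the assembly sequence. Only the first answer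
could make the two diverge, and `hfirst` prevents this. -/
theorem InvokesAtMostOnce.between_step (hM : M.InvokesAtMostOnce) {C D D' : M.Config}
    (hC : M.Reachable C) (h : C.state.Follows C.blockages seq X) (hD : Between C X D) {e : Event}
    (hs : Step D e D') (he : ¬ e.IsCrash)
    (hfirst : ∀ i, e = .respond i → D.state.dec = none → ∀ n e, (X n).dec = some e → e.1 = i) :
    Between C X D' := by
  have hI := hM.inv (hC.trans hD.reaches)
  have hle := le_of_produces (hI.produces hs)
  obtain ⟨n, hn⟩ := hD.le_stage
  have h' := h
  rw [← hD.blockages] at h'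
  refine ⟨ReflTransGen.tail hD.reaches ⟨e, hs⟩, ?_, ?_, hD.le.trans hle, ?_⟩
  · rw [← hD.blockages]
    rcases e with i | i | i
    · exact blockages_comp hs
    · exact blockages_respond hI hs
    · exact absurd trivial he
  · intro j
    rw [← hD.crashed]
    rcases e with i | i | i
    · exact (step_comp hs).2.2.2.2.2 j
    · obtain ⟨-, -, -, -, -, hcr⟩ := step_respond hs
      exact hcr j
    · exact absurd trivial he
  · rcases e with i | i | i
    · exact hI.overtake_comp h' hn hs
    · exact hI.overtake_respond h' hn hs (hfirst i rfl)
    · exact absurd trivial he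

/-- The process that is answered first in an assembly sequence can be answered first in an
execution. -/
theorem InvokesAtMostOnce.step_first (hM : M.InvokesAtMostOnce) {C D : M.Config}
    (hC : M.Reachable C) (h : C.state.Follows C.blockages seq X) (hD : Between C X D) {n : ℕ}
    {i : Fin 2} {w : M.blueprint.V} (hX : (X n).dec = some (i, w)) (hd : D.state.dec = none) :
    (M.blueprint.prop i (D.state.s i)).isSome ∧ D.state.len i ≤ M.bound + 3 ∧
      ∃ e D', Step D e D' ∧ (e = .comp i ∨ e = .respond i) := by
  have hI := hM.inv (hC.trans hD.reaches)
  have hA : ¬ D.Answered i := by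
    intro hA
    have := Inv.dec_isSome_of_answered hA
    rw [hd] at this
    cases this
  obtain ⟨n', hn'⟩ := hD.le_stage
  have hXs : (X n).s = D.state.s :=
    (h.mono 0 n (Nat.zero_le n)).s.trans (by rw [h.zero, hD.le.s])
  obtain ⟨hprop, hl⟩ := (h.valid n).prop_of_dec i w hX
  rw [hXs] at hprop
  have hsome : (M.blueprint.prop i (D.state.s i)).isSome := by rw [hprop]; rfl
  have hlen : D.state.len i ≤ M.bound + 3 := by
    by_contra hc
    exact hA ((hI.answered_iff i).2 ⟨hsome, by omega⟩)
  refine ⟨hsome, hlen, ?_⟩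
  by_cases hp : ∃ v, D.obj.port i = .pending v
  · obtain ⟨v, hv⟩ := hp
    exact ⟨_, _, Step.respond hv, .inr rfl⟩
  · have hlt : D.state.len i ≠ M.bound + 3 := fun h3 => hp ((hI.pending_iff i).2 ⟨hsome, h3⟩)
    have hle := hD.le.len i
    -- If it had crashed before its invocation, its track would be blocked in the whole assembly
    -- sequence, which nevertheless contains its pending tile.
    have ha : (D.proc i).crashed = false := by
      by_contra hc
      have hc : (C.proc i).crashed = true := by
        rw [← hD.crashed]
        simpa using hc
      have := h.blocked n i (not_free_of_crashed hc (by omega))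
      have hm : M.blueprint.m = M.bound := rfl
      omega
    obtain ⟨v, hv⟩ := Option.isSome_iff_exists.1 ((hI.prop_isSome i).1 hsome)
    obtain ⟨y, hy, -⟩ := DetProc.pends_of_proposal hv
    have h1 := hI.len_of_some hv
    have h2 := DetProc.traj_isSome_of_le (show D.count i + 1 ≤ (M.proc i).time (D.ini i) by omega)
      (by rw [hy]; rfl)
    rw [DetProc.traj, hI.pre i hA] at h2
    obtain ⟨D', hs⟩ := exists_step_comp ha (fun v hv => hp ⟨v, hv⟩) h2
    exact ⟨_, _, hs, .inl rfl⟩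

/-- Only the process that decides in the assembly sequence is run until it is answered. As `S` is
not met on the way, it must still be achieved afterwards. -/
theorem InvokesAtMostOnce.exists_between_dec (hM : M.InvokesAtMostOnce) {C : M.Config}
    (hC : M.Reachable C) (h : C.state.Follows C.blockages seq X) {S : Set M.Config}
    (hS : ∀ D, Between C X D → D ∉ S) {n : ℕ} {i : Fin 2} {w : M.blueprint.V}
    (hX : (X n).dec = some (i, w)) {D : M.Config} (hD : Between C X D) (hDS : M.MustAchieve D S) :
    ∃ D, Between C X D ∧ M.MustAchieve D S ∧ D.state.dec.isSome := by
  have hfirst : ∀ n e, (X n).dec = some e → e.1 = i := by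
    intro n' e he
    rcases le_total n n' with hn | hn
    · rw [(h.mono _ _ hn).dec _ hX] at he
      cases he
      rfl
    · rw [(h.mono _ _ hn).dec _ he] at hX
      cases hX
      rfl
  -- The measure counts the computation steps left before the process is pending; its answer then
  -- ends the argument.
  induction hk : M.bound + 3 - D.state.len i using Nat.strong_induction_on generalizing D with
  | h k ih =>
    cases hd : D.state.dec with
    | some e => exact ⟨D, hD, hDS, by rw [hd]; rfl⟩
    | none =>
      have hI := hM.inv (hC.trans hD.reaches)
      obtain ⟨hprop, hlen, e, D', hs, he⟩ := hM.step_first hC h hD hX hd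
      have hcr : ¬ e.IsCrash := by rcases he with rfl | rfl <;> exact id
      have hD' : Between C X D' := by
        refine hM.between_step hC h hD hs hcr fun j hj _ n e' he' => ?_
        rcases he with rfl | rfl
        · cases hj
        · cases hj
          exact hfirst n e' he'
      have hDS' := hDS.step (hS D hD) hs hcr
      rcases he with rfl | rfl
      · have hne := hI.len_ne_of_comp hs hprop
        refine ih _ ?_ hD' hDS' rfl
        rw [state_comp hs]
        simp only [Blueprint.St.setLen, Function.update_self]
        omega
      · refine ⟨D', hD', hDS', ?_⟩
        obtain ⟨v, hp, -⟩ := step_respond hs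
        rw [state_respond hI hp hs, if_pos hd]
        rfl

theorem InvokesAtMostOnce.progress (hM : M.InvokesAtMostOnce) {C : M.Config} {S : Set M.Config}
    (hC : M.Reachable C) (hS : M.MustAchieve C S) {seq : ℕ → M.blueprint.tileSystem.Assembly}
    (hseq : C.tiles.FairSeq seq) :
    ∃ C' ∈ S, M.Reaches C C' ∧ ∃ n, C'.tiles.ProducesCleanly (seq n) := by
  have hI := hM.inv hC
  obtain ⟨X, h⟩ := hI.valid.exists_follows (Inv.clear C) hseq
  suffices hB : ∃ D, Between C X D ∧ D ∈ S by
    obtain ⟨D, hD, hDS⟩ := hB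
    obtain ⟨n, hn⟩ := hD.le_stage
    refine ⟨D, hDS, hD.reaches, n, TileSet.Assembly.ProducesCleanly.of_sub
      (hseq.producesCleanly n) _ hD.blockages ?_ ?_⟩
    · change (C.state.full C.blockages).Sub (D.state.full D.blockages)
      rw [hD.blockages]
      exact hD.le.sub_full hI.valid (hD.blockages ▸ Inv.clear D)
    · rw [h.eq n]
      change (D.state.full D.blockages).Sub ((X n).full C.blockages)
      rw [hD.blockages]
      exact hn.sub_full (hM.inv (hC.trans hD.reaches)).valid (h.clear n)
  by_contra hno
  have hno : ∀ D, Between C X D → D ∉ S := fun D h1 h2 => hno ⟨D, h1, h2⟩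
  have hC0 : Between C X C := ⟨ReflTransGen.refl, rfl, fun _ => rfl, .refl _, 0, by
    rw [h.zero]; exact .refl _⟩
  -- From `D` on, the execution cannot contradict the assembly sequence: either the decision has
  -- been made in agreement with it, or the sequence never decides.
  obtain ⟨D, hD, hDS, hdec⟩ : ∃ D, Between C X D ∧ M.MustAchieve D S ∧
      (D.state.dec = none → ∀ n, (X n).dec = none) := by
    by_cases hX : ∃ n e, (X n).dec = some e
    · obtain ⟨n, ⟨i, w⟩, hX⟩ := hX
      obtain ⟨D, h1, h2, h3⟩ := hM.exists_between_dec hC h hno hX hC0 hS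
      exact ⟨D, h1, h2, fun h4 => by rw [h4] at h3; cases h3⟩
    · refine ⟨C, hC0, hS, fun _ n => ?_⟩
      cases hd : (X n).dec with
      | none => rfl
      | some e => exact absurd ⟨n, e, hd⟩ hX
  -- Now any fair run stays below the assembly sequence; since it must meet `S`, this contradicts
  -- the assumption.
  obtain ⟨run, ev, hr⟩ := exists_fairRun D
  have hrun : ∀ k, Between C X (run k) ∧ D.state.Le (run k).state := by
    intro k
    induction k with
    | zero => rw [hr.start]; exact ⟨hD, .refl _⟩
    | succ k ih =>
      cases he : ev k with
      | none => rw [hr.idle k he]; exact ih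
      | some e =>
        have hs := hr.step k e he
        refine ⟨hM.between_step hC h ih.1 hs (hr.no_crash k e he) fun i _ hd n e' he' => ?_,
          ih.2.trans (le_of_produces ((hM.inv (hC.trans ih.1.reaches)).produces hs))⟩
        have hd' : D.state.dec = none := by
          cases hd' : D.state.dec with
          | none => rfl
          | some e => rw [ih.2.dec e hd'] at hd; cases hd
        rw [hdec hd' n] at he'
        cases he'
  obtain ⟨n, hn⟩ := hDS run ev hr
  exact hno _ (hrun n).1 hn

/-! ### The end -/

/-- A halted process has no successor tile, and the next site of a crashed one is impeded since it
is not waiting for an answer. With no pending invocation, any proposal shown at `mid` comes from an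
answered process, so `mid` is occupied, and `top` together with it. -/
theorem Inv.terminal {C : M.Config} (hC : Inv C) (h : M.AllStopped C) : C.tiles.Terminal := by
  rintro ⟨p, t, hp, hn, hs⟩
  have hp := Blueprint.St.full_eq_none.1 hp
  rw [show C.tiles.tile = C.state.full C.blockages from rfl, Blueprint.St.strengthAt_full] at hs
  have hpend : ∀ i, (M.blueprint.prop i (C.state.s i)).isSome → C.state.len i ≠ M.bound + 3 := by
    intro i h1 h2
    obtain ⟨v, hv⟩ := (hC.pending_iff i).2 ⟨h1, h2⟩
    exact (h i).2 v hv
  have hdec : ∀ i, (M.blueprint.prop i (C.state.s i)).isSome → M.bound + 2 < C.state.len i →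
      C.state.dec.isSome := by
    intro i h1 h2
    have := hpend i h1
    exact Inv.dec_isSome_of_answered ((hC.answered_iff i).2 ⟨h1, by omega⟩)
  rcases hC.valid.attach_cases hp.1 hs with ⟨i, k, hk, rfl, rfl, hc, ha⟩ | ⟨i, v, rfl, rfl, hv, hl⟩ |
    ⟨i, v, rfl, rfl, hd⟩
  · rcases (hC.cont_iff hk).1 hc with ⟨v, hv⟩ | hm
    · exact (h i).2 v hv
    · rcases (h i).1 with h1 | h1
      · have hport := (h i).2
        unfold DetProc.move Config.loc at hm
        unfold Config.action at h1
        cases hq : C.obj.port i with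
        | idle => simp [hq, h1] at hm
        | pending v => exact hport v hq
        | acked w => simp [hq, h1] at hm
      · refine not_free_of_crashed h1 (fun h2 => hpend i (hC.prop_isSome_of_len (by omega)) h2) ?_
        rw [← hk]
        intro q hq
        refine ⟨?_, fun d hd => hn d ?_⟩
        · rintro rfl
          exact hp.2 hq
        · rw [hd]; exact hq
  · have h1 := hdec i (by rw [hv]; rfl) hl
    have h2 := hp.1
    rw [Blueprint.St.asm_mid, Option.map_eq_none_iff] at h2
    rw [h2] at h1
    cases h1
  · have h2 := hp.1
    rw [Blueprint.St.asm_top, ans_eq, hd] at h2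
    cases h2

theorem crash_card {C C' : M.Config} {i : Fin 2} (h : Step C (.crash i) C') :
    C'.tiles.err.card = C.tiles.err.card + 1 := by
  obtain ⟨h1, h2⟩ := tiles_crash h
  change C'.blockages.card = C.blockages.card + 1
  rw [h1, h2]
  rfl

/-! ### The simulation and its decision site -/

theorem InvokesAtMostOnce.simulatesVia (hM : M.InvokesAtMostOnce) :
    M.blueprint.tileSystem.SimulatesVia M Config.tiles where
  injective _ hC _ hC' h := (hM.inv hC).tiles_injective (hM.inv hC') h
  stable _ hC := hM.stable hC
  initial _ hC := hC.producesCleanly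
  sound _ _ _ hC hs := ⟨(hM.inv hC).produces hs, (hM.inv hC).producesCleanly hs⟩
  complete _ _ hC hC' hno h := hno (hM.reaches_of_produces hC hC' h)
  progress _ _ hC hS _ hseq := hM.progress hC hS hseq
  crash _ _ _ _ hs := crash_card hs
  terminal _ hC h := (hM.inv hC).terminal h

theorem InvokesAtMostOnce.decidesAt (hM : M.InvokesAtMostOnce) :
    M.blueprint.tileSystem.DecidesAt M Config.tiles M.blueprint.mid
      (fun v => .val (equivShrink.{0} V v)) (fun v => .ack (equivShrink.{0} V v)) := by
  intro C hC
  have hI := hM.inv hC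
  have hmid : M.blueprint.mid ∉ C.blockages := fun h => (free_mid C _ h).1 rfl
  refine ⟨hmid, ?_, ?_, ?_⟩
  · rw [← dec_eq_none]
    change C.state.full C.blockages M.blueprint.mid = none ↔ _
    rw [Blueprint.St.full_eq_none, Blueprint.St.asm_mid, Option.map_eq_none_iff]
    exact and_iff_left hmid
  · intro i v hv
    have hd : C.state.dec = some (i, equivShrink.{0} V v) := by
      change C.obj.log.head?.map _ = _
      rw [hv]
      rfl
    obtain ⟨hN, hS, hi, ho⟩ := M.blueprint.glue_dec i (equivShrink.{0} V v)
    have ne : ∀ {t : M.blueprint.Tile} {d : Dir} {g : M.blueprint.Glue} {n : Fin 3},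
        M.blueprint.glue t d = (g, n) → n ≠ 0 → (M.blueprint.glue t d).2 ≠ 0 := by
      intro t d g n h hn
      rwa [h]
    refine ⟨.dec i (equivShrink.{0} V v), Blueprint.St.full_of_asm
      (by rw [Blueprint.St.asm_mid, hd]; rfl), ne hN (by decide), ne hS (by decide), ne hi (by decide),
      congrArg Prod.snd ho, congrArg Prod.fst hi, congrArg Prod.fst hN⟩
  · intro j w
    refine Iff.trans ?_ (hI.valid.ray_iff C.blockages j (equivShrink.{0} V w)).symm
    have hans : C.state.ans = some (equivShrink.{0} V w) ↔ C.decided = some w :=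
      (Option.map_injective (equivShrink.{0} V).injective).eq_iff (b := some w)
    refine Iff.trans ?_ (and_congr hans (hI.answered_iff j).symm).symm
    -- All entries of the log carry the decision, so a ray named after a value exists exactly if
    -- that value was the answer.
    have hlog : ∀ k w', (k, w') ∈ C.obj.log → C.decided = some w' := by
      intro k w' hk
      unfold Config.decided
      rcases hI.log with hl | ⟨i, v, hl⟩ | ⟨i, j, v, -, hl⟩ <;> rw [hl] at hk ⊢ <;>
        simp at hk ⊢ <;> grind
    constructor
    · exact fun h => ⟨hlog j w h, w, h⟩
    · rintro ⟨h1, w', hw'⟩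
      rw [hlog j w' hw'] at h1
      cases h1
      exact hw'

end DistSystem

theorem theorem3 {V : Type u} [Finite V] (M : DistSystem.{u, v} V) (hM : M.InvokesAtMostOnce) :
    ∃ (T : TileSystem) (h : M.Config → T.Assembly),
      T.SimulatesVia M h ∧
      ∃ (l : ℤ × ℤ) (val ack : V → T.Glue),
        Function.Injective val ∧ Function.Injective ack ∧ T.DecidesAt M h l val ack := by
  refine ⟨M.blueprint.tileSystem, DistSystem.Config.tiles, hM.simulatesVia, M.blueprint.mid,
    fun v => .val (equivShrink.{0} V v), fun v => .ack (equivShrink.{0} V v), ?_, ?_, hM.decidesAt⟩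
  · intro v w h
    injection h with h
    exact (equivShrink.{0} V).injective h
  · intro v w h
    injection h with h
    exact (equivShrink.{0} V).injective h
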